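/- Throughout, $\mathbb R^n_k=[0,\infty)^k\times\mathbb R^{n-k}$, manifolds with corners are locally modelled on $\mathbb R^n_k$ with smooth transition maps, and a subset $P\subset M$ is a *p-submanifold* if near each of its points there is a chart of $M$ with values in some $\mathbb R^n_k$ in which $P$ is given by the vanishing of some of the coordinates. For a closed p-submanifold $P$ let $[M:P]=(M\smallsetminus P)\sqcup \mathbb S(N^M_+P)$ be the blow-up of $M$ along $P$, where $\mathbb S(N^M_+P)$ is the inward pointing spherical normal bundle, and let $\beta_{M,P}:[M:P]\to M$ be the blow-down map. The pull-back of a closed set $Q\subset M$ is $\beta_{M,P}^*(Q)=\overline{\beta_{M,P}^{-1}(Q\smallsetminus P)}\subset[M:P]$. For a tuple $\mathcal P=(P_1,\dots,P_k)$ of closed subsets of $M$ with $P_1$ a closed p-submanifold put $\mathcal P'=(\beta_{M,P_1}^*(P_2),\dots,\beta_{M,P_1}^*(P_k))$. Recursively, $\mathcal P$ is *admissible* in $M$ if $P_1$ is a closed p-submanifold of $M$, no $P_i$ with $i>1$ is a proper subset of $P_1$, and $\mathcal P'$ is admissible in $[M:P_1]$ (the empty tuple being admissible). In this case the iterated blow-up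 is $[M:\mathcal P]=[[M:P_1]:\mathcal P']$ (with $[M:()]=M$); it contains $M\smallsetminus\bigcup\mathcal P$. A *smoothed distance function* to a closed p-submanifold $P$ in $M$ is a function $r_P:M\to[0,\infty)$ whose lift $r_P\circ\beta_{M,P}$ is a boundary defining function of $\beta_{M,P}^{-1}(P)$ in $[M:P]$, i.e. it is smooth and $\ge 0$, vanishes exactly on $\beta_{M,P}^{-1}(P)$, and has nonzero differential there. A *smoothed distance function* to an admissible tuple $\mathcal P$ ($k\ge1$) is a function $\rho_{\mathcal P}:M\to[0,\infty)$ which for $k=1$ is a smoothed distance function to $P_1$ and for $k>1$ satisfies $\rho_{\mathcal P}(x)=r_{P_1}(x)\,\rho_{\mathcal P'}(y)$ for all $x\in M$ and $y\in\beta_{M,P_1}^{-1}(x)$, for some smoothed distance functions $r_{P_1}$ to $P_1$ in $M$ and $\rho_{\mathcal P'}$ to $\mathcal P'$ in $[M:P_1]$. **Statement.** Let $M$ be a connected manifold with corners and let $\mathcal S$ be a clean semilattice of closed p-submanifolds of $M$, that is, a finite set of closed p-submanifolds of $M$ such that for all $P,Q\in\mathcal S$ we have $P\cap Q\in\mathcal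 S$ and $T_x(P\cap Q)=T_xP\cap T_xQ$ for every $x\in P\cap Q$. Let $\mathcal S$ be endowed with an admissible order, i.e. its elements are listed without repetition as an admissible tuple. Let $\emptyset\ne Y\in\mathcal S$, let $r_Y$ be a smoothed distance function to $Y$ in $M$, and let $\rho_{\mathcal S}$ be a smoothed distance function to $\mathcal S$ in $M$. Then $\rho_{\mathcal S}/r_Y$ is a well-defined function $M\smallsetminus\bigcup\mathcal S\to(0,\infty)$, and it extends to a smooth function on $[M:\mathcal S]$. -/

import Mathlib

open Set Function Topology
open scoped Manifold ContDiff

noncomputable section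

namespace Corners

universe u

/-- Euclidean space `ℝⁿ`. -/
abbrev Eu (n : ℕ) : Type := EuclideanSpace ℝ (Fin n)

/-- The model `[0, ∞)ⁿ ⊆ ℝⁿ` for manifolds with corners. Since `ℝ` is diffeomorphic to `(0, ∞)`,
every `[0, ∞)ᵏ × ℝⁿ⁻ᵏ` is diffeomorphic to an open subset of it, so manifolds with corners of
dimension `n` are the smooth manifolds over this model. -/
abbrev quad (n : ℕ) : ModelWithCorners ℝ (Eu n) (EuclideanQuadrant n) :=
  modelWithCornersEuclideanQuadrant n

/-- `[0, ∞)ᴷ × ℝ^(Kᶜ)`: the model `ℝⁿ_k`, with an arbitrary set `K` of `k` boundary coordinates. -/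
def corner {n : ℕ} (K : Set (Fin n)) : Set (Eu n) := {y | ∀ i ∈ K, 0 ≤ y i}

section Charts

variable {n : ℕ} {M : Type u} [TopologicalSpace M] [ChartedSpace (EuclideanQuadrant n) M]

/-- A chart with values in `corner K`: a diffeomorphism from an open subset of `M` onto a relatively
open subset of `corner K`. -/
structure IsCornerChart (K : Set (Fin n)) (φ : PartialEquiv M (Eu n)) : Prop where
  open_source : IsOpen φ.source
  target_eq : ∃ O : Set (Eu n), IsOpen O ∧ φ.target = O ∩ corner K
  smooth : ContMDiffOn (quad n) 𝓘(ℝ, Eu n) ∞ φ φ.source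
  smooth_symm : ContMDiffOn 𝓘(ℝ, Eu n) (quad n) ∞ φ.symm φ.target

/-- In the chart `φ`, the subset `P` is given by the vanishing of the coordinates in `J`. -/
structure IsAdapted (P : Set M) (K J : Set (Fin n)) (φ : PartialEquiv M (Eu n)) : Prop
    extends IsCornerChart K φ where
  image_eq : φ '' (P ∩ φ.source) = φ.target ∩ {y | ∀ i ∈ J, y i = 0}

/-- A p-submanifold of `M` (its dimension and boundary depth may vary from point to point). -/
def IsPSubmanifold (P : Set M) : Prop :=
  ∀ x ∈ P, ∃ (K J : Set (Fin n)) (φ : PartialEquiv M (Eu n)), IsAdapted P K J φ ∧ x ∈ φ.source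

/-- The velocities at time `0` of smooth curves `[0, ε) → M` that start at `x` and stay in `A`.
For `A = univ` this is the inward pointing tangent space `T_x⁺M`. -/
def velocities (A : Set M) (x : M) : Set (TangentSpace (quad n) x) :=
  {v | ∃ (γ : ℝ → M) (ε : ℝ), 0 < ε ∧ ContMDiffOn 𝓘(ℝ, ℝ) (quad n) ∞ γ (Ico 0 ε) ∧
    γ 0 = x ∧ (∀ t ∈ Ico 0 ε, γ t ∈ A) ∧
    (mfderivWithin 𝓘(ℝ, ℝ) (quad n) γ (Ico 0 ε) 0 (1 : ℝ) : Eu n) = v}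

/-- The tangent space `T_x P`, as a subspace of `T_x M`; the span is needed because `x` may be a
boundary point of `P`. -/
def tangentSpan (A : Set M) (x : M) : Submodule ℝ (TangentSpace (quad n) x) :=
  Submodule.span ℝ (velocities A x)

/-- The fibre at `x` of the inward pointing spherical normal bundle of `P`: the rays in the normal
space `T_x M / T_x P` that are spanned by the nonzero images of inward pointing tangent vectors. -/
def SphericalNormal (P : Set M) (x : M) : Type :=
  {ρ : Module.Ray ℝ (TangentSpace (quad n) x ⧸ tangentSpan (n := n) P x) //
    ∃ v ∈ velocities (n := n) univ x, ∃ h : (tangentSpan P x).mkQ v ≠ 0,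
      ρ = rayOfNeZero ℝ ((tangentSpan P x).mkQ v) h}

/-- The underlying set `(M ∖ P) ⊔ S(N₊P)` of the blow-up of `M` along `P`. -/
def BlowUp (n : ℕ) {M : Type u} [TopologicalSpace M] [ChartedSpace (EuclideanQuadrant n) M]
    (P : Set M) : Type u :=
  {x : M // x ∉ P} ⊕ (Σ x : P, SphericalNormal (n := n) P x.1)

/-- The blow-down map `[M : P] → M`. -/
def blowDown (P : Set M) : BlowUp n P → M :=
  Sum.elim (fun x => x.1) (fun q => q.1.1)

/-- The differential `T_x M → ℝⁿ` of a chart. -/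
def dChart (φ : M → Eu n) (x : M) : TangentSpace (quad n) x →L[ℝ] Eu n :=
  mfderiv (quad n) 𝓘(ℝ, Eu n) φ x

/-- For a point `x ∈ M ∖ P` this is `φ(x)`; for a point of the spherical normal bundle it is `dφ(v)`,
where `v` is an inward pointing vector that spans the given ray. If `P` is the vanishing locus of
the coordinates in `J`, then the coordinates in `J` of `dφ(v)` are well defined up to a common
positive factor, and only their signs and quotients will be used. -/
def normalCoord (P : Set M) (φ : M → Eu n) : BlowUp n P → Eu n :=
  Sum.elim (fun x => φ x.1)
    (fun q => dChart φ q.1.1 q.2.2.choose)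

open Classical in
/-- The projective coordinates of a point `q` of the blow-up, over the chart `φ` in which `P` is the
vanishing locus of the coordinates in `J`, in the region where the `i`-th normal coordinate is
positive (`i ∈ J`): the coordinates in `J` other than `i` are divided by the `i`-th one, all the
other coordinates (the `i`-th one included) are those of the image of `q` in `M`. -/
def projCoord (P : Set M) (J : Set (Fin n)) (i : Fin n) (φ : M → Eu n) (q : BlowUp n P) : Eu n :=
  WithLp.toLp 2 fun j =>
    if j ∈ J ∧ j ≠ i then normalCoord P φ q j / normalCoord P φ q i else φ (blowDown P q) j

open Classical in
/-- The open embedding `corner K → [0, ∞)ⁿ` that applies `exp` to the coordinates outside `K`. -/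
def toQuad (K : Set (Fin n)) (y : Eu n) : EuclideanQuadrant n :=
  ⟨WithLp.toLp 2 fun j => if j ∈ K then max (y j) 0 else Real.exp (y j), fun j => by
    by_cases h : j ∈ K <;> simp [h, (Real.exp_pos _).le]⟩

/-- Charts of the blow-up away from the exceptional set: charts of `M`, restricted to `M ∖ P`. -/
def regularCharts (P : Set M) : Set (PartialEquiv (BlowUp n P) (EuclideanQuadrant n)) :=
  {e | ∃ f ∈ atlas (EuclideanQuadrant n) M,
    e.source = {q | blowDown P q ∉ P ∧ blowDown P q ∈ f.source} ∧
    EqOn e (fun q => f (blowDown P q)) e.source}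

/-- Charts of the blow-up near the exceptional set: the projective coordinates, which take values in
the corner with boundary coordinates `K ∪ {i}`, for all charts `φ` adapted to `P`. -/
def projectiveCharts (P : Set M) : Set (PartialEquiv (BlowUp n P) (EuclideanQuadrant n)) :=
  {e | ∃ (K J : Set (Fin n)) (φ : PartialEquiv M (Eu n)), IsAdapted P K J φ ∧ ∃ i ∈ J,
    e.source = {q | blowDown P q ∈ φ.source ∧ 0 < normalCoord P φ q i} ∧
    EqOn e (fun q => toQuad (insert i K) (projCoord P J i φ q)) e.source}


theorem IsCornerChart.mdifferentiableAt {K : Set (Fin n)} {φ : PartialEquiv M (Eu n)}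
    (h : IsCornerChart K φ) {x : M} (hx : x ∈ φ.source) :
    MDifferentiableAt (quad n) 𝓘(ℝ, Eu n) φ x :=
  ((h.smooth x hx).contMDiffAt (h.open_source.mem_nhds hx)).mdifferentiableAt (by simp)

theorem hasDerivWithinAt_comp_curve {f : M → Eu n} {γ : ℝ → M} {ε : ℝ} (hε : 0 < ε)
    (hγ : ContMDiffOn 𝓘(ℝ, ℝ) (quad n) ∞ γ (Ico 0 ε))
    (hf : MDifferentiableAt (quad n) 𝓘(ℝ, Eu n) f (γ 0)) :
    HasDerivWithinAt (fun t => f (γ t)) (dChart f (γ 0)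
      (mfderivWithin 𝓘(ℝ, ℝ) (quad n) γ (Ico 0 ε) 0 (1 : ℝ))) (Ico 0 ε) 0 := by
  have h1 := ((hγ 0 ⟨le_rfl, hε⟩).mdifferentiableWithinAt (by simp)).hasMFDerivWithinAt
  have h2 := hf.hasMFDerivAt.comp_hasMFDerivWithinAt 0 h1
  let L : ℝ →L[ℝ] Eu n := (mfderiv (quad n) 𝓘(ℝ, Eu n) f (γ 0)).comp
    (mfderivWithin 𝓘(ℝ, ℝ) (quad n) γ (Ico 0 ε) 0)
  have h3 : HasFDerivWithinAt (fun t => f (γ t)) L (Ico 0 ε) 0 :=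
    hasMFDerivWithinAt_iff_hasFDerivWithinAt.1 h2
  exact h3.hasDerivWithinAt

theorem IsCornerChart.mfderiv_injective {K : Set (Fin n)} {φ : PartialEquiv M (Eu n)}
    (h : IsCornerChart K φ) {x : M} (hx : x ∈ φ.source) :
    Injective (dChart φ x) := by
  have h1 := (h.mdifferentiableAt hx).hasMFDerivAt
  have h2 := ((h.smooth_symm (φ x) (φ.map_source hx)).mdifferentiableWithinAt
    (by simp)).hasMFDerivWithinAt
  have h4 : HasMFDerivWithinAt (quad n) (quad n) (φ.symm ∘ φ) φ.source x
      ((mfderivWithin 𝓘(ℝ, Eu n) (quad n) φ.symm φ.target (φ x)).comp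
        (mfderiv (quad n) 𝓘(ℝ, Eu n) φ x)) :=
    HasMFDerivWithinAt.comp x h2 h1.hasMFDerivWithinAt fun y hy => φ.map_source hy
  have h5 := (h4.hasMFDerivAt (h.open_source.mem_nhds hx)).congr_of_eventuallyEq (f₁ := id)
    (Filter.eventuallyEq_of_mem (h.open_source.mem_nhds hx) fun y hy => (φ.left_inv hy).symm)
  have h6 := hasMFDerivAt_unique h5 (hasMFDerivAt_id x)
  intro v w hvw
  have h7 := DFunLike.congr_fun h6 v
  have h8 := DFunLike.congr_fun h6 w
  have h9 := congrArg (mfderivWithin 𝓘(ℝ, Eu n) (quad n) φ.symm φ.target (φ x)) hvw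
  exact h7.symm.trans (h9.trans h8)

theorem uniqueDiffWithinAt_Ico {ε : ℝ} (hε : 0 < ε) : UniqueDiffWithinAt ℝ (Ico (0 : ℝ) ε) 0 :=
  uniqueDiffOn_Ico 0 ε 0 ⟨le_rfl, hε⟩

theorem IsCornerChart.exists_velocity {K : Set (Fin n)} {φ : PartialEquiv M (Eu n)}
    (h : IsCornerChart K φ) {x : M} (hx : x ∈ φ.source) {w : Eu n}
    (hw : ∀ j ∈ K, φ x j = 0 → 0 ≤ w j) {A : Set M}
    (hA : ∀ t : ℝ, 0 ≤ t → φ x + t • w ∈ φ.target → φ.symm (φ x + t • w) ∈ A) :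
    ∃ v ∈ velocities A x, dChart φ x v = w := by
  obtain ⟨O, hO, hT⟩ := h.target_eq
  have hφx : φ x ∈ O ∩ corner K := hT ▸ φ.map_source hx
  have hcont : Continuous fun t : ℝ => φ x + t • w := by fun_prop
  have ev1 : ∀ᶠ t : ℝ in 𝓝 0, φ x + t • w ∈ O :=
    hcont.continuousAt.eventually_mem (by simpa using hO.mem_nhds hφx.1)
  have ev2 : ∀ᶠ t : ℝ in 𝓝 0, ∀ j ∈ K, 0 < φ x j → 0 < φ x j + t * w j := by
    rw [Filter.eventually_all]
    intro j
    by_cases hj : j ∈ K ∧ 0 < φ x j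
    · have : Continuous fun t : ℝ => φ x j + t * w j := by fun_prop
      have := this.continuousAt.eventually_mem (x := 0) (s := Ioi 0)
        (by simpa using Ioi_mem_nhds hj.2)
      filter_upwards [this] with t ht _ _ using ht
    · exact Filter.Eventually.of_forall fun t h1 h2 => absurd ⟨h1, h2⟩ hj
  obtain ⟨ε, hε, hball⟩ := Metric.eventually_nhds_iff.1 (ev1.and ev2)
  have hmem : ∀ t ∈ Ico 0 ε, φ x + t • w ∈ φ.target := by
    intro t ht
    have := hball (y := t) (by simpa [abs_of_nonneg ht.1] using ht.2)
    rw [hT]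
    refine ⟨this.1, fun j hj => ?_⟩
    rcases (hφx.2 j hj).eq_or_lt with h0 | h0
    · have := mul_nonneg ht.1 (hw j hj h0.symm)
      simpa [← h0] using this
    · simpa using (this.2 j hj h0).le
  set γ : ℝ → M := fun t => φ.symm (φ x + t • w) with hγdef
  have hγ0 : γ 0 = x := by simp [hγdef, φ.left_inv hx]
  have hγ : ContMDiffOn 𝓘(ℝ, ℝ) (quad n) ∞ γ (Ico 0 ε) := by
    refine h.smooth_symm.comp (t := φ.target) (f := fun t : ℝ => φ x + t • w) ?_ hmem
    exact (contMDiff_iff_contDiff.2 (by fun_prop)).contMDiffOn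
  refine ⟨_, ⟨γ, ε, hε, hγ, hγ0, fun t ht => hA t ht.1 (hmem t ht), rfl⟩, ?_⟩
  have h1 := hasDerivWithinAt_comp_curve (f := φ) hε hγ (hγ0.symm ▸ h.mdifferentiableAt hx)
  have h2 : HasDerivWithinAt (fun t => φ (γ t)) w (Ico 0 ε) 0 := by
    have : HasDerivWithinAt (fun t : ℝ => φ x + t • w) w (Ico 0 ε) 0 := by
      simpa using ((hasDerivAt_id (0 : ℝ)).smul_const w).const_add (φ x) |>.hasDerivWithinAt
    refine this.congr_of_mem (fun t ht => φ.right_inv (hmem t ht)) ⟨le_rfl, hε⟩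
  have h3 := (uniqueDiffWithinAt_Ico hε).eq_deriv _ h1 h2
  rw [hγ0] at h3
  exact h3

theorem IsAdapted.mem_iff {P : Set M} {K J : Set (Fin n)} {φ : PartialEquiv M (Eu n)}
    (h : IsAdapted P K J φ) {x : M} (hx : x ∈ φ.source) : x ∈ P ↔ ∀ j ∈ J, φ x j = 0 := by
  constructor
  · intro hP
    have : φ x ∈ φ '' (P ∩ φ.source) := ⟨x, ⟨hP, hx⟩, rfl⟩
    rw [h.image_eq] at this
    exact this.2
  · intro hJ
    have : φ x ∈ φ '' (P ∩ φ.source) := by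
      rw [h.image_eq]; exact ⟨φ.map_source hx, hJ⟩
    obtain ⟨y, ⟨hy, hys⟩, hyx⟩ := this
    exact φ.injOn hys hx hyx ▸ hy

theorem hasDerivWithinAt_coord {f : M → Eu n} {γ : ℝ → M} {ε : ℝ} (hε : 0 < ε)
    (hγ : ContMDiffOn 𝓘(ℝ, ℝ) (quad n) ∞ γ (Ico 0 ε))
    (hf : MDifferentiableAt (quad n) 𝓘(ℝ, Eu n) f (γ 0)) (j : Fin n) :
    HasDerivWithinAt (fun t => f (γ t) j) (dChart f (γ 0)
      (mfderivWithin 𝓘(ℝ, ℝ) (quad n) γ (Ico 0 ε) 0 (1 : ℝ)) j) (Ico 0 ε) 0 :=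
  (EuclideanSpace.proj j : Eu n →L[ℝ] ℝ).hasFDerivAt.comp_hasDerivWithinAt 0
    (hasDerivWithinAt_comp_curve hε hγ hf)

theorem IsAdapted.mem_tangentSpan_iff {P : Set M} {K J : Set (Fin n)}
    {φ : PartialEquiv M (Eu n)} (h : IsAdapted P K J φ) {x : M} (hx : x ∈ φ.source)
    (hP : x ∈ P) (v : TangentSpace (quad n) x) :
    v ∈ tangentSpan P x ↔ ∀ j ∈ J, dChart φ x v j = 0 := by
  constructor
  · intro hv j hj
    let ℓ : TangentSpace (quad n) x →ₗ[ℝ] ℝ :=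
      ((EuclideanSpace.proj j : Eu n →L[ℝ] ℝ) : Eu n →ₗ[ℝ] ℝ) ∘ₗ
        (dChart φ x : TangentSpace (quad n) x →ₗ[ℝ] Eu n)
    have hle : tangentSpan P x ≤ LinearMap.ker ℓ := by
      refine Submodule.span_le.2 ?_
      rintro _ ⟨γ, ε, hε, hγ, rfl, hA, rfl⟩
      have h1 := hasDerivWithinAt_coord (f := φ) hε hγ (h.mdifferentiableAt hx) j
      have h2 : HasDerivWithinAt (fun t => φ (γ t) j) 0 (Ico 0 ε) 0 := by
        refine (hasDerivWithinAt_const (0 : ℝ) (Ico 0 ε) (0 : ℝ)).congr_of_eventuallyEq ?_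
          ((h.mem_iff hx).1 hP j hj)
        have := (hγ 0 ⟨le_rfl, hε⟩).continuousWithinAt.eventually_mem
          (h.open_source.mem_nhds hx)
        filter_upwards [this, self_mem_nhdsWithin] with t ht ht'
        exact (h.mem_iff ht).1 (hA t ht') j hj
      exact (uniqueDiffWithinAt_Ico hε).eq_deriv _ h1 h2
    exact hle hv
  · intro hv
    set w : Eu n := dChart φ x v with hw
    have key : ∀ u : Eu n, (∀ j, 0 ≤ u j) → (∀ j ∈ J, u j = 0) →
        ∃ v ∈ velocities P x, dChart φ x v = u := by
      intro u hu huJ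
      refine h.exists_velocity hx (fun j _ _ => hu j) fun t ht hT => ?_
      refine (h.mem_iff (φ.map_target hT)).2 fun j hj => ?_
      rw [φ.right_inv hT]
      simp [huJ j hj, (h.mem_iff hx).1 hP j hj]
    obtain ⟨v₁, hv₁, h₁⟩ := key (WithLp.toLp 2 fun j => max (w j) 0) (by simp)
      (fun j hj => by simp [hv j hj])
    obtain ⟨v₂, hv₂, h₂⟩ := key (WithLp.toLp 2 fun j => max (-w j) 0) (by simp)
      (fun j hj => by simp [hv j hj])
    have : v = v₁ - v₂ := by
      apply h.mfderiv_injective hx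
      rw [map_sub, h₁, h₂, ← hw]
      ext j
      rcases le_total (w j) 0 with hj | hj
      · simp [hj]
      · simp [hj]
    rw [this]
    exact sub_mem (Submodule.subset_span hv₁) (Submodule.subset_span hv₂)

theorem IsCornerChart.nonneg_of_inward {K : Set (Fin n)} {φ : PartialEquiv M (Eu n)}
    (h : IsCornerChart K φ) {x : M} (hx : x ∈ φ.source) {v : TangentSpace (quad n) x}
    (hv : v ∈ velocities univ x) {j : Fin n} (hj : j ∈ K) (h0 : φ x j = 0) :
    0 ≤ dChart φ x v j := by
  obtain ⟨γ, ε, hε, hγ, rfl, -, rfl⟩ := hv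
  have h1 := hasDerivWithinAt_coord (f := φ) hε hγ (h.mdifferentiableAt hx) j
  obtain ⟨O, hO, hT⟩ := h.target_eq
  have ev := (hγ 0 ⟨le_rfl, hε⟩).continuousWithinAt.eventually_mem (h.open_source.mem_nhds hx)
  rw [hasDerivWithinAt_iff_tendsto_slope] at h1
  have hne : (𝓝[Ico 0 ε \ {0}] (0 : ℝ)).NeBot := by
    rw [Ico_sdiff_left]
    exact left_nhdsWithin_Ioo_neBot hε
  refine ge_of_tendsto h1 ?_
  filter_upwards [nhdsWithin_mono _ sdiff_subset ev, self_mem_nhdsWithin] with t ht ht'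
  have : φ (γ t) ∈ O ∩ corner K := hT ▸ φ.map_source ht
  rw [slope_def_field, h0]
  exact div_nonneg (by simpa using this.2 j hj) (by simpa using ht'.1.1)

open Classical in
/-- The blow-down map in projective coordinates. -/
def blowModel (J : Set (Fin n)) (i : Fin n) (z : Eu n) : Eu n :=
  WithLp.toLp 2 fun j => if j ∈ J ∧ j ≠ i then z i * z j else z j

open Classical in
/-- The normal direction with given projective coordinates. -/
def dirVec (J : Set (Fin n)) (i : Fin n) (z : Eu n) : Eu n :=
  WithLp.toLp 2 fun j => if j = i then 1 else if j ∈ J then z j else 0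

open Classical in
/-- The projection to the vanishing locus of the coordinates in `J`. -/
def baseVec (J : Set (Fin n)) (z : Eu n) : Eu n :=
  WithLp.toLp 2 fun j => if j ∈ J then 0 else z j

theorem continuous_blowModel (J : Set (Fin n)) (i : Fin n) : Continuous (blowModel J i) := by
  refine (PiLp.continuous_toLp 2 _).comp (continuous_pi fun j => ?_)
  split_ifs <;> fun_prop

theorem continuous_dirVec (J : Set (Fin n)) (i : Fin n) : Continuous (dirVec J i) := by
  refine (PiLp.continuous_toLp 2 _).comp (continuous_pi fun j => ?_)
  split_ifs <;> fun_prop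

theorem continuous_baseVec (J : Set (Fin n)) : Continuous (baseVec (n := n) J) := by
  refine (PiLp.continuous_toLp 2 _).comp (continuous_pi fun j => ?_)
  split_ifs <;> fun_prop

theorem blowModel_eq {J : Set (Fin n)} {i : Fin n} (hi : i ∈ J) (z : Eu n) :
    blowModel J i z = baseVec J z + z i • dirVec J i z := by
  ext j
  by_cases hj : j = i
  · subst hj; simp [blowModel, baseVec, dirVec, hi]
  · by_cases hJ : j ∈ J <;> simp [blowModel, baseVec, dirVec, hj, hJ]

theorem convex_corner (K : Set (Fin n)) : Convex ℝ (corner K) := by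
  intro x hx y hy a b ha hb _ i hi
  have h1 := mul_nonneg ha (hx i hi)
  have h2 := mul_nonneg hb (hy i hi)
  simpa using add_nonneg h1 h2

theorem uniqueDiffOn_inter_corner {O : Set (Eu n)} (hO : IsOpen O) (K : Set (Fin n)) :
    UniqueDiffOn ℝ (O ∩ corner K) := by
  rw [inter_comm]
  refine UniqueDiffOn.inter (uniqueDiffOn_convex (convex_corner K) ?_) hO
  refine ⟨WithLp.toLp 2 fun _ => 1, mem_interior.2 ⟨{y | ∀ i, 0 < y i}, ?_, ?_, ?_⟩⟩
  · exact fun y hy i _ => (hy i).le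
  · simp only [ofPred_forall]
    exact isOpen_iInter_of_finite fun i => isOpen_lt (by fun_prop) (by fun_prop)
  · simp

open Classical in
theorem continuousOn_ratio {K J : Set (Fin n)} {O : Set (Eu n)} (hO : IsOpen O) {g : Eu n → ℝ}
    (hg : ContDiffOn ℝ 1 g (O ∩ corner K))
    (hg0 : ∀ y ∈ O ∩ corner K, (∀ j ∈ J, y j = 0) → g y = 0) {i : Fin n} (hi : i ∈ J) :
    ContinuousOn (fun z => if 0 < z i then g (blowModel J i z) / z i else
      fderivWithin ℝ g (O ∩ corner K) (blowModel J i z) (dirVec J i z))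
      {z | 0 ≤ z i ∧ blowModel J i z ∈ O ∩ corner K} := by
  have hud := uniqueDiffOn_inter_corner hO K
  set A := O ∩ corner K with hA
  rintro z₀ ⟨hz₀, hz₀A⟩
  rcases hz₀.eq_or_lt with h0 | h0
  swap
  · have h1 : ContinuousWithinAt (fun z => g (blowModel J i z) / z i)
        {z | 0 ≤ z i ∧ blowModel J i z ∈ A} z₀ := by
      refine ContinuousWithinAt.div ?_ (by fun_prop) h0.ne'
      exact (hg.continuousOn _ hz₀A).comp (continuous_blowModel J i).continuousWithinAt
        fun z hz => hz.2
    have hev : ∀ᶠ z in 𝓝 z₀, 0 < (z : Eu n) i :=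
      (continuousAt_const (y := (0 : ℝ))).eventually_lt (by fun_prop) h0
    refine h1.congr_of_eventuallyEq ?_ (by simp [h0])
    filter_upwards [nhdsWithin_le_nhds hev] with z hz
    simp [hz]
  · set D₀ := fderivWithin ℝ g A (blowModel J i z₀) with hD₀
    have hbase : baseVec J z₀ = blowModel J i z₀ := by
      rw [blowModel_eq hi, ← h0]; simp
    rw [Metric.continuousWithinAt_iff']
    intro ε hε
    set C := ‖dirVec J i z₀‖ + 1 with hC
    have hCpos : 0 < C := by positivity
    have hcontD := (hg.continuousOn_fderivWithin hud le_rfl) _ hz₀A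
    obtain ⟨δ₁, hδ₁, hD⟩ := Metric.continuousWithinAt_iff.1 hcontD (ε / (2 * C)) (by positivity)
    obtain ⟨δ₂, hδ₂, hball⟩ := Metric.isOpen_iff.1 hO _ hz₀A.1
    set B := Metric.ball (blowModel J i z₀) (min δ₁ δ₂) ∩ corner K with hB
    have hBA : B ⊆ A := fun y hy => ⟨hball (Metric.ball_subset_ball (min_le_right _ _) hy.1), hy.2⟩
    have hBconv : Convex ℝ B := (convex_ball _ _).inter (convex_corner K)
    have hmin : 0 < min δ₁ δ₂ := lt_min hδ₁ hδ₂
    have hder : ∀ y ∈ B, HasFDerivWithinAt g (fderivWithin ℝ g A y) B y := fun y hy =>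
      ((hg.differentiableOn one_ne_zero y (hBA hy)).hasFDerivWithinAt).mono hBA
    have hbd : ∀ y ∈ B, ‖fderivWithin ℝ g A y - D₀‖ ≤ ε / (2 * C) := fun y hy => by
      have := hD (hBA hy) (lt_of_lt_of_le (Metric.mem_ball.1 hy.1) (min_le_left _ _))
      rw [dist_eq_norm] at this
      exact this.le
    have ev1 : ∀ᶠ z in 𝓝 z₀, blowModel J i z ∈ Metric.ball (blowModel J i z₀) (min δ₁ δ₂) :=
      (continuous_blowModel J i).continuousAt.eventually_mem (Metric.ball_mem_nhds _ hmin)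
    have ev2 : ∀ᶠ z in 𝓝 z₀, baseVec J z ∈ Metric.ball (blowModel J i z₀) (min δ₁ δ₂) :=
      (continuous_baseVec J).continuousAt.eventually_mem
        (by rw [hbase]; exact Metric.ball_mem_nhds _ hmin)
    have ev3 : ∀ᶠ z in 𝓝 z₀, ‖dirVec J i z‖ < C :=
      ((continuous_dirVec J i).norm.continuousAt).eventually_lt continuousAt_const
        (by rw [hC]; linarith)
    have ev4 : ∀ᶠ z in 𝓝 z₀, dist (D₀ (dirVec J i z)) (D₀ (dirVec J i z₀)) < ε / 2 :=
      ((D₀.continuous.comp (continuous_dirVec J i)).continuousAt).eventually_mem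
        (Metric.ball_mem_nhds _ (half_pos hε))
    filter_upwards [nhdsWithin_le_nhds ev1, nhdsWithin_le_nhds ev2, nhdsWithin_le_nhds ev3,
      nhdsWithin_le_nhds ev4, self_mem_nhdsWithin] with z h1 h2 h3 h4 hz
    have hzB : blowModel J i z ∈ B := ⟨h1, hz.2.2⟩
    have hpB : baseVec J z ∈ B := by
      refine ⟨h2, fun j hj => ?_⟩
      by_cases hJ : j ∈ J
      · simp [baseVec, hJ]
      · have := hz.2.2 j hj
        simpa [blowModel, baseVec, hJ] using this
    have hgp : g (baseVec J z) = 0 := hg0 _ (hBA hpB) fun j hj => by simp [baseVec, hj]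
    have main : ‖(if 0 < z i then g (blowModel J i z) / z i else
        fderivWithin ℝ g A (blowModel J i z) (dirVec J i z)) - D₀ (dirVec J i z)‖ ≤
        ε / (2 * C) * ‖dirVec J i z‖ := by
      split_ifs with hpos
      · have := hBconv.norm_image_sub_le_of_norm_hasFDerivWithin_le' hder hbd hpB hzB
        rw [hgp, blowModel_eq hi, add_sub_cancel_left, map_smul, norm_smul, sub_zero,
          Real.norm_of_nonneg hpos.le, ← blowModel_eq hi, smul_eq_mul] at this
        have e : g (blowModel J i z) / z i - D₀ (dirVec J i z) =
            (g (blowModel J i z) - z i * D₀ (dirVec J i z)) / z i := by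
          field_simp
        rw [e, norm_div, Real.norm_of_nonneg hpos.le, div_le_iff₀ hpos]
        linarith
      · rw [← sub_apply]
        exact (ContinuousLinearMap.le_opNorm _ _).trans
          (mul_le_mul_of_nonneg_right (hbd _ hzB) (norm_nonneg _))
    have e0 : (if 0 < z₀ i then g (blowModel J i z₀) / z₀ i else
        fderivWithin ℝ g A (blowModel J i z₀) (dirVec J i z₀)) = D₀ (dirVec J i z₀) := by
      simp [← h0, hD₀]
    rw [e0]
    refine lt_of_le_of_lt (dist_triangle _ (D₀ (dirVec J i z)) _) ?_
    rw [dist_eq_norm]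
    have : ε / (2 * C) * ‖dirVec J i z‖ ≤ ε / 2 := by
      calc ε / (2 * C) * ‖dirVec J i z‖ ≤ ε / (2 * C) * C := by gcongr
        _ = ε / 2 := by field_simp
    linarith

theorem blowDown_inr_mem {P : Set M} (q : Σ x : P, SphericalNormal (n := n) P x.1) :
    blowDown P (.inr q) ∈ P := q.1.2

theorem projCoord_self (P : Set M) (J : Set (Fin n)) (i : Fin n) (φ : M → Eu n)
    (q : BlowUp n P) : projCoord P J i φ q i = φ (blowDown P q) i := by
  simp [projCoord]

section Adapted

variable {P : Set M} {K J : Set (Fin n)} {φ : PartialEquiv M (Eu n)}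

theorem IsAdapted.coord_nonneg (h : IsAdapted P K J φ) {x : M} (hx : x ∈ φ.source) {j : Fin n}
    (hj : j ∈ K) : 0 ≤ φ x j := by
  obtain ⟨O, hO, hT⟩ := h.target_eq
  have : φ x ∈ O ∩ corner K := hT ▸ φ.map_source hx
  exact this.2 j hj

theorem IsAdapted.normalCoord_nonneg (h : IsAdapted P K J φ) {q : BlowUp n P}
    (hq : blowDown P q ∈ φ.source) {j : Fin n} (hj : j ∈ K) (hJ : j ∈ J) :
    0 ≤ normalCoord P φ q j := by
  rcases q with x | ⟨⟨x, hx⟩, ρ⟩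
  · exact h.coord_nonneg hq hj
  · exact h.nonneg_of_inward hq ρ.2.choose_spec.1 hj ((h.mem_iff hq).1 hx j hJ)

theorem IsAdapted.blowModel_projCoord (h : IsAdapted P K J φ) {i : Fin n}
    {q : BlowUp n P} (hq : blowDown P q ∈ φ.source) (hpos : 0 < normalCoord P φ q i) (hi : i ∈ J) :
    blowModel J i (projCoord P J i φ q) = φ (blowDown P q) := by
  ext j
  by_cases hj : j ∈ J ∧ j ≠ i
  · simp only [blowModel, hj, ne_eq, not_false_eq_true, and_self, if_true, projCoord_self]
    rcases q with x | ⟨⟨x, hx⟩, ρ⟩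
    · simp only [projCoord, hj, ne_eq, not_false_eq_true, and_self, if_true]
      exact mul_div_cancel₀ _ hpos.ne'
    · have h1 := (h.mem_iff hq).1 hx i hi
      have h2 := (h.mem_iff hq).1 hx j hj.1
      change φ x i * _ = φ x j
      change φ x i = 0 at h1
      change φ x j = 0 at h2
      rw [h1, h2, zero_mul]
  · simp only [blowModel, hj, if_false, projCoord]

theorem IsAdapted.projCoord_mem_corner (h : IsAdapted P K J φ) {i : Fin n}
    {q : BlowUp n P} (hq : blowDown P q ∈ φ.source) (hpos : 0 < normalCoord P φ q i) (hi : i ∈ J) :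
    projCoord P J i φ q ∈ corner (insert i K) := by
  intro j hj
  by_cases hj' : j ∈ J ∧ j ≠ i
  · have hjK : j ∈ K := (mem_insert_iff.1 hj).resolve_left hj'.2
    simp only [projCoord, hj', ne_eq, not_false_eq_true, and_self, if_true]
    exact div_nonneg (h.normalCoord_nonneg hq hjK hj'.1) hpos.le
  · simp only [projCoord, hj', if_false]
    rcases mem_insert_iff.1 hj with rfl | hj
    · rcases q with x | ⟨⟨x, hx⟩, ρ⟩
      · exact le_of_lt hpos
      · exact ((h.mem_iff hq).1 hx j hi).ge
    · exact h.coord_nonneg hq hj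

theorem normalCoord_eq {i : Fin n} {q : BlowUp n P} (hpos : 0 < normalCoord P φ q i)
    {j : Fin n} (hj : j ∈ J) :
    normalCoord P φ q j = normalCoord P φ q i * dirVec J i (projCoord P J i φ q) j := by
  by_cases hji : j = i
  · subst hji; simp [dirVec]
  · simp [dirVec, hji, hj, projCoord, mul_div_cancel₀ _ hpos.ne']

theorem IsAdapted.injOn_projCoord (h : IsAdapted P K J φ) {i : Fin n} (hi : i ∈ J) :
    InjOn (projCoord P J i φ) {q | blowDown P q ∈ φ.source ∧ 0 < normalCoord P φ q i} := by
  rintro q ⟨hq, hpos⟩ q' ⟨hq', hpos'⟩ heq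
  have hβ : blowDown P q = blowDown P q' := by
    apply φ.injOn hq hq'
    rw [← h.blowModel_projCoord hq hpos hi, ← h.blowModel_projCoord hq' hpos' hi, heq]
  have hN := fun j (hj : j ∈ J) => normalCoord_eq (J := J) hpos hj
  have hN' := fun j (hj : j ∈ J) => normalCoord_eq (J := J) hpos' hj
  rw [heq] at hN
  rcases q with ⟨x, hx⟩ | ⟨⟨x, hx⟩, ρ⟩ <;> rcases q' with ⟨x', hx'⟩ | ⟨⟨x', hx'⟩, ρ'⟩
  · change x = x' at hβ
    subst hβ; rfl
  · change x = x' at hβ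
    exact absurd (hβ ▸ hx') hx
  · change x = x' at hβ
    exact absurd (hβ ▸ hx) hx'
  · change x = x' at hβ
    subst hβ
    have hqx : x ∈ φ.source := hq
    have hρ := ρ.2.choose_spec.2
    have hρ' := ρ'.2.choose_spec.2
    obtain ⟨h1, e1⟩ := hρ
    obtain ⟨h2, e2⟩ := hρ'
    have : ρ = ρ' := by
      apply Subtype.ext
      rw [e1, e2, ray_eq_iff]
      set v := ρ.2.choose
      set v' := ρ'.2.choose
      have hc : 0 < dChart φ x v i / dChart φ x v' i := div_pos hpos hpos'
      have hmk : (tangentSpan P x).mkQ v =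
          (dChart φ x v i / dChart φ x v' i) • (tangentSpan P x).mkQ v' := by
        rw [← map_smul, ← sub_eq_zero, ← map_sub, Submodule.mkQ_apply,
          Submodule.Quotient.mk_eq_zero, h.mem_tangentSpan_iff hqx hx]
        intro j hj
        have a1 : dChart φ x v j = dChart φ x v i * _ := hN j hj
        have a2 : dChart φ x v' j = dChart φ x v' i * _ := hN' j hj
        have a3 : dChart φ x v' i ≠ 0 := hpos'.ne'
        rw [map_sub, map_smul, PiLp.sub_apply, PiLp.smul_apply, a1, a2, smul_eq_mul]
        field_simp
        simp
      rw [hmk]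
      exact (SameRay.refl _).pos_smul_left hc
    rw [this]

theorem IsAdapted.exists_projCoord_eq (h : IsAdapted P K J φ) {i : Fin n} (hi : i ∈ J) {z : Eu n}
    (hz : z ∈ corner (insert i K)) (hzT : blowModel J i z ∈ φ.target) :
    ∃ q : BlowUp n P, (blowDown P q ∈ φ.source ∧ 0 < normalCoord P φ q i) ∧
      projCoord P J i φ q = z := by
  set x := φ.symm (blowModel J i z) with hxdef
  have hx : x ∈ φ.source := φ.map_target hzT
  have hφx : φ x = blowModel J i z := φ.right_inv hzT
  have hbi : blowModel J i z i = z i := by simp [blowModel]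
  rcases (hz i (mem_insert _ _)).eq_or_lt with h0 | h0
  · have hxP : x ∈ P := by
      refine (h.mem_iff hx).2 fun j hj => ?_
      rw [hφx]
      by_cases hji : j = i
      · simp [blowModel, hji, ← h0]
      · simp [blowModel, hj, hji, ← h0]
    obtain ⟨w, hw, hdw⟩ := h.exists_velocity hx (w := dirVec J i z) (A := univ)
      (fun j hj _ => by
        by_cases hji : j = i
        · simp [dirVec, hji]
        · by_cases hJ : j ∈ J
          · simpa [dirVec, hji, hJ] using hz j (mem_insert_of_mem _ hj)
          · simp [dirVec, hji, hJ]) (fun _ _ _ => mem_univ _)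
    have hmk : (tangentSpan P x).mkQ w ≠ 0 := by
      rw [Submodule.mkQ_apply, Ne, Submodule.Quotient.mk_eq_zero, h.mem_tangentSpan_iff hx hxP]
      intro hall
      have := hall i hi
      rw [hdw] at this
      simp [dirVec] at this
    let ρ : SphericalNormal (n := n) P x := ⟨rayOfNeZero ℝ _ hmk, w, hw, hmk, rfl⟩
    set v := ρ.2.choose with hv
    obtain ⟨hv0, hray⟩ := ρ.2.choose_spec.2
    have hsame : SameRay ℝ ((tangentSpan P x).mkQ w) ((tangentSpan P x).mkQ v) :=
      (ray_eq_iff hmk hv0).1 hray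
    obtain ⟨r₁, r₂, hr₁, hr₂, hr⟩ := hsame.exists_pos hmk hv0
    have hN : ∀ j ∈ J, dChart φ x v j = r₁ / r₂ * dirVec J i z j := by
      intro j hj
      rw [← map_smul, ← map_smul, ← sub_eq_zero, ← map_sub, Submodule.mkQ_apply,
        Submodule.Quotient.mk_eq_zero, h.mem_tangentSpan_iff hx hxP] at hr
      have := hr j hj
      rw [map_sub, map_smul, map_smul, hdw, PiLp.sub_apply, PiLp.smul_apply,
        PiLp.smul_apply, smul_eq_mul, smul_eq_mul] at this
      field_simp
      linarith
    have hNi : dChart φ x v i = r₁ / r₂ := by rw [hN i hi]; simp [dirVec]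
    refine ⟨.inr ⟨⟨x, hxP⟩, ρ⟩, ⟨hx, ?_⟩, ?_⟩
    · change 0 < dChart φ x v i
      rw [hNi]; positivity
    · ext j
      by_cases hj : j ∈ J ∧ j ≠ i
      · simp only [projCoord, hj, ne_eq, not_false_eq_true, and_self, if_true]
        change dChart φ x v j / dChart φ x v i = z j
        rw [hNi, hN j hj.1]
        simp only [dirVec, hj, if_true, if_false]
        field_simp
      · simp only [projCoord, hj, if_false]
        change φ x j = z j
        rw [hφx]
        simp only [blowModel, hj, if_false]
  · have hxP : x ∉ P := fun hxP => by
      have := (h.mem_iff hx).1 hxP i hi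
      rw [hφx, hbi] at this
      exact h0.ne' this
    refine ⟨.inl ⟨x, hxP⟩, ⟨hx, ?_⟩, ?_⟩
    · change 0 < φ x i
      rwa [hφx, hbi]
    · ext j
      by_cases hj : j ∈ J ∧ j ≠ i
      · simp only [projCoord, hj, ne_eq, not_false_eq_true, and_self, if_true]
        change φ x j / φ x i = z j
        rw [hφx, hbi]
        simp only [blowModel, hj, ne_eq, not_false_eq_true, and_self, if_true]
        field_simp
      · simp only [projCoord, hj, if_false]
        change φ x j = z j
        rw [hφx]
        simp only [blowModel, hj, if_false]

end Adapted

open Classical in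
/-- A left inverse of `toQuad` on `corner K`. -/
def fromQuad (K : Set (Fin n)) (h : EuclideanQuadrant n) : Eu n :=
  WithLp.toLp 2 fun j => if j ∈ K then h.1 j else Real.log (h.1 j)

theorem fromQuad_toQuad {K : Set (Fin n)} {y : Eu n} (hy : y ∈ corner K) :
    fromQuad K (toQuad K y) = y := by
  ext j
  by_cases hj : j ∈ K
  · simp [fromQuad, toQuad, hj, hy j hj]
  · simp [fromQuad, toQuad, hj]

theorem toQuad_fromQuad {K : Set (Fin n)} {h : EuclideanQuadrant n} (hh : ∀ j ∉ K, 0 < h.1 j) :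
    toQuad K (fromQuad K h) = h := by
  ext j
  by_cases hj : j ∈ K
  · simp [fromQuad, toQuad, hj, h.2 j]
  · simp [fromQuad, toQuad, hj, Real.exp_log (hh j hj)]

theorem fromQuad_mem_corner (K : Set (Fin n)) (h : EuclideanQuadrant n) :
    fromQuad K h ∈ corner K := fun j hj => by simpa [fromQuad, hj] using h.2 j

theorem toQuad_pos (K : Set (Fin n)) (y : Eu n) {j : Fin n} (hj : j ∉ K) :
    0 < (toQuad K y).1 j := by
  simp [toQuad, hj, Real.exp_pos]

theorem continuous_toQuad (K : Set (Fin n)) : Continuous (toQuad (n := n) K) := by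
  refine Continuous.subtype_mk ((PiLp.continuous_toLp 2 _).comp (continuous_pi fun j => ?_)) _
  split_ifs <;> fun_prop

theorem continuous_quad_coord (j : Fin n) : Continuous fun h : EuclideanQuadrant n => h.1 j :=
  (EuclideanSpace.proj j : Eu n →L[ℝ] ℝ).continuous.comp continuous_subtype_val

theorem continuousOn_fromQuad (K : Set (Fin n)) :
    ContinuousOn (fromQuad (n := n) K) {h | ∀ j ∉ K, 0 < h.1 j} := by
  refine (PiLp.continuous_toLp 2 _).comp_continuousOn (continuousOn_pi.2 fun j => ?_)
  by_cases hj : j ∈ K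
  · simpa [hj] using (continuous_quad_coord j).continuousOn
  · simp only [hj, if_false]
    exact (continuous_quad_coord j).continuousOn.log fun h hh => (hh j hj).ne'

theorem isOpen_quad_pos (K : Set (Fin n)) :
    IsOpen {h : EuclideanQuadrant n | ∀ j ∉ K, 0 < h.1 j} := by
  simp only [ofPred_forall]
  exact isOpen_iInter_of_finite fun j => isOpen_iInter_of_finite fun _ =>
    isOpen_lt continuous_const (continuous_quad_coord j)

theorem IsCornerChart.dChart_change {K : Set (Fin n)} {φ φ' : PartialEquiv M (Eu n)}
    (h : IsCornerChart K φ) {O A : Set (Eu n)} (hO : IsOpen O) (hA : A = O ∩ corner K)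
    (hA' : A = φ.target ∩ φ.symm ⁻¹' φ'.source)
    (hψ : ContDiffOn ℝ 1 (fun y => φ' (φ.symm y)) A)
    {K' : Set (Fin n)} (h' : IsCornerChart K' φ') {x : M}
    (hx : x ∈ φ.source) (hx' : x ∈ φ'.source) (w : TangentSpace (quad n) x) (j : Fin n) :
    dChart φ' x w j = fderivWithin ℝ (fun y => φ' (φ.symm y) j) A (φ x) (dChart φ x w) := by
  have hxA : φ x ∈ A := by
    rw [hA']; exact ⟨φ.map_source hx, by simpa [φ.left_inv hx] using hx'⟩
  have hud : UniqueDiffWithinAt ℝ A (φ x) := by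
    rw [hA] at hxA ⊢; exact uniqueDiffOn_inter_corner hO K _ hxA
  have h1 := (hψ.differentiableOn one_ne_zero _ hxA).hasFDerivWithinAt
  have h2 := (EuclideanSpace.proj j : Eu n →L[ℝ] ℝ).hasFDerivAt.comp_hasFDerivWithinAt _ h1
  have h3 := h2.fderivWithin hud
  have hs : φ.source ∩ φ'.source ∈ 𝓝 x :=
    (h.open_source.inter h'.open_source).mem_nhds ⟨hx, hx'⟩
  have h4 : HasMFDerivWithinAt (quad n) 𝓘(ℝ, Eu n) ((fun y => φ' (φ.symm y)) ∘ φ)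
      (φ.source ∩ φ'.source) x _ :=
    HasMFDerivWithinAt.comp x (hasMFDerivWithinAt_iff_hasFDerivWithinAt.2 h1)
      (h.mdifferentiableAt hx).hasMFDerivAt.hasMFDerivWithinAt fun y hy => by
        rw [hA']; exact ⟨φ.map_source hy.1, by simpa [φ.left_inv hy.1] using hy.2⟩
  have h5 := (h4.hasMFDerivAt hs).congr_of_eventuallyEq (f₁ := φ')
    (Filter.eventuallyEq_of_mem hs fun y hy => by simp [φ.left_inv hy.1])
  have h6 := hasMFDerivAt_unique (h'.mdifferentiableAt hx').hasMFDerivAt h5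
  have h7 : dChart φ' x w = fderivWithin ℝ (fun y => φ' (φ.symm y)) A (φ x) (dChart φ x w) :=
    DFunLike.congr_fun h6 w
  have h8 := DFunLike.congr_fun h3 (dChart φ x w)
  rw [h7]
  exact h8.symm

theorem IsCornerChart.dChart_surjective {K : Set (Fin n)} {φ : PartialEquiv M (Eu n)}
    (h : IsCornerChart K φ) {x : M} (hx : x ∈ φ.source) : Surjective (dChart φ x) := by
  let L : TangentSpace (quad n) x →ₗ[ℝ] Eu n := (dChart φ x : _ →ₗ[ℝ] _)
  let L' : Eu n →ₗ[ℝ] Eu n := L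
  have : Injective L' := h.mfderiv_injective hx
  have h2 : Surjective L' := LinearMap.surjective_of_injective this
  exact h2

/-- The properties of the charts of the blow-up from which the continuity of the transition maps is
deduced. -/
structure IsCompatible (P : Set M) (e : PartialEquiv (BlowUp n P) (EuclideanQuadrant n)) :
    Prop where
  open_target : IsOpen e.target
  cont : ContinuousOn (fun h => blowDown P (e.symm h)) e.target
  ratio : ∀ (K J : Set (Fin n)) (φ : PartialEquiv M (Eu n)), IsAdapted P K J φ →
    ∀ h₀ ∈ e.target, blowDown P (e.symm h₀) ∈ φ.source →
    ∃ c : EuclideanQuadrant n → ℝ, (∀ h ∈ e.target, 0 < c h) ∧ ∀ j ∈ J,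
      ContinuousWithinAt (fun h => c h * normalCoord P φ (e.symm h) j) e.target h₀

theorem normalCoord_of_notMem {P : Set M} (φ : M → Eu n) {q : BlowUp n P}
    (hq : blowDown P q ∉ P) : normalCoord P φ q = φ (blowDown P q) := by
  rcases q with x | q
  · rfl
  · exact absurd q.1.2 hq

theorem IsCompatible.of_regular {P : Set M} (hP : IsClosed P)
    {e : PartialEquiv (BlowUp n P) (EuclideanQuadrant n)} (he : e ∈ regularCharts P) :
    IsCompatible P e := by
  obtain ⟨f, hf, hs, heq⟩ := he
  have fact : ∀ h ∈ e.target, blowDown P (e.symm h) ∉ P ∧ blowDown P (e.symm h) ∈ f.source ∧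
      blowDown P (e.symm h) = f.symm h := by
    intro h hh
    have h1 := e.map_target hh
    have h2 := heq h1
    rw [hs] at h1
    rw [e.right_inv hh] at h2
    refine ⟨h1.1, h1.2, ?_⟩
    have h3 := f.left_inv h1.2
    rw [← h3]
    exact congrArg f.symm h2.symm
  have hT : e.target = f.target ∩ f.symm ⁻¹' Pᶜ := by
    ext h
    constructor
    · intro hh
      obtain ⟨h1, h2, h3⟩ := fact h hh
      have h4 := heq (e.map_target hh)
      rw [e.right_inv hh] at h4
      refine ⟨by rw [h4]; exact f.map_source h2, ?_⟩
      rw [mem_preimage, ← h3]; exact h1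
    · rintro ⟨h1, h2⟩
      have h3 : (Sum.inl ⟨f.symm h, h2⟩ : BlowUp n P) ∈ e.source := by
        rw [hs]; exact ⟨h2, f.map_target h1⟩
      have h4 := heq h3
      have h5 : h = e (Sum.inl ⟨f.symm h, h2⟩) := by
        rw [h4]; exact (f.right_inv h1).symm
      rw [h5]; exact e.map_source h3
  have hcont : ContinuousOn (fun h => blowDown P (e.symm h)) e.target :=
    (f.continuousOn_symm.mono (by rw [hT]; exact inter_subset_left)).congr
      fun h hh => (fact h hh).2.2
  refine ⟨?_, hcont, ?_⟩
  · rw [hT]; exact f.isOpen_inter_preimage_symm hP.isOpen_compl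
  · intro K J φ h h₀ hh₀ hφ
    refine ⟨fun _ => 1, fun _ _ => one_pos, fun j _ => ?_⟩
    have h1 : ContinuousAt φ (blowDown P (e.symm h₀)) :=
      (h.smooth.continuousOn).continuousAt (h.open_source.mem_nhds hφ)
    have h2 : ContinuousWithinAt (fun h => φ (blowDown P (e.symm h)) j) e.target h₀ :=
      (EuclideanSpace.proj j : Eu n →L[ℝ] ℝ).continuous.continuousAt.comp_continuousWithinAt
        (ContinuousAt.comp_continuousWithinAt (f := fun h => blowDown P (e.symm h)) h1
          (hcont h₀ hh₀))
    refine h2.congr (fun h hh => ?_) ?_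
    · rw [one_mul, normalCoord_of_notMem φ (fact h hh).1]
    · rw [one_mul, normalCoord_of_notMem φ (fact h₀ hh₀).1]

theorem IsCompatible.of_projective {P : Set M}
    {e : PartialEquiv (BlowUp n P) (EuclideanQuadrant n)} (he : e ∈ projectiveCharts P) :
    IsCompatible P e := by
  classical
  obtain ⟨K, J, φ, hφ, i, hi, hs, heq⟩ := he
  set K₁ := insert i K with hK₁
  obtain ⟨O, hO, hφT⟩ := hφ.target_eq
  have src : ∀ h ∈ e.target, blowDown P (e.symm h) ∈ φ.source ∧
      0 < normalCoord P φ (e.symm h) i := by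
    intro h hh
    have := e.map_target hh
    rwa [hs] at this
  have fact : ∀ h ∈ e.target, h = toQuad K₁ (projCoord P J i φ (e.symm h)) := by
    intro h hh
    have := heq (e.map_target hh)
    rwa [e.right_inv hh] at this
  have fact2 : ∀ h ∈ e.target, projCoord P J i φ (e.symm h) = fromQuad K₁ h := by
    intro h hh
    conv_rhs => rw [fact h hh]
    exact (fromQuad_toQuad (hφ.projCoord_mem_corner (src h hh).1 (src h hh).2 hi)).symm
  have fact3 : ∀ h ∈ e.target, blowModel J i (fromQuad K₁ h) = φ (blowDown P (e.symm h)) := by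
    intro h hh
    rw [← fact2 h hh]
    exact hφ.blowModel_projCoord (src h hh).1 (src h hh).2 hi
  have hpos : ∀ h ∈ e.target, ∀ j ∉ K₁, 0 < h.1 j := by
    intro h hh j hj
    rw [fact h hh]; exact toQuad_pos _ _ hj
  have hcq : ContinuousOn (fun h => blowModel J i (fromQuad K₁ h))
      {h : EuclideanQuadrant n | ∀ j ∉ K₁, 0 < h.1 j} :=
    (continuous_blowModel J i).comp_continuousOn (continuousOn_fromQuad K₁)
  have hT : e.target = {h | ∀ j ∉ K₁, 0 < h.1 j} ∩
      (fun h => blowModel J i (fromQuad K₁ h)) ⁻¹' O := by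
    ext h
    constructor
    · intro hh
      refine ⟨hpos h hh, ?_⟩
      have : φ (blowDown P (e.symm h)) ∈ O ∩ corner K := hφT ▸ φ.map_source (src h hh).1
      rw [mem_preimage, fact3 h hh]; exact this.1
    · rintro ⟨h1, h2⟩
      have hc := fromQuad_mem_corner K₁ h
      have h3 : blowModel J i (fromQuad K₁ h) ∈ φ.target := by
        rw [hφT]
        refine ⟨h2, fun j hj => ?_⟩
        have hj' := hc j (mem_insert_of_mem _ hj)
        have hi' := hc i (mem_insert _ _)
        by_cases hJ : j ∈ J ∧ j ≠ i
        · simpa only [blowModel, hJ, ne_eq, not_false_eq_true, and_self, if_true]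
            using mul_nonneg hi' hj'
        · simpa only [blowModel, hJ, if_false] using hj'
      obtain ⟨q, hq, hqz⟩ := hφ.exists_projCoord_eq hi hc h3
      have hqs : q ∈ e.source := by rw [hs]; exact hq
      have : e q = h := by
        rw [heq hqs]
        change toQuad K₁ (projCoord P J i φ q) = h
        rw [hqz, toQuad_fromQuad h1]
      rw [← this]; exact e.map_source hqs
  have hTsub : e.target ⊆ {h | ∀ j ∉ K₁, 0 < h.1 j} := fun h hh => hpos h hh
  have hβ : ∀ h ∈ e.target,
      blowDown P (e.symm h) = φ.symm (blowModel J i (fromQuad K₁ h)) := by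
    intro h hh
    rw [fact3 h hh, φ.left_inv (src h hh).1]
  have hmaps : ∀ h ∈ e.target, blowModel J i (fromQuad K₁ h) ∈ φ.target := by
    intro h hh
    rw [fact3 h hh]; exact φ.map_source (src h hh).1
  have hcont : ContinuousOn (fun h => blowDown P (e.symm h)) e.target :=
    (hφ.smooth_symm.continuousOn.comp (hcq.mono hTsub) hmaps).congr hβ
  have hopen : IsOpen e.target := by
    rw [hT]; exact hcq.isOpen_inter_preimage (isOpen_quad_pos K₁) hO
  refine ⟨hopen, hcont, ?_⟩
  intro K' J' φ' hφ' h₀ hh₀ hx₀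
  refine ⟨fun h => if h ∈ e.target then (normalCoord P φ (e.symm h) i)⁻¹ else 1, ?_, ?_⟩
  · intro h hh
    simp only [hh, if_true]
    exact inv_pos.2 (src h hh).2
  intro j hj
  obtain ⟨u, hu, hu'⟩ := continuousOn_iff'.1 hφ.smooth_symm.continuousOn _ hφ'.open_source
  set A := φ.target ∩ φ.symm ⁻¹' φ'.source with hAdef
  have hA : A = (u ∩ O) ∩ corner K := by
    rw [hAdef, inter_comm, hu', hφT, inter_assoc]
  have hψ : ContDiffOn ℝ 1 (fun y => φ' (φ.symm y)) A := by
    have : ContMDiffOn 𝓘(ℝ, Eu n) 𝓘(ℝ, Eu n) ∞ (fun y => φ' (φ.symm y)) A :=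
      hφ'.smooth.comp (hφ.smooth_symm.mono inter_subset_left) fun y hy => hy.2
    exact (contMDiffOn_iff_contDiffOn.1 this).of_le (by simp)
  have hg : ContDiffOn ℝ 1 (fun y => φ' (φ.symm y) j) A :=
    (EuclideanSpace.proj j : Eu n →L[ℝ] ℝ).contDiff.comp_contDiffOn hψ
  have hg0 : ∀ y ∈ A, (∀ l ∈ J, y l = 0) → φ' (φ.symm y) j = 0 := by
    intro y hy hyJ
    have : φ.symm y ∈ P := (hφ.mem_iff (φ.map_target hy.1)).2 (by rwa [φ.right_inv hy.1])
    exact (hφ'.mem_iff hy.2).1 this j hj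
  have key := continuousOn_ratio (K := K) (hu.inter hO) (hA ▸ hg) (hA ▸ hg0) hi
  rw [← hA] at key
  have hinS : ∀ h ∈ e.target, blowDown P (e.symm h) ∈ φ'.source →
      fromQuad K₁ h ∈ {z : Eu n | 0 ≤ z i ∧ blowModel J i z ∈ A} := by
    intro h hh hx
    refine ⟨fromQuad_mem_corner K₁ h i (mem_insert _ _), hmaps h hh, ?_⟩
    rw [mem_preimage, ← hβ h hh]; exact hx
  have hev : ∀ᶠ h in 𝓝[e.target] h₀, blowDown P (e.symm h) ∈ φ'.source :=
    (hcont h₀ hh₀).eventually_mem (hφ'.open_source.mem_nhds hx₀)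
  set T₁ := e.target ∩ {h | blowDown P (e.symm h) ∈ φ'.source} with hT₁
  have hcw := (key _ (hinS h₀ hh₀ hx₀)).comp (t := {z : Eu n | 0 ≤ z i ∧ blowModel J i z ∈ A})
    (((continuousOn_fromQuad K₁).mono hTsub h₀ hh₀).mono
      (inter_subset_left : T₁ ⊆ e.target)) fun h hh => hinS h hh.1 hh.2
  have hcw' := hcw.mono_of_mem_nhdsWithin (s := e.target)
    (Filter.inter_mem self_mem_nhdsWithin hev)
  have heqn : ∀ h ∈ e.target, blowDown P (e.symm h) ∈ φ'.source →
      (if h ∈ e.target then (normalCoord P φ (e.symm h) i)⁻¹ else 1) *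
        normalCoord P φ' (e.symm h) j =
      if 0 < fromQuad K₁ h i then φ' (φ.symm (blowModel J i (fromQuad K₁ h))) j / fromQuad K₁ h i
      else fderivWithin ℝ (fun y => φ' (φ.symm y) j) A (blowModel J i (fromQuad K₁ h))
        (dirVec J i (fromQuad K₁ h)) := by
    intro h hh hx
    obtain ⟨hs1, hs2⟩ := src h hh
    have hzi : fromQuad K₁ h i = φ (blowDown P (e.symm h)) i := by
      rw [← fact2 h hh, projCoord_self]
    have hN := fun l (hl : l ∈ J) => normalCoord_eq (J := J) hs2 hl
    rw [← hβ h hh, fact3 h hh, if_pos hh, hzi]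
    rw [fact2 h hh] at hN
    generalize hqe : e.symm h = q at *
    rcases q with x | ⟨⟨x, hxP⟩, ρ⟩
    · have hpos' : 0 < φ (blowDown P (Sum.inl x : BlowUp n P)) i := hs2
      rw [if_pos hpos']
      exact (div_eq_inv_mul _ _).symm
    · have hx0 : φ x i = 0 := (hφ.mem_iff hs1).1 hxP i hi
      have : ¬ 0 < φ (blowDown P (Sum.inr ⟨⟨x, hxP⟩, ρ⟩ : BlowUp n P)) i := by
        change ¬ 0 < φ x i
        rw [hx0]; exact lt_irrefl _
      rw [if_neg this]
      set v := ρ.2.choose with hv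
      change (dChart φ x v i)⁻¹ * dChart φ' x v j = fderivWithin ℝ _ A (φ x) _
      have hsx : x ∈ φ.source := hs1
      have hsx' : x ∈ φ'.source := hx
      obtain ⟨w, hw⟩ := hφ.dChart_surjective hsx (dirVec J i (fromQuad K₁ h))
      rw [← hw, ← hφ.dChart_change (hu.inter hO) hA rfl hψ hφ'.toIsCornerChart hsx hsx']
      have hc : 0 < dChart φ x v i := hs2
      have hmem : v - dChart φ x v i • w ∈ tangentSpan P x := by
        refine (hφ.mem_tangentSpan_iff hsx hxP _).2 fun l hl => ?_
        have := hN l hl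
        change dChart φ x v l = dChart φ x v i * _ at this
        rw [map_sub, map_smul, PiLp.sub_apply, PiLp.smul_apply, hw, this, smul_eq_mul, sub_self]
      have := (hφ'.mem_tangentSpan_iff hsx' hxP _).1 hmem j hj
      rw [map_sub, map_smul, PiLp.sub_apply, PiLp.smul_apply, smul_eq_mul] at this
      rw [inv_mul_eq_div, div_eq_iff hc.ne']
      linarith
  refine hcw'.congr_of_eventuallyEq ?_ (heqn h₀ hh₀ hx₀)
  filter_upwards [hev, self_mem_nhdsWithin] with h hx hh
  exact heqn h hh hx

theorem exists_regularChart (P : Set M) (q : BlowUp n P) (hq : blowDown P q ∉ P) :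
    ∃ e ∈ regularCharts (n := n) P, q ∈ e.source := by
  have : Nonempty (BlowUp n P) := ⟨q⟩
  set f := chartAt (EuclideanQuadrant n) (blowDown P q) with hf
  have hinj : InjOn (fun q : BlowUp n P => f (blowDown P q))
      {q | blowDown P q ∉ P ∧ blowDown P q ∈ f.source} := by
    rintro q ⟨h1, h2⟩ q' ⟨h1', h2'⟩ h
    have h3 := f.injOn h2 h2' h
    rcases q with ⟨x, hx⟩ | q
    · rcases q' with ⟨x', hx'⟩ | q'
      · change x = x' at h3
        subst h3; rfl
      · exact absurd q'.1.2 h1'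
    · exact absurd q.1.2 h1
  exact ⟨hinj.toPartialEquiv _ _, ⟨f, chart_mem_atlas _ _, rfl, fun _ _ => rfl⟩,
    hq, mem_chart_source _ _⟩

open Classical in
/-- The reflection in the `i`-th coordinate. -/
def flipCoord (i : Fin n) : Eu n ≃ Eu n where
  toFun y := WithLp.toLp 2 fun j => if j = i then -y j else y j
  invFun y := WithLp.toLp 2 fun j => if j = i then -y j else y j
  left_inv y := by ext j; by_cases h : j = i <;> simp [h]
  right_inv y := by ext j; by_cases h : j = i <;> simp [h]

theorem contDiff_flipCoord (i : Fin n) : ContDiff ℝ ∞ (flipCoord i) := by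
  classical
  refine contDiff_euclidean.2 fun j => ?_
  by_cases h : j = i
  · simp only [flipCoord, Equiv.coe_fn_mk, h, if_true]; fun_prop
  · simp only [flipCoord, Equiv.coe_fn_mk, h, if_false]; fun_prop

theorem flipCoord_flipCoord (i : Fin n) (y : Eu n) : flipCoord i (flipCoord i y) = y :=
  (flipCoord i).left_inv y

theorem IsAdapted.flip {P : Set M} {K J : Set (Fin n)} {φ : PartialEquiv M (Eu n)}
    (h : IsAdapted P K J φ) {i : Fin n} (hi : i ∉ K) :
    IsAdapted P K J (φ.trans (flipCoord i).toPartialEquiv) := by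
  classical
  have hzero : ∀ y : Eu n, ∀ j, flipCoord i y j = 0 ↔ y j = 0 := by
    intro y j
    by_cases hj : j = i <;> simp [flipCoord, hj]
  have hcor : ∀ y : Eu n, flipCoord i y ∈ corner K ↔ y ∈ corner K := by
    intro y
    refine forall₂_congr fun j hj => ?_
    have : j ≠ i := fun e => hi (e ▸ hj)
    simp [flipCoord, this]
  have hT : (φ.trans (flipCoord i).toPartialEquiv).target = flipCoord i ⁻¹' φ.target := by
    ext y; simp [PartialEquiv.trans_target]; rfl
  have hS : (φ.trans (flipCoord i).toPartialEquiv).source = φ.source := by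
    simp [PartialEquiv.trans_source]
  refine ⟨⟨?_, ?_, ?_, ?_⟩, ?_⟩
  · rw [hS]; exact h.open_source
  · obtain ⟨O, hO, hO'⟩ := h.target_eq
    refine ⟨flipCoord i ⁻¹' O, hO.preimage (contDiff_flipCoord i).continuous, ?_⟩
    rw [hT, hO']
    ext y
    simp [hcor]
  · rw [hS]
    exact (contMDiff_iff_contDiff.2 (contDiff_flipCoord i)).comp_contMDiffOn h.smooth
  · rw [hT]
    exact h.smooth_symm.comp (contMDiff_iff_contDiff.2 (contDiff_flipCoord i)).contMDiffOn
      fun y hy => hy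
  · rw [hT, hS]
    ext y
    constructor
    · rintro ⟨x, ⟨hxP, hx⟩, rfl⟩
      have : φ x ∈ φ.target ∩ {y | ∀ i ∈ J, y i = 0} := h.image_eq ▸ ⟨x, ⟨hxP, hx⟩, rfl⟩
      refine ⟨?_, fun j hj => (hzero _ j).2 (this.2 j hj)⟩
      change flipCoord i (flipCoord i (φ x)) ∈ φ.target
      rw [flipCoord_flipCoord]; exact this.1
    · rintro ⟨h1, h2⟩
      have : flipCoord i y ∈ φ '' (P ∩ φ.source) := by
        rw [h.image_eq]; exact ⟨h1, fun j hj => (hzero _ j).2 (h2 j hj)⟩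
      obtain ⟨x, hx, hxy⟩ := this
      refine ⟨x, hx, ?_⟩
      change flipCoord i (φ x) = y
      rw [hxy, flipCoord_flipCoord]

theorem IsAdapted.dChart_flip {P : Set M} {K J : Set (Fin n)} {φ : PartialEquiv M (Eu n)}
    (h : IsAdapted P K J φ) {i : Fin n} (hi : i ∉ K) {x : M} (hx : x ∈ φ.source)
    {v : TangentSpace (quad n) x} (hv : v ∈ velocities univ x) :
    dChart (φ.trans (flipCoord i).toPartialEquiv) x v i = -dChart φ x v i := by
  obtain ⟨γ, ε, hε, hγ, rfl, -, rfl⟩ := hv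
  have h1 := hasDerivWithinAt_coord hε hγ ((h.flip hi).mdifferentiableAt
    (by simpa [PartialEquiv.trans_source] using hx)) i
  have h2 := (hasDerivWithinAt_coord hε hγ (h.mdifferentiableAt hx) i).fun_neg
  refine (uniqueDiffWithinAt_Ico hε).eq_deriv _ h1 (h2.congr_of_mem (fun t _ => ?_) ⟨le_rfl, hε⟩)
  simp [flipCoord]

theorem exists_projectiveChart {P : Set M} (hP : IsPSubmanifold (n := n) P) (q : BlowUp n P)
    (hq : blowDown P q ∈ P) : ∃ e ∈ projectiveCharts (n := n) P, q ∈ e.source := by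
  classical
  have : Nonempty (BlowUp n P) := ⟨q⟩
  have main : ∃ (K J : Set (Fin n)) (φ : PartialEquiv M (Eu n)), IsAdapted P K J φ ∧ ∃ i ∈ J,
      blowDown P q ∈ φ.source ∧ 0 < normalCoord P φ q i := by
    obtain ⟨K, J, φ, hφ, hx⟩ := hP _ hq
    rcases q with x | ⟨⟨x, hxP⟩, ρ⟩
    · exact absurd hq x.2
    · obtain ⟨h0, -⟩ := ρ.2.choose_spec.2
      have hx' : x ∈ φ.source := hx
      rw [Submodule.mkQ_apply, Ne, Submodule.Quotient.mk_eq_zero,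
        hφ.mem_tangentSpan_iff hx' hxP] at h0
      push Not at h0
      obtain ⟨i, hi, hne⟩ := h0
      rcases lt_or_gt_of_ne hne with hlt | hgt
      · have hiK : i ∉ K := fun hiK => by
          have := hφ.nonneg_of_inward hx' ρ.2.choose_spec.1 hiK ((hφ.mem_iff hx').1 hxP i hi)
          exact absurd hlt (not_lt.2 this)
        refine ⟨K, J, _, hφ.flip hiK, i, hi, by simpa [PartialEquiv.trans_source] using hx, ?_⟩
        change 0 < dChart _ x ρ.2.choose i
        have hd : dChart (φ.trans (flipCoord i).toPartialEquiv) x ρ.2.choose i =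
            - dChart φ x ρ.2.choose i := hφ.dChart_flip hiK hx' ρ.2.choose_spec.1
        rw [hd]
        exact neg_pos.2 hlt
      · exact ⟨K, J, φ, hφ, i, hi, hx, hgt⟩
  obtain ⟨K, J, φ, hφ, i, hi, h1, h2⟩ := main
  have hinj : InjOn (fun q => toQuad (insert i K) (projCoord P J i φ q))
      {q : BlowUp n P | blowDown P q ∈ φ.source ∧ 0 < normalCoord P φ q i} := by
    intro a ha b hb hab
    refine hφ.injOn_projCoord hi ha hb ?_
    have := congrArg (fromQuad (insert i K)) hab
    simpa only [fromQuad_toQuad (hφ.projCoord_mem_corner ha.1 ha.2 hi),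
      fromQuad_toQuad (hφ.projCoord_mem_corner hb.1 hb.2 hi)] using this
  exact ⟨hinj.toPartialEquiv _ _, ⟨K, J, φ, hφ, i, hi, rfl, fun _ _ => rfl⟩, h1, h2⟩

theorem IsCompatible.trans_regular {P : Set M} (hP : IsClosed P)
    {e e' : PartialEquiv (BlowUp n P) (EuclideanQuadrant n)} (he : IsCompatible P e)
    (he' : e' ∈ regularCharts P) :
    IsOpen (e.symm.trans e').source ∧ ContinuousOn (e.symm.trans e') (e.symm.trans e').source := by
  obtain ⟨f, hf, hs, heq⟩ := he'
  have hsrc : (e.symm.trans e').source =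
      e.target ∩ (fun h => blowDown P (e.symm h)) ⁻¹' (Pᶜ ∩ f.source) := by
    rw [PartialEquiv.trans_source, hs]; rfl
  refine ⟨?_, ?_⟩
  · rw [hsrc]
    exact he.cont.isOpen_inter_preimage he.open_target (hP.isOpen_compl.inter f.open_source)
  · have : ContinuousOn (fun h => f (blowDown P (e.symm h))) (e.symm.trans e').source := by
      rw [hsrc]
      exact f.continuousOn.comp (he.cont.mono inter_subset_left) fun h hh => hh.2.2
    exact this.congr fun h hh => heq hh.2

theorem IsCompatible.trans_projective {P : Set M}
    {e e' : PartialEquiv (BlowUp n P) (EuclideanQuadrant n)} (he : IsCompatible P e)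
    (he' : e' ∈ projectiveCharts P) :
    IsOpen (e.symm.trans e').source ∧ ContinuousOn (e.symm.trans e') (e.symm.trans e').source := by
  classical
  obtain ⟨K, J, φ, hφ, i, hi, hs, heq⟩ := he'
  have hsrc : ∀ h, h ∈ (e.symm.trans e').source ↔
      h ∈ e.target ∧ blowDown P (e.symm h) ∈ φ.source ∧ 0 < normalCoord P φ (e.symm h) i := by
    intro h
    rw [PartialEquiv.trans_source, hs]; rfl
  refine ⟨isOpen_iff_mem_nhds.2 fun h₀ hh₀ => ?_, fun h₀ hh₀ => ?_⟩
  · obtain ⟨hT, hx, hpos⟩ := (hsrc h₀).1 hh₀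
    obtain ⟨c, hc, hcont⟩ := he.ratio K J φ hφ h₀ hT hx
    have n1 := he.open_target.mem_nhds hT
    have e1 : ∀ᶠ h in 𝓝 h₀, blowDown P (e.symm h) ∈ φ.source :=
      ((he.cont h₀ hT).continuousAt n1).eventually_mem (hφ.open_source.mem_nhds hx)
    have e2 : ∀ᶠ h in 𝓝 h₀, c h * normalCoord P φ (e.symm h) i ∈ Ioi (0 : ℝ) :=
      ((hcont i hi).continuousAt n1).eventually_mem (Ioi_mem_nhds (mul_pos (hc h₀ hT) hpos))
    filter_upwards [n1, e1, e2] with h h1 h2 h3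
    exact (hsrc h).2 ⟨h1, h2, (mul_pos_iff_of_pos_left (hc h h1)).1 h3⟩
  · obtain ⟨hT, hx, hpos⟩ := (hsrc h₀).1 hh₀
    obtain ⟨c, hc, hcont⟩ := he.ratio K J φ hφ h₀ hT hx
    have hsub : (e.symm.trans e').source ⊆ e.target := fun h hh => ((hsrc h).1 hh).1
    have key : ContinuousWithinAt (fun h => toQuad (insert i K) (projCoord P J i φ (e.symm h)))
        (e.symm.trans e').source h₀ := by
      refine (continuous_toQuad _).continuousAt.comp_continuousWithinAt
        (f := fun h => projCoord P J i φ (e.symm h)) ?_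
      refine (PiLp.continuous_toLp 2 _).continuousAt.comp_continuousWithinAt
        (continuousWithinAt_pi.2 fun j => ?_)
      by_cases hj : j ∈ J ∧ j ≠ i
      · have hq : ContinuousWithinAt (fun h => (c h * normalCoord P φ (e.symm h) j) /
            (c h * normalCoord P φ (e.symm h) i)) (e.symm.trans e').source h₀ :=
          ((hcont j hj.1).mono hsub).div ((hcont i hi).mono hsub) (mul_pos (hc h₀ hT) hpos).ne'
        refine hq.congr (fun h hh => ?_) ?_
        · rw [if_pos hj, mul_div_mul_left _ _ (hc h (hsub hh)).ne']
        · rw [if_pos hj, mul_div_mul_left _ _ (hc h₀ hT).ne']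
      · have h1 : ContinuousAt φ (blowDown P (e.symm h₀)) :=
          (hφ.smooth.continuousOn).continuousAt (hφ.open_source.mem_nhds hx)
        have h2 : ContinuousWithinAt (fun h => φ (blowDown P (e.symm h)) j) e.target h₀ :=
          (EuclideanSpace.proj j : Eu n →L[ℝ] ℝ).continuous.continuousAt.comp_continuousWithinAt
            (ContinuousAt.comp_continuousWithinAt (f := fun h => blowDown P (e.symm h)) h1
              (he.cont h₀ hT))
        refine (h2.mono hsub).congr (fun h hh => ?_) ?_
        · rw [if_neg hj]
        · rw [if_neg hj]
    exact key.congr (fun h hh => heq hh.2) (heq hh₀.2)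

open Classical in
/-- The atlas of the blow-up of `M` along a closed p-submanifold `P`. -/
def blowUpCore {P : Set M} (hc : IsClosed P) (hP : IsPSubmanifold (n := n) P) :
    ChartedSpaceCore (EuclideanQuadrant n) (BlowUp n P) where
  atlas := regularCharts P ∪ projectiveCharts P
  chartAt q := if hq : blowDown P q ∈ P then (exists_projectiveChart hP q hq).choose
    else (exists_regularChart P q hq).choose
  mem_chart_source q := by
    by_cases hq : blowDown P q ∈ P
    · rw [dif_pos hq]; exact (exists_projectiveChart hP q hq).choose_spec.2
    · rw [dif_neg hq]; exact (exists_regularChart P q hq).choose_spec.2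
  chart_mem_atlas q := by
    by_cases hq : blowDown P q ∈ P
    · rw [dif_pos hq]; exact .inr (exists_projectiveChart hP q hq).choose_spec.1
    · rw [dif_neg hq]; exact .inl (exists_regularChart P q hq).choose_spec.1
  open_source e e' he he' := by
    have h1 : IsCompatible P e := he.elim (.of_regular hc) .of_projective
    exact he'.elim (fun h => (h1.trans_regular hc h).1) (fun h => (h1.trans_projective h).1)
  continuousOn_toFun e e' he he' := by
    have h1 : IsCompatible P e := he.elim (.of_regular hc) .of_projective
    exact he'.elim (fun h => (h1.trans_regular hc h).2) (fun h => (h1.trans_projective h).2)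

end Charts

/-- A bundled space with charts in `[0, ∞)ⁿ`. It serves to iterate the blow-up: the spaces that
occur below are a manifold with corners `M` (whose charts are smoothly compatible) and the spaces
obtained from it by successive blow-ups. -/
structure CornerSpace (n : ℕ) : Type (u + 1) where
  carrier : Type u
  [top : TopologicalSpace carrier]
  [charted : ChartedSpace (EuclideanQuadrant n) carrier]

instance {n : ℕ} : CoeSort (CornerSpace.{u} n) (Type u) := ⟨CornerSpace.carrier⟩

attribute [instance] CornerSpace.top CornerSpace.charted

section Iterated

variable {n : ℕ}

/-- A closed p-submanifold. -/
structure IsClosedPSubmanifold {M : CornerSpace.{u} n} (P : Set M) : Prop where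
  isClosed : IsClosed P
  isPSubmanifold : IsPSubmanifold (n := n) P

/-- The blow-up `[M : P]` of `M` along a closed p-submanifold `P`, with the topology and the charts
given by the atlas `blowUpCore`. -/
def blowUp {M : CornerSpace.{u} n} {P : Set M} (h : IsClosedPSubmanifold P) : CornerSpace.{u} n :=
  letI c := blowUpCore h.isClosed h.isPSubmanifold
  { carrier := BlowUp n P
    top := c.toTopologicalSpace
    charted := c.toChartedSpace }

/-- The blow-down map `[M : P] → M`. -/
def blowDownMap {M : CornerSpace.{u} n} {P : Set M} (h : IsClosedPSubmanifold P) :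
    blowUp h → M := blowDown P

/-- The pull-back (lifting) of `Q` to `[M : P]`: the closure of the preimage of `Q ∖ P`. -/
def pullback {M : CornerSpace.{u} n} {P : Set M} (h : IsClosedPSubmanifold P) (Q : Set M) :
    Set (blowUp h) := closure (blowDownMap h ⁻¹' (Q \ P))

/-- A `k`-tuple `(P₀, …)` is blow-up-suitable if `P₀` is a closed p-submanifold and the pull-back of
the remaining entries to `[M : P₀]` is blow-up-suitable. -/
def IsSuitable : (k : ℕ) → (M : CornerSpace.{u} n) → (Fin k → Set M) → Prop
  | 0, _, _ => True
  | k + 1, _, P => ∃ h : IsClosedPSubmanifold (P 0),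
      IsSuitable k (blowUp h) fun i => pullback h (P i.succ)

/-- A `k`-tuple `(P₀, …)` is admissible if `P₀` is a closed p-submanifold, no other entry is a proper
subset of `P₀`, and the pull-back of the remaining entries to `[M : P₀]` is admissible. -/
def IsAdmissible : (k : ℕ) → (M : CornerSpace.{u} n) → (Fin k → Set M) → Prop
  | 0, _, _ => True
  | k + 1, _, P => ∃ h : IsClosedPSubmanifold (P 0), (∀ i : Fin k, ¬ P i.succ ⊂ P 0) ∧
      IsAdmissible k (blowUp h) fun i => pullback h (P i.succ)

theorem IsAdmissible.isSuitable : ∀ {k : ℕ} {M : CornerSpace.{u} n} {P : Fin k → Set M},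
    IsAdmissible k M P → IsSuitable k M P
  | 0, _, _, _ => trivial
  | _ + 1, _, _, ⟨h, _, h'⟩ => ⟨h, h'.isSuitable⟩

/-- The iterated blow-up `[M : P₀, P₁, …] = [[M : P₀] : pull-back of (P₁, …)]`. -/
def iteratedBlowUp : (k : ℕ) → (M : CornerSpace.{u} n) → (P : Fin k → Set M) →
    IsSuitable k M P → CornerSpace.{u} n
  | 0, M, _, _ => M
  | k + 1, _, P, h => iteratedBlowUp k (blowUp h.fst) (fun i => pullback h.fst (P i.succ)) h.snd

/-- The blow-down map `[M : P₀, P₁, …] → M`. It is a bijection over the complement of the union of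
the `Pᵢ` (the identity, under the usual identification). -/
def iteratedBlowDown : (k : ℕ) → (M : CornerSpace.{u} n) → (P : Fin k → Set M) →
    (h : IsSuitable k M P) → iteratedBlowUp k M P h → M
  | 0, _, _, _ => id
  | k + 1, _, P, h => fun q => blowDownMap h.fst
      (iteratedBlowDown k (blowUp h.fst) (fun i => pullback h.fst (P i.succ)) h.snd q)

theorem continuous_blowDownMap {M : CornerSpace.{u} n} {P : Set M} (h : IsClosedPSubmanifold P) :
    Continuous (blowDownMap h) := by
  refine continuous_iff_continuousAt.2 fun q => ?_
  let c := blowUpCore h.isClosed h.isPSubmanifold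
  let e : OpenPartialHomeomorph (blowUp h) (EuclideanQuadrant n) := chartAt (EuclideanQuadrant n) q
  have hq : q ∈ e.source := mem_chart_source _ q
  have hcompat : IsCompatible P (c.chartAt q) :=
    (c.chart_mem_atlas q).elim (.of_regular h.isClosed) .of_projective
  have h1 : ContinuousOn (fun y => blowDownMap h (e.symm y)) e.target := hcompat.cont
  have h2 : ContinuousAt (fun q' => blowDownMap h (e.symm (e q'))) q :=
    ContinuousAt.comp (f := e) (g := fun y => blowDownMap h (e.symm y))
      (h1.continuousAt (e.open_target.mem_nhds (e.map_source hq))) (e.continuousAt hq)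
  refine h2.congr (Filter.eventuallyEq_of_mem (e.open_source.mem_nhds hq) fun q' hq' => ?_)
  simp only [e.left_inv hq']

/-- The complement of the union of the `Pᵢ` is identified with a subset of the iterated blow-up. -/
theorem existsUnique_iteratedBlowDown : ∀ (k : ℕ) (M : CornerSpace.{u} n) (P : Fin k → Set M)
    (h : IsSuitable k M P), (∀ i, IsClosed (P i)) → ∀ x ∉ ⋃ i, P i,
    ∃! q, iteratedBlowDown k M P h q = x
  | 0, _, _, _, _, x, _ => ⟨x, rfl, fun _ hq => hq⟩
  | k + 1, M, P, h, hc, x, hx => by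
    have hx' : ∀ i, x ∉ P i := fun i hi => hx (mem_iUnion.2 ⟨i, hi⟩)
    let y : blowUp h.fst := (Sum.inl ⟨x, hx' 0⟩ : BlowUp n (P 0))
    have hy : y ∉ ⋃ i : Fin k, pullback h.fst (P i.succ) := by
      intro hy
      obtain ⟨i, hi⟩ := mem_iUnion.1 hy
      have hsub : pullback h.fst (P i.succ) ⊆ blowDownMap h.fst ⁻¹' P i.succ :=
        closure_minimal (preimage_mono sdiff_subset)
          ((hc i.succ).preimage (continuous_blowDownMap h.fst))
      exact hx' i.succ (hsub hi)
    obtain ⟨q, hq, huniq⟩ := existsUnique_iteratedBlowDown k (blowUp h.fst)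
      (fun i => pullback h.fst (P i.succ)) h.snd (fun _ => isClosed_closure) y hy
    refine ⟨q, congrArg (blowDownMap h.fst) hq, fun q' hq' => huniq q' ?_⟩
    have h0 : blowDownMap h.fst (iteratedBlowDown k (blowUp h.fst)
      (fun i => pullback h.fst (P i.succ)) h.snd q') = x := hq'
    change iteratedBlowDown k (blowUp h.fst) (fun i => pullback h.fst (P i.succ)) h.snd q' = y
    generalize iteratedBlowDown k (blowUp h.fst)
      (fun i => pullback h.fst (P i.succ)) h.snd q' = b at h0 ⊢
    rcases (b : BlowUp n (P 0)) with ⟨a, ha⟩ | a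
    · change a = x at h0
      subst h0
      rfl
    · exact absurd (show x ∈ P 0 from h0 ▸ a.1.2) (hx' 0)

/-- `f` is a boundary defining function of `H`. -/
structure IsBoundaryDefining {M : CornerSpace.{u} n} (H : Set M) (f : M → ℝ) : Prop where
  nonneg : ∀ x, 0 ≤ f x
  smooth : ContMDiff (quad n) 𝓘(ℝ, ℝ) ∞ f
  zero_iff : ∀ x, f x = 0 ↔ x ∈ H
  deriv_ne_zero : ∀ x ∈ H, mfderiv (quad n) 𝓘(ℝ, ℝ) f x ≠ 0

/-- `r` is a smoothed distance function to `P` in `M`: its lift to `[M : P]` is a boundary defining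
function of the exceptional hypersurface. -/
structure IsSmoothedDistance {M : CornerSpace.{u} n} {P : Set M} (h : IsClosedPSubmanifold P)
    (r : M → ℝ) : Prop where
  nonneg : ∀ x, 0 ≤ r x
  lift : IsBoundaryDefining (blowDownMap h ⁻¹' P) fun q => r (blowDownMap h q)

/-- `ρ` is a smoothed distance function to the `k`-tuple `(P₀, …)` in `M`: for `k = 1` a smoothed
distance function to `P₀`, for `k > 1` a function with `ρ(x) = r(x) ρ'(y)` for `y ∈ [M : P₀]` over
`x`, where `r` is a smoothed distance function to `P₀` in `M` and `ρ'` is one to the pull-back of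
`(P₁, …)` in `[M : P₀]`. (For the empty tuple the only function is `1`.) -/
def IsSmoothedDistanceTuple : (k : ℕ) → (M : CornerSpace.{u} n) → (P : Fin k → Set M) →
    IsSuitable k M P → (M → ℝ) → Prop
  | 0, _, _, _, ρ => ∀ x, ρ x = 1
  | 1, _, _, h, ρ => IsSmoothedDistance h.fst ρ
  | k + 2, _, P, h, ρ => (∀ x, 0 ≤ ρ x) ∧ ∃ r ρ', IsSmoothedDistance h.fst r ∧
      IsSmoothedDistanceTuple (k + 1) (blowUp h.fst) (fun i => pullback h.fst (P i.succ)) h.snd ρ' ∧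
      ∀ y, ρ (blowDownMap h.fst y) = r (blowDownMap h.fst y) * ρ' y

/-- A clean semilattice of closed p-submanifolds: closed under pairwise intersections, and any two
members satisfy `T_x(P ∩ Q) = T_x P ∩ T_x Q` at all points of `P ∩ Q`. -/
structure IsCleanSemilattice {M : CornerSpace.{u} n} (S : Set (Set M)) : Prop where
  isClosedPSubmanifold : ∀ P ∈ S, IsClosedPSubmanifold P
  inter_mem : ∀ P ∈ S, ∀ Q ∈ S, P ∩ Q ∈ S
  clean : ∀ P ∈ S, ∀ Q ∈ S, ∀ x ∈ P ∩ Q,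
    tangentSpan (n := n) (P ∩ Q) x = tangentSpan P x ⊓ tangentSpan Q x

end Iterated

end Corners

end

/-! Near a point of `Y` let the functions `w l` generate the ideal of smooth functions vanishing on
`Y`. Lifted to `[M : S]`, near any point `q` over `Y`, they acquire a common factor: `w l = g * v l`
with `g ≥ 0` and the `v l` not all zero at `q`. Here `g` is a product of some of the lifted distance
functions whose full product is the lift of `ρ`, so that also `ρ = g * e` with `e` smooth
(`exists_common_factor`). On the other hand the quotients of the `v l` are projective coordinates of
a smooth local lift of the blow-down map to `[M : Y]`, and along this lift `r = g * E` with `E > 0`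
(`IsSmoothedDistance.exists_eq_mul_of_factor`). Hence `ρ / r = e / E` off the preimage of the union
of the family. This preimage has dense complement, so the local extensions agree and glue.

The common factor is found one blow-up at a time. Let `P` be the first entry. If `P` meets `Y`, then
`P ∩ Y` is an entry which, by admissibility, is not a proper subset of `P`; so `P ⊆ Y`. Thus over
`P` the `w l` are divisible by the lifted distance function: `w l = r_P * w' l`. If some `w' l` is
nonzero at the image of `q` in `[M : P]`, then `g = r_P`. Otherwise this point lies on the pull-back
of `Y`, the `w' l` generate the ideal of the pull-back there, and the argument is repeated in `[M :
P]`. Away from `P` the generators are unchanged and `r_P` goes into `e`.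

It is not proved that the pulled-back family is again a clean semilattice of p-submanifolds. The
induction carries a weaker structure. `RetractAt` provides generators together with a map into `Y`
that is the identity modulo the generators; it lifts because the exceptional coordinate cancels in
projective coordinates (`RetractAt.blowUp_of_mem`). `GoodFamily` adds that the ideal of an
intersection is the sum of the ideals, which survives division by `r_P`
(`GoodFamily.meet_pullback`). Cleanness is used only to start the induction (`exists_add_of_clean`).
All divisions, including those showing that the blow-up is a smooth manifold, rest on Hadamard's
lemma on convex pieces of corners. -/

noncomputable section

namespace Corners

universe u

/-! ### Parametric integrals and Hadamard's lemma on convex sets. -/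

section Hadamard

variable {X F : Type} [NormedAddCommGroup X] [NormedSpace ℝ X] [NormedAddCommGroup F]
  [NormedSpace ℝ F]

/-- The partial derivative of `h` in the first variable, on `C × [0, 1]`. -/
def partialFDeriv (C : Set X) (h : X × ℝ → F) (y : X × ℝ) : X →L[ℝ] F :=
  (fderivWithin ℝ h (C ×ˢ Icc (0 : ℝ) 1) y).comp (ContinuousLinearMap.inl ℝ X ℝ)

theorem contDiffOn_partialFDeriv {C : Set X} (hC : UniqueDiffOn ℝ C) {h : X × ℝ → F}
    (hh : ContDiffOn ℝ ∞ h (C ×ˢ Icc (0 : ℝ) 1)) :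
    ContDiffOn ℝ ∞ (partialFDeriv C h) (C ×ˢ Icc (0 : ℝ) 1) :=
  (hh.fderivWithin (hC.prod (uniqueDiffOn_Icc one_pos)) (by simp)).clm_comp contDiffOn_const

theorem hasFDerivWithinAt_partial {C : Set X} {h : X × ℝ → F}
    (hh : ContDiffOn ℝ ∞ h (C ×ˢ Icc (0 : ℝ) 1)) {x : X} (hx : x ∈ C) {s : ℝ}
    (hs : s ∈ Icc (0 : ℝ) 1) :
    HasFDerivWithinAt (fun x => h (x, s)) (partialFDeriv C h (x, s)) C x := by
  have h1 := (hh.differentiableOn (by simp) (x, s) ⟨hx, hs⟩).hasFDerivWithinAt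
  exact h1.comp (f := fun x => (x, s)) x (hasFDerivAt_prodMk_left x s).hasFDerivWithinAt
    fun y hy => (⟨hy, hs⟩ : (y, s) ∈ C ×ˢ Icc (0 : ℝ) 1)

/-- Differentiation under the integral sign: compactness of `[0, 1]` makes the partial derivative
continuous at `x` uniformly in the parameter, and the mean value inequality on a convex piece of `C`
turns this into a uniform error bound. -/
theorem hasFDerivWithinAt_integral [CompleteSpace F] {C : Set X} (hC : Convex ℝ C) (hC' : UniqueDiffOn ℝ C)
    {h : X × ℝ → F} (hh : ContDiffOn ℝ ∞ h (C ×ˢ Icc (0 : ℝ) 1)) {x : X} (hx : x ∈ C) :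
    HasFDerivWithinAt (fun x => ∫ s in (0 : ℝ)..1, h (x, s))
      (∫ s in (0 : ℝ)..1, partialFDeriv C h (x, s)) C x := by
  have hD := (contDiffOn_partialFDeriv hC' hh).continuousOn
  have int1 : ∀ y ∈ C, IntervalIntegrable (fun s => h (y, s)) MeasureTheory.volume 0 1 := by
    intro y hy
    refine ContinuousOn.intervalIntegrable ?_
    rw [uIcc_of_le zero_le_one]
    exact hh.continuousOn.comp (by fun_prop) fun s hs => ⟨hy, hs⟩
  have int2 : IntervalIntegrable (fun s => partialFDeriv C h (x, s)) MeasureTheory.volume 0 1 := by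
    refine ContinuousOn.intervalIntegrable ?_
    rw [uIcc_of_le zero_le_one]
    exact hD.comp (by fun_prop) fun s hs => ⟨hx, hs⟩
  rw [hasFDerivWithinAt_iff_isLittleO, Asymptotics.isLittleO_iff]
  intro ε hε
  obtain ⟨v, hv, hv'⟩ := isCompact_Icc.mem_uniformity_of_prod
    (f := fun y s => partialFDeriv C h (y, s)) hD hx (Metric.dist_mem_uniformity hε)
  obtain ⟨δ, hδ, hball⟩ := Metric.mem_nhdsWithin_iff.1 hv
  filter_upwards [nhdsWithin_le_nhds (Metric.ball_mem_nhds x hδ), self_mem_nhdsWithin] with y hy hyC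
  have hint : IntervalIntegrable (fun s => partialFDeriv C h (x, s) (y - x))
      MeasureTheory.volume 0 1 :=
    ⟨int2.1.apply_continuousLinearMap _, int2.2.apply_continuousLinearMap _⟩
  rw [← intervalIntegral.integral_sub (int1 y hyC) (int1 x hx),
    ContinuousLinearMap.intervalIntegral_apply int2,
    ← intervalIntegral.integral_sub ((int1 y hyC).sub (int1 x hx)) hint]
  have key : ∀ s ∈ uIoc (0 : ℝ) 1,
      ‖h (y, s) - h (x, s) - partialFDeriv C h (x, s) (y - x)‖ ≤ ε * ‖y - x‖ := by
    intro s hs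
    rw [uIoc_of_le zero_le_one] at hs
    have hs' : s ∈ Icc (0 : ℝ) 1 := ⟨hs.1.le, hs.2⟩
    refine ((convex_ball x δ).inter hC).norm_image_sub_le_of_norm_hasFDerivWithin_le'
      (f := fun y => h (y, s)) (f' := fun y => partialFDeriv C h (y, s))
      (fun z hz => (hasFDerivWithinAt_partial hh hz.2 hs').mono inter_subset_right)
      (fun z hz => ?_) ⟨Metric.mem_ball_self hδ, hx⟩ ⟨hy, hyC⟩
    have := hv' z (hball hz) s hs'
    rw [← dist_eq_norm]
    exact le_of_lt this
  simpa using intervalIntegral.norm_integral_le_of_norm_le_const key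

/-- The derivative of such an integral is an integral of the same kind with values in `X →L[ℝ] F`;
hence the target space is quantified inside the induction on the order. -/
theorem contDiffOn_nat_integral (m : ℕ) {C : Set X} (hC : Convex ℝ C) (hC' : UniqueDiffOn ℝ C) :
    ∀ {F : Type} [NormedAddCommGroup F] [NormedSpace ℝ F] [CompleteSpace F] {h : X × ℝ → F},
    ContDiffOn ℝ ∞ h (C ×ˢ Icc (0 : ℝ) 1) →
    ContDiffOn ℝ m (fun x => ∫ s in (0 : ℝ)..1, h (x, s)) C := by
  induction m with
  | zero =>
    intro F _ _ _ h hh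
    exact contDiffOn_zero.2 fun x hx => (hasFDerivWithinAt_integral hC hC' hh hx).continuousWithinAt
  | succ m ih =>
    intro F _ _ _ h hh
    push_cast
    rw [contDiffOn_succ_iff_fderivWithin hC']
    refine ⟨fun x hx => (hasFDerivWithinAt_integral hC hC' hh hx).differentiableWithinAt,
      by simp, ?_⟩
    refine (ih (contDiffOn_partialFDeriv hC' hh)).congr fun x hx => ?_
    exact (hasFDerivWithinAt_integral hC hC' hh hx).fderivWithin (hC' x hx)

theorem contDiffOn_integral [CompleteSpace F] {C : Set X} (hC : Convex ℝ C) (hC' : UniqueDiffOn ℝ C)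
    {h : X × ℝ → F} (hh : ContDiffOn ℝ ∞ h (C ×ˢ Icc (0 : ℝ) 1)) :
    ContDiffOn ℝ ∞ (fun x => ∫ s in (0 : ℝ)..1, h (x, s)) C :=
  contDiffOn_infty.2 fun m => contDiffOn_nat_integral m hC hC' hh

/-- Hadamard's lemma on a convex set, with two variable points. -/
theorem exists_hadamard [CompleteSpace F] {C : Set X} (hC : Convex ℝ C) (hC' : UniqueDiffOn ℝ C) {f : X → F}
    (hf : ContDiffOn ℝ ∞ f C) :
    ∃ G : X × X → X →L[ℝ] F, ContDiffOn ℝ ∞ G (C ×ˢ C) ∧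
      (∀ y ∈ C, ∀ z ∈ C, f z - f y = G (y, z) (z - y)) ∧
      ∀ y ∈ C, G (y, y) = fderivWithin ℝ f C y := by
  have hD : ContDiffOn ℝ ∞ (fderivWithin ℝ f C) C := hf.fderivWithin hC' (by simp)
  have hmem : ∀ y ∈ C, ∀ z ∈ C, ∀ s ∈ Icc (0 : ℝ) 1, y + s • (z - y) ∈ C := fun y hy z hz s hs =>
    hC.add_smul_sub_mem hy hz hs
  -- The witness is the mean of the derivative over the segment from `y` to `z`, which lies in `C`
  -- by convexity.
  refine ⟨fun p => ∫ s in (0 : ℝ)..1, (fun a : (X × X) × ℝ =>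
    fderivWithin ℝ f C (a.1.1 + a.2 • (a.1.2 - a.1.1))) (p, s), ?_, ?_, ?_⟩
  · refine contDiffOn_integral (h := fun a : (X × X) × ℝ =>
      fderivWithin ℝ f C (a.1.1 + a.2 • (a.1.2 - a.1.1))) (hC.prod hC) (hC'.prod hC') ?_
    exact hD.comp (ContDiff.contDiffOn (by fun_prop)) fun a ha => hmem _ ha.1.1 _ ha.1.2 _ ha.2
  · intro y hy z hz
    have hcont : ContinuousOn (fun s : ℝ => fderivWithin ℝ f C (y + s • (z - y))) (Icc 0 1) :=
      hD.continuousOn.comp (by fun_prop) fun s hs => hmem y hy z hz s hs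
    have hint : IntervalIntegrable (fun s : ℝ => fderivWithin ℝ f C (y + s • (z - y)))
        MeasureTheory.volume 0 1 := by
      refine ContinuousOn.intervalIntegrable ?_
      rwa [uIcc_of_le zero_le_one]
    have hder : ∀ s ∈ Icc (0 : ℝ) 1, HasDerivWithinAt (fun s : ℝ => f (y + s • (z - y)))
        (fderivWithin ℝ f C (y + s • (z - y)) (z - y)) (Icc 0 1) s := by
      intro s hs
      have h1 := (hf.differentiableOn (by simp) _ (hmem y hy z hz s hs)).hasFDerivWithinAt
      have h2 : HasDerivWithinAt (fun s : ℝ => y + s • (z - y)) (z - y) (Icc 0 1) s := by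
        simpa using (((hasDerivAt_id s).smul_const (z - y)).const_add y).hasDerivWithinAt
      exact h1.comp_hasDerivWithinAt s h2 fun t ht => hmem y hy z hz t ht
    have hint' : IntervalIntegrable (fun s : ℝ => fderivWithin ℝ f C (y + s • (z - y)) (z - y))
        MeasureTheory.volume 0 1 :=
      ⟨hint.1.apply_continuousLinearMap _, hint.2.apply_continuousLinearMap _⟩
    have := intervalIntegral.integral_eq_sub_of_hasDerivAt_of_le zero_le_one
      (fun s hs => (hder s hs).continuousWithinAt)
      (fun s hs => (hder s ⟨hs.1.le, hs.2.le⟩).hasDerivAt (Icc_mem_nhds hs.1 hs.2)) hint'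
    rw [ContinuousLinearMap.intervalIntegral_apply hint, this]
    simp
  · intro y hy
    simp

end Hadamard

/-! ### Smoothness of the model maps of the blow-up. -/

section Model

variable {n : ℕ}

theorem contMDiffOn_toQuad (K : Set (Fin n)) :
    ContMDiffOn 𝓘(ℝ, Eu n) (quad n) ∞ (toQuad (n := n) K) (corner K) := by
  classical
  have h1 : ContMDiffOn 𝓘(ℝ, Eu n) 𝓘(ℝ, Eu n) ∞ (fun y => quad n (toQuad K y)) (corner K) := by
    refine contMDiffOn_iff_contDiffOn.2 ?_
    -- On `corner K` the `max` in `toQuad` is inactive, so the map agrees there with one that is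
    -- smooth on all of `ℝⁿ`.
    have : ContDiff ℝ ∞ (fun y : Eu n => (WithLp.toLp 2 fun j => if j ∈ K then y j else
        Real.exp (y j) : Eu n)) := by
      refine contDiff_euclidean.2 fun j => ?_
      by_cases h : j ∈ K <;> simp only [h, if_true, if_false] <;> fun_prop
    refine this.contDiffOn.congr fun y hy => ?_
    ext j
    by_cases h : j ∈ K
    · change (toQuad K y).1 j = _
      simp [toQuad, h, hy j h]
    · change (toQuad K y).1 j = _
      simp [toQuad, h]
  have h2 := ((quad n).contMDiffOn_symm (n := ∞)).comp h1 fun y _ =>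
    mem_range_self (toQuad K y)
  exact h2.congr fun y _ => ((quad n).left_inv _).symm

theorem contMDiff_quad_coord (j : Fin n) :
    ContMDiff (quad n) 𝓘(ℝ, ℝ) ∞ fun h : EuclideanQuadrant n => h.1 j :=
  ((EuclideanSpace.proj j : Eu n →L[ℝ] ℝ).contDiff.contMDiff).comp
    ((quad n).contMDiff (n := ∞))

theorem contMDiffWithinAt_euclidean {H E' M' : Type*} [NormedAddCommGroup E'] [NormedSpace ℝ E']
    [TopologicalSpace H] {I : ModelWithCorners ℝ E' H} [TopologicalSpace M'] [ChartedSpace H M']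
    {f : M' → Eu n} {s : Set M'} {x : M'} :
    ContMDiffWithinAt I 𝓘(ℝ, Eu n) ∞ f s x ↔
      ∀ j, ContMDiffWithinAt I 𝓘(ℝ, ℝ) ∞ (fun y => f y j) s x := by
  constructor
  · intro h j
    exact ((EuclideanSpace.proj j : Eu n →L[ℝ] ℝ).contDiff.contMDiff (n := ∞)).contMDiffAt.comp_contMDiffWithinAt
      x h
  · intro h
    have h1 : ContMDiffWithinAt I 𝓘(ℝ, Fin n → ℝ) ∞ (fun y j => f y j) s x :=
      contMDiffWithinAt_pi_space.2 h
    exact ((PiLp.continuousLinearEquiv 2 ℝ (fun _ : Fin n => ℝ)).symm.contDiff.contMDiff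
      (n := ∞)).contMDiffAt.comp_contMDiffWithinAt x h1

theorem contMDiffOn_fromQuad (K : Set (Fin n)) :
    ContMDiffOn (quad n) 𝓘(ℝ, Eu n) ∞ (fromQuad (n := n) K) {h | ∀ j ∉ K, 0 < h.1 j} := by
  intro h hh
  refine contMDiffWithinAt_euclidean.2 fun j => ?_
  by_cases hj : j ∈ K
  · simpa only [fromQuad, hj, if_true] using (contMDiff_quad_coord j).contMDiffAt.contMDiffWithinAt
  · simp only [fromQuad, hj, if_false]
    exact ((Real.contDiffAt_log.2 (hh j hj).ne').contMDiffAt (n := ∞)).comp_contMDiffWithinAt h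
      (contMDiff_quad_coord j).contMDiffAt.contMDiffWithinAt

theorem contDiff_blowModel (J : Set (Fin n)) (i : Fin n) : ContDiff ℝ ∞ (blowModel J i) := by
  refine contDiff_euclidean.2 fun j => ?_
  by_cases h : j ∈ J ∧ j ≠ i
  · simp only [blowModel, h, ne_eq, not_false_eq_true, and_self, if_true]; fun_prop
  · simp only [blowModel, h, if_false]; fun_prop

theorem contDiff_dirVec (J : Set (Fin n)) (i : Fin n) : ContDiff ℝ ∞ (dirVec J i) := by
  refine contDiff_euclidean.2 fun j => ?_
  by_cases h : j = i
  · simp only [dirVec, h, if_true]; fun_prop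
  · by_cases h' : j ∈ J
    · simp only [dirVec, h, h', if_true, if_false]; fun_prop
    · simp only [dirVec, h, h', if_false]; fun_prop

theorem contDiff_baseVec (J : Set (Fin n)) : ContDiff ℝ ∞ (baseVec (n := n) J) := by
  refine contDiff_euclidean.2 fun j => ?_
  by_cases h : j ∈ J
  · simp only [baseVec, h, if_true]; fun_prop
  · simp only [baseVec, h, if_false]; fun_prop

theorem blowModel_mem_corner {K J : Set (Fin n)} {i : Fin n} {z : Eu n}
    (hz : z ∈ corner (insert i K)) : blowModel J i z ∈ corner K := by
  intro j hj
  have hj' := hz j (mem_insert_of_mem _ hj)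
  have hi' := hz i (mem_insert _ _)
  by_cases hJ : j ∈ J ∧ j ≠ i
  · simpa only [blowModel, hJ, ne_eq, not_false_eq_true, and_self, if_true]
      using mul_nonneg hi' hj'
  · simpa only [blowModel, hJ, if_false] using hj'

theorem baseVec_mem_corner {K J : Set (Fin n)} {z : Eu n} (hz : z ∈ corner K) :
    baseVec J z ∈ corner K := by
  intro j hj
  by_cases hJ : j ∈ J
  · simp [baseVec, hJ]
  · simpa [baseVec, hJ] using hz j hj

-- The points `baseVec J z` and `blowModel J i z` differ by `z i • dirVec J i z`, and `g` vanishes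
-- at the first. Hadamard's lemma between them exhibits `z i` as a factor of `g (blowModel J i z)`,
-- with a smooth cofactor that is the derivative of `g` along `dirVec J i z` when `z i = 0`. This is
-- the basic division by the exceptional coordinate.
open Classical in
theorem contDiffWithinAt_ratio {K J : Set (Fin n)} {O : Set (Eu n)} (hO : IsOpen O) {g : Eu n → ℝ}
    (hg : ContDiffOn ℝ ∞ g (O ∩ corner K))
    (hg0 : ∀ y ∈ O ∩ corner K, (∀ j ∈ J, y j = 0) → g y = 0) {i : Fin n} (hi : i ∈ J)
    {z₀ : Eu n} (hz₀ : z₀ ∈ corner (insert i K)) (hz₀O : blowModel J i z₀ ∈ O) :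
    ContDiffWithinAt ℝ ∞ (fun z => if 0 < z i then g (blowModel J i z) / z i else
      fderivWithin ℝ g (O ∩ corner K) (blowModel J i z) (dirVec J i z))
      {z | z ∈ corner (insert i K) ∧ blowModel J i z ∈ O} z₀ := by
  set S := {z | z ∈ corner (insert i K) ∧ blowModel J i z ∈ O} with hS
  have hmaps : ∀ z ∈ S, blowModel J i z ∈ O ∩ corner K := fun z hz =>
    ⟨hz.2, blowModel_mem_corner hz.1⟩
  have hz₀S : z₀ ∈ S := ⟨hz₀, hz₀O⟩
  rcases (hz₀ i (mem_insert _ _)).eq_or_lt with h0 | h0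
  swap
  · have h1 : ContDiffWithinAt ℝ ∞ (fun z => g (blowModel J i z) / z i) S z₀ := by
      refine ContDiffWithinAt.div ?_ (ContDiff.contDiffWithinAt (by fun_prop)) h0.ne'
      exact (hg _ (hmaps _ hz₀S)).comp z₀ (contDiff_blowModel J i).contDiffWithinAt hmaps
    have hev : ∀ᶠ z in 𝓝 z₀, 0 < (z : Eu n) i :=
      (continuousAt_const (y := (0 : ℝ))).eventually_lt (by fun_prop) h0
    refine h1.congr_of_eventuallyEq ?_ (by simp [h0])
    filter_upwards [nhdsWithin_le_nhds hev] with z hz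
    simp [hz]
  · have hbase : baseVec J z₀ = blowModel J i z₀ := by
      rw [blowModel_eq hi, ← h0]; simp
    obtain ⟨δ, hδ, hball⟩ := Metric.isOpen_iff.1 hO _ hz₀O
    set B := Metric.ball (blowModel J i z₀) δ with hB
    set C := B ∩ corner K with hC
    have hCA : C ⊆ O ∩ corner K := fun y hy => ⟨hball hy.1, hy.2⟩
    obtain ⟨G, hG, hG1, hG2⟩ := exists_hadamard ((convex_ball _ _).inter (convex_corner K))
      (uniqueDiffOn_inter_corner Metric.isOpen_ball K) (hg.mono hCA)
    have ev1 : ∀ᶠ z in 𝓝 z₀, blowModel J i z ∈ B :=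
      (continuous_blowModel J i).continuousAt.eventually_mem (Metric.ball_mem_nhds _ hδ)
    have ev2 : ∀ᶠ z in 𝓝 z₀, baseVec J z ∈ B :=
      (continuous_baseVec J).continuousAt.eventually_mem
        (by rw [hbase]; exact Metric.ball_mem_nhds _ hδ)
    have hcorner : ∀ z ∈ S, baseVec J z ∈ corner K := fun z hz =>
      baseVec_mem_corner fun j hj => hz.1 j (mem_insert_of_mem _ hj)
    have hsm : ContDiffWithinAt ℝ ∞ (fun z => G (baseVec J z, blowModel J i z) (dirVec J i z))
        S z₀ := by
      have hm : ContDiffWithinAt ℝ ∞ (fun z => G (baseVec J z, blowModel J i z))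
          (S ∩ {z | baseVec J z ∈ B ∧ blowModel J i z ∈ B}) z₀ := by
        refine (hG (baseVec J z₀, blowModel J i z₀) ⟨⟨ev2.self_of_nhds, hcorner _ hz₀S⟩,
          ev1.self_of_nhds, (hmaps _ hz₀S).2⟩).comp
          (f := fun z => (baseVec J z, blowModel J i z)) z₀ ?_ ?_
        · exact ((contDiff_baseVec J).prodMk (contDiff_blowModel J i)).contDiffWithinAt
        · exact fun z hz => ⟨⟨hz.2.1, hcorner z hz.1⟩, hz.2.2, (hmaps _ hz.1).2⟩
      have hm' := hm.mono_of_mem_nhdsWithin (t := S)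
        (Filter.inter_mem self_mem_nhdsWithin (nhdsWithin_le_nhds (ev2.and ev1)))
      exact hm'.clm_apply (contDiff_dirVec J i).contDiffWithinAt
    have heq : ∀ z ∈ S, baseVec J z ∈ B → blowModel J i z ∈ B →
        (if 0 < z i then g (blowModel J i z) / z i else
          fderivWithin ℝ g (O ∩ corner K) (blowModel J i z) (dirVec J i z)) =
        G (baseVec J z, blowModel J i z) (dirVec J i z) := by
      intro z hz h1 h2
      have hb : baseVec J z ∈ C := ⟨h1, hcorner z hz⟩
      have hm : blowModel J i z ∈ C := ⟨h2, (hmaps z hz).2⟩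
      split_ifs with hpos
      · have := hG1 _ hb _ hm
        rw [hg0 _ (hCA hb) (fun j hj => by simp [baseVec, hj]), sub_zero] at this
        rw [this]
        have e : blowModel J i z - baseVec J z = z i • dirVec J i z := by
          rw [blowModel_eq hi]; abel
        rw [e, map_smul, smul_eq_mul, mul_div_cancel_left₀ _ hpos.ne']
      · have hz0 : z i = 0 := le_antisymm (not_lt.1 hpos) (hz.1 i (mem_insert _ _))
        have e : baseVec J z = blowModel J i z := by rw [blowModel_eq hi, hz0]; simp
        rw [e, hG2 _ hm]
        have hcg : (O ∩ corner K : Set (Eu n)) =ᶠ[𝓝 (blowModel J i z)] (C : Set (Eu n)) := by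
          filter_upwards [Metric.isOpen_ball.mem_nhds h2] with y hy
          exact propext ⟨fun h => ⟨hy, h.2⟩, fun h => hCA h⟩
        rw [fderivWithin_congr_set hcg]
    refine hsm.congr_of_eventuallyEq ?_ (heq _ hz₀S ev2.self_of_nhds ev1.self_of_nhds)
    filter_upwards [nhdsWithin_le_nhds ev1, nhdsWithin_le_nhds ev2, self_mem_nhdsWithin]
      with z h1 h2 hz using heq z hz h2 h1

end Model

/-! ### Smooth compatibility of the charts of the blow-up. -/

section SmoothAtlas

variable {n : ℕ} {M : Type u} [TopologicalSpace M] [ChartedSpace (EuclideanQuadrant n) M]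

theorem IsCornerChart.contMDiffAt {K : Set (Fin n)} {φ : PartialEquiv M (Eu n)}
    (h : IsCornerChart K φ) {x : M} (hx : x ∈ φ.source) :
    ContMDiffAt (quad n) 𝓘(ℝ, Eu n) ∞ φ x :=
  (h.smooth x hx).contMDiffAt (h.open_source.mem_nhds hx)

theorem IsCornerChart.contMDiffAt_coord {K : Set (Fin n)} {φ : PartialEquiv M (Eu n)}
    (h : IsCornerChart K φ) {x : M} (hx : x ∈ φ.source) (j : Fin n) :
    ContMDiffAt (quad n) 𝓘(ℝ, ℝ) ∞ (fun x => φ x j) x :=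
  ((EuclideanSpace.proj j : Eu n →L[ℝ] ℝ).contDiff.contMDiff (n := ∞)).contMDiffAt.comp
    x (h.contMDiffAt hx)

/-- The properties of the charts of the blow-up from which the smoothness of the transition maps is
deduced. -/
structure IsSmoothlyCompatible (P : Set M)
    (e : PartialEquiv (BlowUp n P) (EuclideanQuadrant n)) : Prop where
  smooth : ContMDiffOn (quad n) (quad n) ∞ (fun h => blowDown P (e.symm h)) e.target
  ratio : ∀ (K J : Set (Fin n)) (φ : PartialEquiv M (Eu n)), IsAdapted P K J φ →
    ∀ h₀ ∈ e.target, blowDown P (e.symm h₀) ∈ φ.source →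
    ∃ c : EuclideanQuadrant n → ℝ, (∀ h ∈ e.target, 0 < c h) ∧ ∀ j ∈ J,
      ContMDiffWithinAt (quad n) 𝓘(ℝ, ℝ) ∞ (fun h => c h * normalCoord P φ (e.symm h) j)
        e.target h₀

theorem IsSmoothlyCompatible.of_regular [IsManifold (quad n) ∞ M] {P : Set M}
    {e : PartialEquiv (BlowUp n P) (EuclideanQuadrant n)} (he : e ∈ regularCharts P) :
    IsSmoothlyCompatible P e := by
  obtain ⟨f, hf, hs, heq⟩ := he
  have fact : ∀ h ∈ e.target, blowDown P (e.symm h) ∉ P ∧ blowDown P (e.symm h) ∈ f.source ∧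
      blowDown P (e.symm h) = f.symm h ∧ h ∈ f.target := by
    intro h hh
    have h1 := e.map_target hh
    have h2 := heq h1
    rw [hs] at h1
    rw [e.right_inv hh] at h2
    have h3 := f.left_inv h1.2
    refine ⟨h1.1, h1.2, ?_, ?_⟩
    · rw [← h3]
      exact congrArg f.symm h2.symm
    · rw [h2]; exact f.map_source h1.2
  have hsm : ContMDiffOn (quad n) (quad n) ∞ (fun h => blowDown P (e.symm h)) e.target :=
    ((contMDiffOn_symm_of_mem_maximalAtlas (I := quad n) (n := ∞)
      (IsManifold.subset_maximalAtlas hf)).mono fun h hh => (fact h hh).2.2.2).congr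
      fun h hh => (fact h hh).2.2.1
  refine ⟨hsm, fun K J φ h h₀ hh₀ hφ => ⟨fun _ => 1, fun _ _ => one_pos, fun j _ => ?_⟩⟩
  have h2 : ContMDiffWithinAt (quad n) 𝓘(ℝ, ℝ) ∞ (fun h => φ (blowDown P (e.symm h)) j)
      e.target h₀ :=
    ContMDiffAt.comp_contMDiffWithinAt (g := fun x => φ x j) h₀ (h.contMDiffAt_coord hφ j)
      (hsm h₀ hh₀)
  refine h2.congr (fun h hh => ?_) ?_
  · rw [one_mul, normalCoord_of_notMem φ (fact h hh).1]
  · rw [one_mul, normalCoord_of_notMem φ (fact h₀ hh₀).1]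

/-- The normal coordinates of a second adapted chart, divided by the `i`-th one of the first, are
quotients as in `contDiffWithinAt_ratio`, applied to the components of the coordinate change. -/
theorem IsSmoothlyCompatible.of_projective {P : Set M}
    {e : PartialEquiv (BlowUp n P) (EuclideanQuadrant n)} (he : e ∈ projectiveCharts P) :
    IsSmoothlyCompatible P e := by
  classical
  obtain ⟨K, J, φ, hφ, i, hi, hs, heq⟩ := he
  set K₁ := insert i K with hK₁
  obtain ⟨O, hO, hφT⟩ := hφ.target_eq
  have src : ∀ h ∈ e.target, blowDown P (e.symm h) ∈ φ.source ∧
      0 < normalCoord P φ (e.symm h) i := by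
    intro h hh
    have := e.map_target hh
    rwa [hs] at this
  have fact : ∀ h ∈ e.target, h = toQuad K₁ (projCoord P J i φ (e.symm h)) := by
    intro h hh
    have := heq (e.map_target hh)
    rwa [e.right_inv hh] at this
  have fact2 : ∀ h ∈ e.target, projCoord P J i φ (e.symm h) = fromQuad K₁ h := by
    intro h hh
    conv_rhs => rw [fact h hh]
    exact (fromQuad_toQuad (hφ.projCoord_mem_corner (src h hh).1 (src h hh).2 hi)).symm
  have fact3 : ∀ h ∈ e.target, blowModel J i (fromQuad K₁ h) = φ (blowDown P (e.symm h)) := by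
    intro h hh
    rw [← fact2 h hh]
    exact hφ.blowModel_projCoord (src h hh).1 (src h hh).2 hi
  have hTsub : e.target ⊆ {h | ∀ j ∉ K₁, 0 < h.1 j} := by
    intro h hh j hj
    rw [fact h hh]; exact toQuad_pos _ _ hj
  have hβ : ∀ h ∈ e.target,
      blowDown P (e.symm h) = φ.symm (blowModel J i (fromQuad K₁ h)) := by
    intro h hh
    rw [fact3 h hh, φ.left_inv (src h hh).1]
  have hmaps : ∀ h ∈ e.target, blowModel J i (fromQuad K₁ h) ∈ φ.target := by
    intro h hh
    rw [fact3 h hh]; exact φ.map_source (src h hh).1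
  have hfq : ContMDiffOn (quad n) 𝓘(ℝ, Eu n) ∞ (fromQuad (n := n) K₁) e.target :=
    (contMDiffOn_fromQuad K₁).mono hTsub
  have hsm : ContMDiffOn (quad n) (quad n) ∞ (fun h => blowDown P (e.symm h)) e.target :=
    (hφ.smooth_symm.comp ((contDiff_blowModel J i).contMDiff.comp_contMDiffOn hfq)
      hmaps).congr hβ
  refine ⟨hsm, ?_⟩
  intro K' J' φ' hφ' h₀ hh₀ hx₀
  -- Over the centre, normal coordinates depend on the vector chosen to span the ray. Dividing by
  -- the `i`-th one, which is positive on the source of `e`, removes this ambiguity; the value `1`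
  -- elsewhere plays no role.
  refine ⟨fun h => if h ∈ e.target then (normalCoord P φ (e.symm h) i)⁻¹ else 1, ?_, ?_⟩
  · intro h hh
    simp only [hh, if_true]
    exact inv_pos.2 (src h hh).2
  intro j hj
  obtain ⟨u, hu, hu'⟩ := continuousOn_iff'.1 hφ.smooth_symm.continuousOn _ hφ'.open_source
  set A := φ.target ∩ φ.symm ⁻¹' φ'.source with hAdef
  have hA : A = (u ∩ O) ∩ corner K := by
    rw [hAdef, inter_comm, hu', hφT, inter_assoc]
  have hψ : ContDiffOn ℝ ∞ (fun y => φ' (φ.symm y)) A := by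
    have : ContMDiffOn 𝓘(ℝ, Eu n) 𝓘(ℝ, Eu n) ∞ (fun y => φ' (φ.symm y)) A :=
      hφ'.smooth.comp (hφ.smooth_symm.mono inter_subset_left) fun y hy => hy.2
    exact contMDiffOn_iff_contDiffOn.1 this
  have hψ1 : ContDiffOn ℝ 1 (fun y => φ' (φ.symm y)) A := hψ.of_le (by simp)
  have hg : ContDiffOn ℝ ∞ (fun y => φ' (φ.symm y) j) A :=
    (EuclideanSpace.proj j : Eu n →L[ℝ] ℝ).contDiff.comp_contDiffOn hψ
  have hg0 : ∀ y ∈ A, (∀ l ∈ J, y l = 0) → φ' (φ.symm y) j = 0 := by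
    intro y hy hyJ
    have : φ.symm y ∈ P := (hφ.mem_iff (φ.map_target hy.1)).2 (by rwa [φ.right_inv hy.1])
    exact (hφ'.mem_iff hy.2).1 this j hj
  have hinS : ∀ h ∈ e.target, blowDown P (e.symm h) ∈ φ'.source →
      fromQuad K₁ h ∈ {z : Eu n | z ∈ corner (insert i K) ∧ blowModel J i z ∈ u ∩ O} := by
    intro h hh hx
    have : blowModel J i (fromQuad K₁ h) ∈ A :=
      ⟨hmaps h hh, by rw [mem_preimage, ← hβ h hh]; exact hx⟩
    rw [hA] at this
    exact ⟨fromQuad_mem_corner K₁ h, this.1⟩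
  have key := contDiffWithinAt_ratio (K := K) (hu.inter hO) (hA ▸ hg) (hA ▸ hg0) hi
    (hinS h₀ hh₀ hx₀).1 (hinS h₀ hh₀ hx₀).2
  rw [← hA] at key
  have hev : ∀ᶠ h in 𝓝[e.target] h₀, blowDown P (e.symm h) ∈ φ'.source :=
    (hsm.continuousOn h₀ hh₀).eventually_mem (hφ'.open_source.mem_nhds hx₀)
  set T₁ := e.target ∩ {h | blowDown P (e.symm h) ∈ φ'.source} with hT₁
  have hcw := ContMDiffWithinAt.comp h₀ (contMDiffWithinAt_iff_contDiffWithinAt.2 key)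
    ((hfq h₀ hh₀).mono (inter_subset_left : T₁ ⊆ e.target)) fun h hh => hinS h hh.1 hh.2
  have hcw' := hcw.mono_of_mem_nhdsWithin (t := e.target)
    (Filter.inter_mem self_mem_nhdsWithin hev)
  have heqn : ∀ h ∈ e.target, blowDown P (e.symm h) ∈ φ'.source →
      (if h ∈ e.target then (normalCoord P φ (e.symm h) i)⁻¹ else 1) *
        normalCoord P φ' (e.symm h) j =
      if 0 < fromQuad K₁ h i then φ' (φ.symm (blowModel J i (fromQuad K₁ h))) j / fromQuad K₁ h i
      else fderivWithin ℝ (fun y => φ' (φ.symm y) j) A (blowModel J i (fromQuad K₁ h))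
        (dirVec J i (fromQuad K₁ h)) := by
    intro h hh hx
    obtain ⟨hs1, hs2⟩ := src h hh
    have hzi : fromQuad K₁ h i = φ (blowDown P (e.symm h)) i := by
      rw [← fact2 h hh, projCoord_self]
    have hN := fun l (hl : l ∈ J) => normalCoord_eq (J := J) hs2 hl
    rw [← hβ h hh, fact3 h hh, if_pos hh, hzi]
    rw [fact2 h hh] at hN
    generalize hqe : e.symm h = q at *
    rcases q with x | ⟨⟨x, hxP⟩, ρ⟩
    · have hpos' : 0 < φ (blowDown P (Sum.inl x : BlowUp n P)) i := hs2
      rw [if_pos hpos']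
      exact (div_eq_inv_mul _ _).symm
    · have hx0 : φ x i = 0 := (hφ.mem_iff hs1).1 hxP i hi
      have : ¬ 0 < φ (blowDown P (Sum.inr ⟨⟨x, hxP⟩, ρ⟩ : BlowUp n P)) i := by
        change ¬ 0 < φ x i
        rw [hx0]; exact lt_irrefl _
      rw [if_neg this]
      set v := ρ.2.choose with hv
      change (dChart φ x v i)⁻¹ * dChart φ' x v j = fderivWithin ℝ _ A (φ x) _
      have hsx : x ∈ φ.source := hs1
      have hsx' : x ∈ φ'.source := hx
      -- The chosen vector `v` differs from a positive multiple of `w` by a vector tangent to `P`,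
      -- which the normal coordinates of `φ'` do not see.
      obtain ⟨w, hw⟩ := hφ.dChart_surjective hsx (dirVec J i (fromQuad K₁ h))
      rw [← hw, ← hφ.dChart_change (hu.inter hO) hA rfl hψ1 hφ'.toIsCornerChart hsx hsx']
      have hc : 0 < dChart φ x v i := hs2
      have hmem : v - dChart φ x v i • w ∈ tangentSpan P x := by
        refine (hφ.mem_tangentSpan_iff hsx hxP _).2 fun l hl => ?_
        have := hN l hl
        change dChart φ x v l = dChart φ x v i * _ at this
        rw [map_sub, map_smul, PiLp.sub_apply, PiLp.smul_apply, hw, this, smul_eq_mul, sub_self]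
      have := (hφ'.mem_tangentSpan_iff hsx' hxP _).1 hmem j hj
      rw [map_sub, map_smul, PiLp.sub_apply, PiLp.smul_apply, smul_eq_mul] at this
      rw [inv_mul_eq_div, div_eq_iff hc.ne']
      linarith
  refine hcw'.congr_of_eventuallyEq ?_ (heqn h₀ hh₀ hx₀)
  filter_upwards [hev, self_mem_nhdsWithin] with h hx hh
  exact heqn h hh hx

theorem IsSmoothlyCompatible.trans_regular [IsManifold (quad n) ∞ M] {P : Set M}
    {e e' : PartialEquiv (BlowUp n P) (EuclideanQuadrant n)} (he : IsSmoothlyCompatible P e)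
    (he' : e' ∈ regularCharts P) :
    ContMDiffOn (quad n) (quad n) ∞ (e.symm.trans e') (e.symm.trans e').source := by
  obtain ⟨f, hf, hs, heq⟩ := he'
  have hsrc : (e.symm.trans e').source =
      e.target ∩ (fun h => blowDown P (e.symm h)) ⁻¹' (Pᶜ ∩ f.source) := by
    rw [PartialEquiv.trans_source, hs]; rfl
  have : ContMDiffOn (quad n) (quad n) ∞ (fun h => f (blowDown P (e.symm h)))
      (e.symm.trans e').source := by
    rw [hsrc]
    exact (contMDiffOn_of_mem_maximalAtlas (I := quad n) (n := ∞)
      (IsManifold.subset_maximalAtlas hf)).comp (he.smooth.mono inter_subset_left)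
      fun h hh => hh.2.2
  exact this.congr fun h hh => heq hh.2

theorem IsSmoothlyCompatible.trans_projective {P : Set M}
    {e e' : PartialEquiv (BlowUp n P) (EuclideanQuadrant n)} (he : IsSmoothlyCompatible P e)
    (he' : e' ∈ projectiveCharts P) :
    ContMDiffOn (quad n) (quad n) ∞ (e.symm.trans e') (e.symm.trans e').source := by
  classical
  obtain ⟨K, J, φ, hφ, i, hi, hs, heq⟩ := he'
  have hsrc : ∀ h, h ∈ (e.symm.trans e').source ↔
      h ∈ e.target ∧ blowDown P (e.symm h) ∈ φ.source ∧ 0 < normalCoord P φ (e.symm h) i := by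
    intro h
    rw [PartialEquiv.trans_source, hs]; rfl
  intro h₀ hh₀
  obtain ⟨hT, hx, hpos⟩ := (hsrc h₀).1 hh₀
  obtain ⟨c, hc, hcont⟩ := he.ratio K J φ hφ h₀ hT hx
  have hsub : (e.symm.trans e').source ⊆ e.target := fun h hh => ((hsrc h).1 hh).1
  have hmaps : ∀ h ∈ (e.symm.trans e').source,
      projCoord P J i φ (e.symm h) ∈ corner (insert i K) := fun h hh =>
    hφ.projCoord_mem_corner ((hsrc h).1 hh).2.1 ((hsrc h).1 hh).2.2 hi
  have key : ContMDiffWithinAt (quad n) (quad n) ∞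
      (fun h => toQuad (insert i K) (projCoord P J i φ (e.symm h)))
      (e.symm.trans e').source h₀ := by
    refine (contMDiffOn_toQuad (insert i K) _ (hmaps h₀ hh₀)).comp
      (f := fun h => projCoord P J i φ (e.symm h)) h₀ ?_ hmaps
    refine contMDiffWithinAt_euclidean.2 fun j => ?_
    by_cases hj : j ∈ J ∧ j ≠ i
    -- The factor `c`, which need not be smooth, cancels in the projective coordinates.
    · have hq : ContMDiffWithinAt (quad n) 𝓘(ℝ, ℝ) ∞
          (fun h => (c h * normalCoord P φ (e.symm h) j) /
          (c h * normalCoord P φ (e.symm h) i)) (e.symm.trans e').source h₀ :=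
        ((hcont j hj.1).mono hsub).div₀ ((hcont i hi).mono hsub) (mul_pos (hc h₀ hT) hpos).ne'
      refine hq.congr (fun h hh => ?_) ?_
      · rw [mul_div_mul_left _ _ (hc h (hsub hh)).ne']
        simp only [projCoord, hj, ne_eq, not_false_eq_true, and_self, if_true]
      · rw [mul_div_mul_left _ _ (hc h₀ hT).ne']
        simp only [projCoord, hj, ne_eq, not_false_eq_true, and_self, if_true]
    · have h2 : ContMDiffWithinAt (quad n) 𝓘(ℝ, ℝ) ∞
          (fun h => φ (blowDown P (e.symm h)) j) e.target h₀ :=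
        ContMDiffAt.comp_contMDiffWithinAt (g := fun x => φ x j) h₀ (hφ.contMDiffAt_coord hx j)
          (he.smooth h₀ hT)
      refine (h2.mono hsub).congr (fun h hh => ?_) ?_
      · simp only [projCoord, hj, if_false]
      · simp only [projCoord, hj, if_false]
  exact key.congr (fun h hh => heq hh.2) (heq hh₀.2)

end SmoothAtlas

/-! ### The blow-up as a smooth manifold with corners. -/

section BlowUpManifold

variable {n : ℕ} {N : CornerSpace.{u} n} {P : Set N}

theorem mem_atlas_blowUp (h : IsClosedPSubmanifold P)
    (e : OpenPartialHomeomorph (blowUp h) (EuclideanQuadrant n))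
    (he : e ∈ atlas (EuclideanQuadrant n) (blowUp h)) :
    e.toPartialEquiv ∈ regularCharts (n := n) P ∪ projectiveCharts P := by
  let c := blowUpCore h.isClosed h.isPSubmanifold
  obtain ⟨e', he'⟩ := mem_iUnion.1 he
  obtain ⟨he1, he2⟩ := mem_iUnion.1 he'
  have he3 : e = c.openPartialHomeomorph e' he1 := he2
  rw [he3]
  exact he1

theorem exists_mem_atlas_blowUp (h : IsClosedPSubmanifold P)
    {e : PartialEquiv (BlowUp n P) (EuclideanQuadrant n)}
    (he : e ∈ regularCharts (n := n) P ∪ projectiveCharts P) :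
    ∃ e' : OpenPartialHomeomorph (blowUp h) (EuclideanQuadrant n),
      e' ∈ atlas (EuclideanQuadrant n) (blowUp h) ∧ e'.toPartialEquiv = e := by
  let c := blowUpCore h.isClosed h.isPSubmanifold
  exact ⟨c.openPartialHomeomorph e he, mem_iUnion.2 ⟨e, mem_iUnion.2 ⟨he, rfl⟩⟩, rfl⟩

instance isManifold_blowUp [IsManifold (quad n) ∞ N] (h : IsClosedPSubmanifold P) :
    IsManifold (quad n) ∞ (blowUp h) := by
  refine isManifold_of_contDiffOn _ _ _ fun e e' he he' => ?_
  have h1 : IsSmoothlyCompatible P e.toPartialEquiv :=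
    (mem_atlas_blowUp h e he).elim .of_regular .of_projective
  have h2 : ContMDiffOn (quad n) (quad n) ∞ (e.symm ≫ₕ e') (e.symm ≫ₕ e').source :=
    (mem_atlas_blowUp h e' he').elim (fun he' => h1.trans_regular he')
      (fun he' => h1.trans_projective he')
  -- The charts of the model space are the identity, so the base points are arbitrary; the origin is
  -- used.
  have h3 := (contMDiffOn_iff.1 h2).2 ⟨0, by simp⟩ ⟨0, by simp⟩
  refine h3.congr_mono (fun y hy => rfl) fun y hy => ⟨?_, hy.1, ?_⟩
  · exact ⟨(quad n).target_eq ▸ hy.2, mem_univ _⟩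
  · rw [mem_preimage, extChartAt_source]
    exact mem_univ _

end BlowUpManifold

/-! ### The blow-down map and projective charts with values in corners. -/

section BlowUpCharts

variable {n : ℕ} {N : CornerSpace.{u} n} {P : Set N}

theorem contMDiff_blowDownMap [IsManifold (quad n) ∞ N] (h : IsClosedPSubmanifold P) :
    ContMDiff (quad n) (quad n) ∞ (blowDownMap h) := by
  intro q
  let e : OpenPartialHomeomorph (blowUp h) (EuclideanQuadrant n) := chartAt (EuclideanQuadrant n) q
  have hq : q ∈ e.source := mem_chart_source _ q
  have h1 : IsSmoothlyCompatible P e.toPartialEquiv :=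
    (mem_atlas_blowUp h e (chart_mem_atlas _ q)).elim .of_regular .of_projective
  have h2 : ContMDiffAt (quad n) (quad n) ∞ (fun y => blowDownMap h (e.symm y)) (e q) :=
    (h1.smooth _ (e.map_source hq)).contMDiffAt (e.open_target.mem_nhds (e.map_source hq))
  have h3 : ContMDiffAt (quad n) (quad n) ∞ e q := contMDiffAt_of_mem_maximalAtlas
    (IsManifold.chart_mem_maximalAtlas q) hq
  refine (h2.comp q h3).congr_of_eventuallyEq
    (Filter.eventuallyEq_of_mem (e.open_source.mem_nhds hq) fun q' hq' => ?_)
  simp only [comp_apply, e.left_inv hq']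

open Classical in
/-- The inverse of the blow-down map on the complement of `P`. -/
def blowUpLift (h : IsClosedPSubmanifold P) (q₀ : blowUp h) (x : N) : blowUp h :=
  if hx : x ∈ P then q₀ else (Sum.inl ⟨x, hx⟩ : BlowUp n P)

theorem blowDownMap_blowUpLift (h : IsClosedPSubmanifold P) (q₀ : blowUp h) {x : N} (hx : x ∉ P) :
    blowDownMap h (blowUpLift h q₀ x) = x := by
  have h1 : blowUpLift h q₀ x = (Sum.inl ⟨x, hx⟩ : BlowUp n P) := dif_neg hx
  rw [h1]
  rfl

theorem blowDownMap_injOn (h : IsClosedPSubmanifold P) {q q' : blowUp h}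
    (hq : blowDownMap h q ∉ P) (hqq : blowDownMap h q = blowDownMap h q') : q = q' := by
  have hq' : blowDownMap h q' ∉ P := hqq ▸ hq
  rcases (q : BlowUp n P) with ⟨x, hx⟩ | a
  · rcases (q' : BlowUp n P) with ⟨x', hx'⟩ | a'
    · change x = x' at hqq
      subst hqq
      rfl
    · exact absurd a'.1.2 hq'
  · exact absurd a.1.2 hq

theorem blowUpLift_blowDownMap (h : IsClosedPSubmanifold P) (q₀ : blowUp h) {q : blowUp h}
    (hq : blowDownMap h q ∉ P) : blowUpLift h q₀ (blowDownMap h q) = q :=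
  (blowDownMap_injOn h hq (blowDownMap_blowUpLift h q₀ hq).symm).symm

/-- A regular chart of the blow-up is a chart of `N` restricted to the complement of `P`; in these
charts the lift is the identity. -/
theorem contMDiffAt_blowUpLift [IsManifold (quad n) ∞ N] (h : IsClosedPSubmanifold P)
    (q₀ : blowUp h) {x : N} (hx : x ∉ P) :
    ContMDiffAt (quad n) (quad n) ∞ (blowUpLift h q₀) x := by
  set q := blowUpLift h q₀ x with hq
  have hqx : blowDownMap h q = x := blowDownMap_blowUpLift h q₀ hx
  obtain ⟨e, he, hqe⟩ := exists_regularChart (n := n) P q (hqx.symm ▸ hx : blowDownMap h q ∉ P)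
  obtain ⟨e', he', hee⟩ := exists_mem_atlas_blowUp h (.inl he)
  obtain ⟨f, hf, hs, heq⟩ := he
  have hxf : x ∈ f.source := by
    rw [hs] at hqe
    exact hqx ▸ hqe.2
  have key : ∀ y ∈ f.source ∩ Pᶜ, blowUpLift h q₀ y = e'.symm (f y) := by
    intro y hy
    have hy' : blowUpLift h q₀ y ∈ e.source := by
      have h0 : blowDown P (blowUpLift h q₀ y) = y := blowDownMap_blowUpLift h q₀ hy.2
      rw [hs]
      change blowDown P (blowUpLift h q₀ y) ∉ P ∧ blowDown P (blowUpLift h q₀ y) ∈ f.source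
      rw [h0]
      exact ⟨hy.2, hy.1⟩
    have h1 : e (blowUpLift h q₀ y) = f y := by
      rw [heq hy']
      exact congrArg f (blowDownMap_blowUpLift h q₀ hy.2)
    have h2 := e.left_inv hy'
    rw [h1] at h2
    rw [← h2, ← hee]
    rfl
  have hnhds : f.source ∩ Pᶜ ∈ 𝓝 x :=
    (f.open_source.inter h.isClosed.isOpen_compl).mem_nhds ⟨hxf, hx⟩
  have hxt : f x ∈ e'.target := by
    have h1 : e q = f x := by
      rw [heq hqe]
      exact congrArg f hqx
    have h2 := e.map_source hqe
    rw [h1] at h2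
    rw [← hee] at h2
    exact h2
  have h1 : ContMDiffAt (quad n) (quad n) ∞ e'.symm (f x) :=
    contMDiffAt_symm_of_mem_maximalAtlas (IsManifold.subset_maximalAtlas he') hxt
  have h2 : ContMDiffAt (quad n) (quad n) ∞ f x :=
    contMDiffAt_of_mem_maximalAtlas (IsManifold.subset_maximalAtlas hf) hxf
  exact (h1.comp x h2).congr_of_eventuallyEq (Filter.eventuallyEq_of_mem hnhds key)

/-- `Ψ` is the chart of the blow-up that is given by the projective coordinates over `φ` in the
region where the `i`-th normal coordinate is positive. -/
structure IsProjectiveChart (h : IsClosedPSubmanifold P) (K J : Set (Fin n)) (i : Fin n)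
    (φ : PartialEquiv N (Eu n)) (Ψ : PartialEquiv (blowUp h) (Eu n)) : Prop
    extends IsCornerChart (insert i K) Ψ where
  adapted : IsAdapted P K J φ
  mem : i ∈ J
  mem_source_iff : ∀ q, q ∈ Ψ.source ↔
    blowDownMap h q ∈ φ.source ∧ 0 < normalCoord (n := n) P φ q i
  apply_eq : ∀ q ∈ Ψ.source, Ψ q = projCoord (n := n) P J i φ q
  mem_target_iff : ∀ z, z ∈ Ψ.target ↔ z ∈ corner (insert i K) ∧ blowModel J i z ∈ φ.target

/-- The projective coordinates themselves, not squeezed into the quadrant by `toQuad`, form a chart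
in which the blow-down map is the polynomial map `blowModel`. Smoothness in both directions follows
from the atlas chart by composition with `fromQuad` and `toQuad`. -/
theorem exists_isProjectiveChart [IsManifold (quad n) ∞ N] (h : IsClosedPSubmanifold P)
    [hne : Nonempty (blowUp h)] {K J : Set (Fin n)} {φ : PartialEquiv N (Eu n)}
    (hφ : IsAdapted P K J φ) {i : Fin n} (hi : i ∈ J) :
    ∃ Ψ, IsProjectiveChart h K J i φ Ψ := by
  have hne' : Nonempty (BlowUp n P) := hne
  set s : Set (BlowUp n P) := {q | blowDown P q ∈ φ.source ∧ 0 < normalCoord P φ q i} with hs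
  have hinj := hφ.injOn_projCoord hi
  have hcor : ∀ q ∈ s, projCoord P J i φ q ∈ corner (insert i K) := fun q hq =>
    hφ.projCoord_mem_corner hq.1 hq.2 hi
  have hinj' : InjOn (fun q => toQuad (insert i K) (projCoord P J i φ q)) s := by
    intro a ha b hb hab
    refine hinj ha hb ?_
    have := congrArg (fromQuad (insert i K)) hab
    simpa only [fromQuad_toQuad (hcor a ha), fromQuad_toQuad (hcor b hb)] using this
  have he : hinj'.toPartialEquiv _ _ ∈ regularCharts (n := n) P ∪ projectiveCharts P :=
    .inr ⟨K, J, φ, hφ, i, hi, rfl, fun _ _ => rfl⟩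
  obtain ⟨e, heA, hee⟩ := exists_mem_atlas_blowUp h he
  have hes : e.source = s := by
    rw [hee]
    rfl
  have heq : ∀ q, e q = toQuad (insert i K) (projCoord (n := n) P J i φ q) := by
    intro q
    change e.toPartialEquiv q = _
    rw [hee]
    rfl
  let Ψ : PartialEquiv (blowUp h) (Eu n) := hinj.toPartialEquiv _ _
  have hΨs : Ψ.source = e.source := hes.symm
  have htar : ∀ z, z ∈ Ψ.target ↔ z ∈ corner (insert i K) ∧ blowModel J i z ∈ φ.target := by
    intro z
    constructor
    · rintro ⟨q, hq, rfl⟩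
      refine ⟨hcor q hq, ?_⟩
      rw [hφ.blowModel_projCoord hq.1 hq.2 hi]
      exact φ.map_source hq.1
    · rintro ⟨hz, hz'⟩
      obtain ⟨q, hq, hqz⟩ := hφ.exists_projCoord_eq hi hz hz'
      exact ⟨q, hq, hqz⟩
  have hemax : e ∈ IsManifold.maximalAtlas (quad n) ∞ (blowUp h) :=
    IsManifold.subset_maximalAtlas heA
  have heto : ∀ z ∈ Ψ.target, toQuad (insert i K) z ∈ e.target ∧
      Ψ.symm z = e.symm (toQuad (insert i K) z) := by
    intro z hz
    have h1 : Ψ.symm z ∈ e.source := hΨs ▸ Ψ.map_target hz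
    have h2 : e (Ψ.symm z) = toQuad (insert i K) z := by
      rw [heq]
      exact congrArg _ (Ψ.right_inv hz)
    rw [← h2]
    exact ⟨e.map_source h1, (e.left_inv h1).symm⟩
  refine ⟨Ψ, ⟨?_, ?_, ?_, ?_⟩, hφ, hi, fun q => Iff.rfl, fun _ _ => rfl, htar⟩
  · rw [hΨs]; exact e.open_source
  · obtain ⟨O, hO, hOT⟩ := hφ.target_eq
    refine ⟨blowModel J i ⁻¹' O, hO.preimage (continuous_blowModel J i), ?_⟩
    ext z
    rw [htar, hOT]
    exact ⟨fun hz => ⟨hz.2.1, hz.1⟩, fun hz => ⟨hz.2, hz.1, blowModel_mem_corner hz.2⟩⟩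
  · rw [hΨs]
    have h1 := (contMDiffOn_fromQuad (insert i K)).comp (t := {h | ∀ j ∉ insert i K, 0 < h.1 j})
      (contMDiffOn_of_mem_maximalAtlas hemax) fun q hq j hj => by
        rw [heq]; exact toQuad_pos _ _ hj
    refine h1.congr fun q hq => ?_
    rw [comp_apply, heq, fromQuad_toQuad (hcor q (hes ▸ hq))]
    rfl
  · have h1 := (contMDiffOn_symm_of_mem_maximalAtlas hemax).comp
      ((contMDiffOn_toQuad (insert i K)).mono fun z hz => ((htar z).1 hz).1)
      fun z hz => (heto z hz).1
    exact h1.congr fun z hz => (heto z hz).2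

theorem exists_isProjectiveChart_mem_source [IsManifold (quad n) ∞ N]
    (h : IsClosedPSubmanifold P) {q : blowUp h} (hq : blowDownMap h q ∈ P) :
    ∃ K J i φ Ψ, IsProjectiveChart h K J i φ Ψ ∧ q ∈ Ψ.source := by
  have : Nonempty (blowUp h) := ⟨q⟩
  obtain ⟨e, ⟨K, J, φ, hφ, i, hi, hs, -⟩, hqe⟩ := exists_projectiveChart h.isPSubmanifold q hq
  obtain ⟨Ψ, hΨ⟩ := exists_isProjectiveChart h hφ hi
  refine ⟨K, J, i, φ, Ψ, hΨ, (hΨ.mem_source_iff q).2 ?_⟩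
  rw [hs] at hqe
  exact hqe

namespace IsProjectiveChart

variable {h : IsClosedPSubmanifold P} {K J : Set (Fin n)} {i : Fin n}
  {φ : PartialEquiv N (Eu n)} {Ψ : PartialEquiv (blowUp h) (Eu n)}

theorem blowDown_mem_source (hΨ : IsProjectiveChart h K J i φ Ψ) {q : blowUp h}
    (hq : q ∈ Ψ.source) : blowDownMap h q ∈ φ.source := ((hΨ.mem_source_iff q).1 hq).1

theorem chart_blowDown (hΨ : IsProjectiveChart h K J i φ Ψ) {q : blowUp h}
    (hq : q ∈ Ψ.source) : φ (blowDownMap h q) = blowModel J i (Ψ q) := by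
  have := (hΨ.mem_source_iff q).1 hq
  rw [hΨ.apply_eq q hq]
  exact (hΨ.adapted.blowModel_projCoord this.1 this.2 hΨ.mem).symm

theorem apply_mem (hΨ : IsProjectiveChart h K J i φ Ψ) {q : blowUp h}
    (hq : q ∈ Ψ.source) : Ψ q ∈ corner (insert i K) :=
  ((hΨ.mem_target_iff _).1 (Ψ.map_source hq)).1

theorem apply_nonneg (hΨ : IsProjectiveChart h K J i φ Ψ) {q : blowUp h}
    (hq : q ∈ Ψ.source) : 0 ≤ Ψ q i := hΨ.apply_mem hq i (mem_insert _ _)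

theorem coord_blowDown_self (hΨ : IsProjectiveChart h K J i φ Ψ) {q : blowUp h}
    (hq : q ∈ Ψ.source) : φ (blowDownMap h q) i = Ψ q i := by
  rw [hΨ.chart_blowDown hq]
  simp [blowModel]

theorem coord_blowDown (hΨ : IsProjectiveChart h K J i φ Ψ) {q : blowUp h}
    (hq : q ∈ Ψ.source) {j : Fin n} (hj : j ∈ J) :
    φ (blowDownMap h q) j = Ψ q i * dirVec J i (Ψ q) j := by
  rw [hΨ.chart_blowDown hq]
  by_cases hji : j = i
  · simp [blowModel, dirVec, hji]
  · simp [blowModel, dirVec, hj, hji]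

theorem mem_iff (hΨ : IsProjectiveChart h K J i φ Ψ) {q : blowUp h}
    (hq : q ∈ Ψ.source) : blowDownMap h q ∈ P ↔ Ψ q i = 0 := by
  rw [hΨ.adapted.mem_iff (hΨ.blowDown_mem_source hq)]
  constructor
  · intro hJ
    rw [← hΨ.coord_blowDown_self hq]
    exact hJ i hΨ.mem
  · intro h0 j hj
    rw [hΨ.coord_blowDown hq hj, h0, zero_mul]

theorem mem_source_of_pos (hΨ : IsProjectiveChart h K J i φ Ψ) {q : blowUp h}
    (hq : blowDownMap h q ∈ φ.source) (hpos : 0 < φ (blowDownMap h q) i) : q ∈ Ψ.source := by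
  have hP : blowDownMap h q ∉ P := fun hP =>
    hpos.ne' ((hΨ.adapted.mem_iff hq).1 hP i hΨ.mem)
  refine (hΨ.mem_source_iff q).2 ⟨hq, ?_⟩
  rw [normalCoord_of_notMem (n := n) φ (q := q) hP]
  exact hpos

end IsProjectiveChart

theorem isOpen_preimage_blowDownMap_compl (h : IsClosedPSubmanifold P) :
    IsOpen (blowDownMap h ⁻¹' Pᶜ) :=
  h.isClosed.isOpen_compl.preimage (continuous_blowDownMap h)

/-- Increasing the exceptional coordinate from zero stays in the corner and leaves the exceptional
set, so each exceptional point is a limit of points off it. -/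
theorem dense_preimage_blowDownMap_compl [IsManifold (quad n) ∞ N] (h : IsClosedPSubmanifold P) :
    Dense (blowDownMap h ⁻¹' Pᶜ) := by
  intro q
  by_cases hq : blowDownMap h q ∈ P
  swap
  · exact subset_closure hq
  obtain ⟨K, J, i, φ, Ψ, hΨ, hqΨ⟩ := exists_isProjectiveChart_mem_source h hq
  obtain ⟨O, hO, hOT⟩ := hΨ.target_eq
  have hqT := Ψ.map_source hqΨ
  have hcont : ContinuousWithinAt Ψ.symm Ψ.target (Ψ q) :=
    (hΨ.smooth_symm _ hqT).continuousWithinAt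
  set c : ℝ → Eu n := fun t => Ψ q + t • EuclideanSpace.single i 1 with hc
  have hc0 : c 0 = Ψ q := by simp [hc]
  have hcc : Continuous c := by fun_prop
  have hcT : ∀ᶠ t in 𝓝[>] (0 : ℝ), c t ∈ Ψ.target := by
    have h1 : ∀ᶠ t in 𝓝 (0 : ℝ), c t ∈ O :=
      hcc.continuousAt.eventually_mem (by rw [hc0]; exact hO.mem_nhds (hOT ▸ hqT : _ ∈ O ∩ _).1)
    filter_upwards [nhdsWithin_le_nhds h1, self_mem_nhdsWithin] with t ht ht0
    rw [hOT]
    refine ⟨ht, fun j hj => ?_⟩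
    have := hΨ.apply_mem hqΨ j hj
    by_cases hji : j = i
    · subst hji
      simpa [hc] using add_nonneg this (le_of_lt ht0)
    · simpa [hc, hji] using this
  have htend : Filter.Tendsto (fun t => Ψ.symm (c t)) (𝓝[>] 0) (𝓝 q) := by
    have h1 : Filter.Tendsto c (𝓝[>] 0) (𝓝[Ψ.target] (Ψ q)) :=
      tendsto_nhdsWithin_iff.2 ⟨(hc0 ▸ hcc.tendsto 0).mono_left nhdsWithin_le_nhds, hcT⟩
    have h2 := hcont.tendsto.comp h1
    rwa [Ψ.left_inv hqΨ] at h2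
  refine mem_closure_of_tendsto htend ?_
  filter_upwards [hcT, self_mem_nhdsWithin] with t ht ht0 hP
  have h1 := (hΨ.mem_iff (Ψ.map_target ht)).1 hP
  rw [Ψ.right_inv ht] at h1
  have h2 := (hΨ.mem_iff hqΨ).1 hq
  simp [hc, h2] at h1
  exact (ne_of_gt ht0) h1

theorem dense_preimage_blowDownMap [IsManifold (quad n) ∞ N] (h : IsClosedPSubmanifold P)
    {D : Set N} (hD : Dense D) : Dense (blowDownMap h ⁻¹' (D \ P)) := by
  rw [dense_iff_inter_open]
  intro U hU hUne
  obtain ⟨q, hqU, hqP⟩ := dense_iff_inter_open.1 (dense_preimage_blowDownMap_compl h) U hU hUne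
  set s := blowUpLift h q with hs
  set x := blowDownMap h q with hx
  have hsx : s x = q := blowUpLift_blowDownMap h q hqP
  have h1 : s ⁻¹' U ∩ Pᶜ ∈ 𝓝 x := by
    refine Filter.inter_mem ?_ (h.isClosed.isOpen_compl.mem_nhds hqP)
    exact (contMDiffAt_blowUpLift h q hqP).continuousAt.preimage_mem_nhds
      (by rw [← hs, hsx]; exact hU.mem_nhds hqU)
  obtain ⟨y, hy, hyD⟩ := hD.inter_nhds_nonempty h1
  refine ⟨s y, hyD.1, ?_⟩
  rw [mem_preimage, hs, blowDownMap_blowUpLift h q hyD.2]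
  exact ⟨hy, hyD.2⟩

end BlowUpCharts

/-! ### Germs of smooth functions. -/

section SmoothNear

variable {n : ℕ} {N N' : CornerSpace.{u} n}

/-- `f` is smooth in a neighbourhood of `q`. -/
def SmoothNear (f : N → ℝ) (q : N) : Prop :=
  ∀ᶠ p in 𝓝 q, ContMDiffAt (quad n) 𝓘(ℝ, ℝ) ∞ f p

/-- `f` vanishes on `Y` in a neighbourhood of `q`. -/
def VanishNear (Y : Set N) (f : N → ℝ) (q : N) : Prop :=
  ∀ᶠ p in 𝓝 q, p ∈ Y → f p = 0

namespace SmoothNear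

variable {f g : N → ℝ} {q : N}

theorem contMDiffAt (hf : SmoothNear f q) : ContMDiffAt (quad n) 𝓘(ℝ, ℝ) ∞ f q :=
  Filter.Eventually.self_of_nhds hf

theorem continuousAt (hf : SmoothNear f q) : ContinuousAt f q := hf.contMDiffAt.continuousAt

/-- The gain from requiring smoothness at all nearby points: at a single point, smoothness of order
`∞` only gives neighbourhoods that may shrink with the order. -/
theorem eventually (hf : SmoothNear f q) : ∀ᶠ p in 𝓝 q, SmoothNear f p :=
  eventually_eventually_nhds.2 hf

theorem congr (hf : SmoothNear f q) (h : ∀ᶠ p in 𝓝 q, g p = f p) : SmoothNear g q := by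
  filter_upwards [hf, eventually_eventually_nhds.2 h] with p h1 h2
  exact h1.congr_of_eventuallyEq h2

theorem const (c : ℝ) (q : N) : SmoothNear (fun _ => c) q :=
  Filter.Eventually.of_forall fun _ => contMDiffAt_const

theorem add (hf : SmoothNear f q) (hg : SmoothNear g q) : SmoothNear (fun p => f p + g p) q := by
  filter_upwards [hf, hg] with p h1 h2 using h1.add h2

theorem mul (hf : SmoothNear f q) (hg : SmoothNear g q) : SmoothNear (fun p => f p * g p) q := by
  filter_upwards [hf, hg] with p h1 h2 using h1.mul h2

theorem neg (hf : SmoothNear f q) : SmoothNear (fun p => -f p) q := by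
  simpa using (const (-1) q).mul hf

theorem sub (hf : SmoothNear f q) (hg : SmoothNear g q) : SmoothNear (fun p => f p - g p) q := by
  simpa [sub_eq_add_neg] using hf.add hg.neg

theorem sum {ι : Type*} (s : Finset ι) {f : ι → N → ℝ} (hf : ∀ j, SmoothNear (f j) q) :
    SmoothNear (fun p => ∑ j ∈ s, f j p) q := by
  classical
  induction s using Finset.induction_on with
  | empty => simpa using const 0 q
  | insert a s ha ih => simpa [Finset.sum_insert ha] using (hf a).add ih

theorem div (hf : SmoothNear f q) (hg : SmoothNear g q) (h0 : g q ≠ 0) :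
    SmoothNear (fun p => f p / g p) q := by
  filter_upwards [hf, hg, hg.continuousAt.eventually_ne h0] with p h1 h2 h3 using h1.div₀ h2 h3

theorem comp {f : N → ℝ} {β : N' → N} {q : N'} (hf : SmoothNear f (β q))
    (hβ : ∀ᶠ p in 𝓝 q, ContMDiffAt (quad n) (quad n) ∞ β p) : SmoothNear (fun p => f (β p)) q := by
  filter_upwards [hβ, hβ.self_of_nhds.continuousAt.eventually hf] with p h1 h2
  exact ContMDiffAt.comp p h2 h1

theorem of_contDiffOn {V : Type*} [NormedAddCommGroup V] [NormedSpace ℝ V] {G : V → ℝ} {C : Set V}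
    (hG : ContDiffOn ℝ ∞ G C) {a : N → V}
    (ha : ∀ᶠ p in 𝓝 q, ContMDiffAt (quad n) 𝓘(ℝ, V) ∞ a p) (hC : ∀ᶠ p in 𝓝 q, a p ∈ C) :
    SmoothNear (fun p => G (a p)) q := by
  filter_upwards [ha, eventually_eventually_nhds.2 hC] with p h1 h2
  have h3 : ContMDiffWithinAt (quad n) 𝓘(ℝ, ℝ) ∞ (fun p => G (a p)) {p | a p ∈ C} p :=
    (contMDiffWithinAt_iff_contDiffWithinAt.2 (hG _ h2.self_of_nhds)).comp (f := a) p
      h1.contMDiffWithinAt fun p hp => hp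
  exact h3.contMDiffAt h2

/-- Used to verify identities off the exceptional set, where division by the distance function is
possible, and to extend them by continuity. -/
theorem eq_of_dense (hf : SmoothNear f q) (hg : SmoothNear g q) {D : Set N} (hD : Dense D)
    (h : ∀ᶠ p in 𝓝 q, p ∈ D → f p = g p) : ∀ᶠ p in 𝓝 q, f p = g p := by
  filter_upwards [hf, hg, eventually_eventually_nhds.2 h] with p h1 h2 h3
  have hne : (𝓝[D] p).NeBot := mem_closure_iff_nhdsWithin_neBot.1 (hD p)
  refine tendsto_nhds_unique (l := 𝓝[D] p) ((h1.continuousAt.tendsto).mono_left nhdsWithin_le_nhds)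
    (Filter.Tendsto.congr' ?_ (h2.continuousAt.tendsto.mono_left nhdsWithin_le_nhds))
  filter_upwards [nhdsWithin_le_nhds h3, self_mem_nhdsWithin] with y hy hyD
  exact (hy hyD).symm

theorem nonneg_of_dense (hf : SmoothNear f q) {D : Set N} (hD : Dense D)
    (h : ∀ᶠ p in 𝓝 q, p ∈ D → 0 ≤ f p) : ∀ᶠ p in 𝓝 q, 0 ≤ f p := by
  filter_upwards [hf, eventually_eventually_nhds.2 h] with p h1 h3
  have hne : (𝓝[D] p).NeBot := mem_closure_iff_nhdsWithin_neBot.1 (hD p)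
  refine ge_of_tendsto (x := 𝓝[D] p) (h1.continuousAt.tendsto.mono_left nhdsWithin_le_nhds) ?_
  filter_upwards [nhdsWithin_le_nhds h3, self_mem_nhdsWithin] with y hy hyD
  exact hy hyD

end SmoothNear

theorem contMDiffAt_toLp {a : Fin n → N → ℝ} {q : N}
    (ha : ∀ j, ContMDiffAt (quad n) 𝓘(ℝ, ℝ) ∞ (a j) q) :
    ContMDiffAt (quad n) 𝓘(ℝ, Eu n) ∞ (fun p => (WithLp.toLp 2 fun j => a j p : Eu n)) q :=
  contMDiffWithinAt_euclidean.2 ha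

theorem IsCornerChart.smoothNear_coord {K : Set (Fin n)} {φ : PartialEquiv N (Eu n)}
    (h : IsCornerChart K φ) {x : N} (hx : x ∈ φ.source) (j : Fin n) :
    SmoothNear (fun p => φ p j) x := by
  filter_upwards [h.open_source.mem_nhds hx] with p hp using h.contMDiffAt_coord hp j

theorem IsCornerChart.eventually_contMDiffAt {K : Set (Fin n)} {φ : PartialEquiv N (Eu n)}
    (h : IsCornerChart K φ) {x : N} (hx : x ∈ φ.source) :
    ∀ᶠ p in 𝓝 x, ContMDiffAt (quad n) 𝓘(ℝ, Eu n) ∞ φ p := by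
  filter_upwards [h.open_source.mem_nhds hx] with p hp using h.contMDiffAt hp

/-- If `y` tends to `φ x` inside the corner, then the points of `N` with coordinates `y` tend to
`x`. -/
theorem IsCornerChart.tendsto_symm {K : Set (Fin n)} {φ : PartialEquiv N (Eu n)}
    (h : IsCornerChart K φ) {x : N} (hx : x ∈ φ.source) {A : Type*} {l : Filter A} {y : A → Eu n}
    (hy : Filter.Tendsto y l (𝓝 (φ x))) (hyK : ∀ᶠ a in l, y a ∈ corner K) :
    (∀ᶠ a in l, y a ∈ φ.target) ∧ Filter.Tendsto (fun a => φ.symm (y a)) l (𝓝 x) := by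
  obtain ⟨O, hO, hT⟩ := h.target_eq
  have hxT := φ.map_source hx
  have h1 : ∀ᶠ a in l, y a ∈ φ.target := by
    filter_upwards [hy (hO.mem_nhds (hT ▸ hxT : _ ∈ O ∩ _).1), hyK] with a h1 h2
    rw [hT]
    exact ⟨h1, h2⟩
  refine ⟨h1, ?_⟩
  have h2 := (h.smooth_symm _ hxT).continuousWithinAt.tendsto.comp
    (tendsto_nhdsWithin_iff.2 ⟨hy, h1⟩)
  rwa [φ.left_inv hx] at h2

theorem IsCornerChart.apply_mem_corner {K : Set (Fin n)} {φ : PartialEquiv N (Eu n)}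
    (h : IsCornerChart K φ) {x : N} (hx : x ∈ φ.source) : φ x ∈ corner K := by
  obtain ⟨O, hO, hT⟩ := h.target_eq
  exact (hT ▸ φ.map_source hx : φ x ∈ O ∩ corner K).2

/-- Hadamard's lemma in a chart. -/
theorem IsCornerChart.exists_hadamard {K : Set (Fin n)} {φ : PartialEquiv N (Eu n)}
    (h : IsCornerChart K φ) {x : N} (hx : x ∈ φ.source) {f : N → ℝ} (hf : SmoothNear f x) :
    ∃ δ > 0, ∃ G : Fin n → Eu n × Eu n → ℝ,
      (∀ j, ContDiffOn ℝ ∞ (G j)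
        ((Metric.ball (φ x) δ ∩ corner K) ×ˢ (Metric.ball (φ x) δ ∩ corner K))) ∧
      ∀ p ∈ φ.source, ∀ p' ∈ φ.source, φ p ∈ Metric.ball (φ x) δ → φ p' ∈ Metric.ball (φ x) δ →
        f p' - f p = ∑ j, (φ p' j - φ p j) * G j (φ p, φ p') := by
  have hx0 : x ∈ φ.source := hx
  have hid : Filter.Tendsto (fun y : Eu n => y) (𝓝[corner K] (φ x)) (𝓝 (φ x)) :=
    Filter.tendsto_id.mono_left nhdsWithin_le_nhds
  obtain ⟨h1, h2⟩ := h.tendsto_symm hx hid self_mem_nhdsWithin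
  obtain ⟨δ, hδ, hball⟩ := Metric.mem_nhdsWithin_iff.1 (Filter.inter_mem h1 (h2 hf))
  set C := Metric.ball (φ x) δ ∩ corner K with hC
  have hsm : ContDiffOn ℝ ∞ (fun y => f (φ.symm y)) C := by
    refine contMDiffOn_iff_contDiffOn.1 fun y hy => ?_
    have hy' := hball hy
    exact ContMDiffAt.comp_contMDiffWithinAt (g := f) y hy'.2
      ((h.smooth_symm y hy'.1).mono fun z hz => (hball hz).1)
  obtain ⟨G, hG, hG1, -⟩ := Corners.exists_hadamard ((convex_ball _ _).inter (convex_corner K))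
    (uniqueDiffOn_inter_corner Metric.isOpen_ball K) hsm
  refine ⟨δ, hδ, fun j a => G a (EuclideanSpace.single j 1), fun j => hG.clm_apply contDiffOn_const,
    fun p hp p' hp' hpb hpb' => ?_⟩
  have := hG1 _ ⟨hpb, h.apply_mem_corner hp⟩ _ ⟨hpb', h.apply_mem_corner hp'⟩
  rw [φ.left_inv hp, φ.left_inv hp'] at this
  rw [this]
  set v := φ p' - φ p with hv
  have hsum : v = ∑ j, v j • EuclideanSpace.single j (1 : ℝ) := by
    ext k
    simp [Finset.sum_apply, Pi.single_apply]
  conv_lhs => rw [hsum]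
  simp [hv]

end SmoothNear

/-! ### Local retractions and generators of the ideal of a closed set. -/

section Retract

variable {n : ℕ} {N : CornerSpace.{u} n}

/-- Near `q`, the set `Y` is the zero set of the functions `w l`, and there is a retraction `π` onto
`Y` (defined on a dense open set) that is the identity modulo the ideal generated by the `w l`. -/
structure RetractAt (Y : Set N) (q : N) (w : Fin n → N → ℝ) : Prop where
  smooth : ∀ l, SmoothNear (w l) q
  zero : ∀ l, w l q = 0
  vanish : ∀ l, VanishNear Y (w l) q
  retr : ∃ (D : Set N) (π : N → N), IsOpen D ∧ Dense D ∧ (∀ᶠ p in 𝓝 q, p ∈ D → π p ∈ Y) ∧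
    ∀ f, SmoothNear f q → ∃ c : Fin n → N → ℝ, (∀ l, SmoothNear (c l) q) ∧
      ∀ᶠ p in 𝓝 q, p ∈ D → f (π p) = f p + ∑ l, w l p * c l p

/-- A map that is the identity modulo the ideal of the `w l` is continuous at `q`. -/
theorem tendsto_of_retract {q : N} {w : Fin n → N → ℝ} (hw : ∀ l, SmoothNear (w l) q)
    (hw0 : ∀ l, w l q = 0) {D : Set N} {π : N → N}
    (hπ : ∀ f, SmoothNear f q → ∃ c : Fin n → N → ℝ, (∀ l, SmoothNear (c l) q) ∧
      ∀ᶠ p in 𝓝 q, p ∈ D → f (π p) = f p + ∑ l, w l p * c l p) :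
    Filter.Tendsto π (𝓝[D] q) (𝓝 q) := by
  classical
  intro U hU
  -- The indicator of the complement of `U` vanishes near `q`, hence is smooth there. The congruence
  -- makes `f (π p)` smaller than `1` for `p` close to `q`, which forces `π p ∈ U`.
  set f : N → ℝ := fun p => if p ∈ U then 0 else 1 with hf
  have hf0 : ∀ᶠ p in 𝓝 q, f p = 0 := by
    filter_upwards [hU] with p hp
    simp [hf, hp]
  obtain ⟨c, hc, hfc⟩ := hπ f ((SmoothNear.const 0 q).congr hf0)
  have hs : SmoothNear (fun p => ∑ l, w l p * c l p) q :=
    SmoothNear.sum _ fun l => (hw l).mul (hc l)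
  have hs0 : ∀ᶠ p in 𝓝 q, ∑ l, w l p * c l p < 1 :=
    hs.continuousAt.eventually_lt continuousAt_const (by simp [hw0])
  rw [Filter.mem_map]
  filter_upwards [nhdsWithin_le_nhds hf0, nhdsWithin_le_nhds hfc, nhdsWithin_le_nhds hs0,
    self_mem_nhdsWithin] with p h1 h2 h3 h4
  have h5 := h2 h4
  rw [h1, zero_add] at h5
  by_contra hp
  have : f (π p) = 1 := if_neg hp
  linarith

/-- If `f` vanishes on `Y`, then `f ∘ π` vanishes near `q` on `D`, and the congruence between `f ∘
π` and `f` puts `f` into the ideal of the `w l`. Density of `D` extends the identity to a full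
neighbourhood. -/
theorem RetractAt.exists_eq_sum {Y : Set N} {q : N} {w : Fin n → N → ℝ} (h : RetractAt Y q w)
    {f : N → ℝ} (hf : SmoothNear f q) (hf0 : VanishNear Y f q) :
    ∃ c : Fin n → N → ℝ, (∀ l, SmoothNear (c l) q) ∧ ∀ᶠ p in 𝓝 q, f p = ∑ l, w l p * c l p := by
  obtain ⟨D, π, hDo, hD, hπY, hπ⟩ := h.retr
  have ht := tendsto_of_retract h.smooth h.zero hπ
  obtain ⟨c, hc, hfc⟩ := hπ f hf
  refine ⟨fun l p => -c l p, fun l => (hc l).neg, hf.eq_of_dense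
    (SmoothNear.sum _ fun l => (h.smooth l).mul (hc l).neg) hD ?_⟩
  have h1 : ∀ᶠ p in 𝓝[D] q, π p ∈ Y → f (π p) = 0 := ht hf0
  rw [eventually_nhdsWithin_iff] at h1
  filter_upwards [h1, hπY, hfc] with p h1 h2 h3 hp
  have h4 := h3 hp
  rw [h1 hp (h2 hp)] at h4
  simp only [mul_neg, Finset.sum_neg_distrib]
  linarith

/-- The points `π p` lie in `Y` and tend to `q`. In this way points of the exceptional set are
recognised as points of a pull-back. -/
theorem RetractAt.mem_of_isClosed {Y : Set N} {q : N} {w : Fin n → N → ℝ} (h : RetractAt Y q w)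
    (hY : IsClosed Y) : q ∈ Y := by
  obtain ⟨D, π, hDo, hD, hπY, hπ⟩ := h.retr
  have ht := tendsto_of_retract h.smooth h.zero hπ
  have : (𝓝[D] q).NeBot := mem_closure_iff_nhdsWithin_neBot.1 (hD q)
  exact hY.mem_of_tendsto ht (eventually_nhdsWithin_iff.2 hπY)

open Classical in
/-- The functions that define `P` in an adapted chart, extended by zero to all indices. -/
def definingFun (J : Set (Fin n)) (φ : N → Eu n) (l : Fin n) (p : N) : ℝ :=
  if l ∈ J then φ p l else 0

theorem IsAdapted.smoothNear_definingFun {P : Set N} {K J : Set (Fin n)} {φ : PartialEquiv N (Eu n)}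
    (h : IsAdapted P K J φ) {x : N} (hx : x ∈ φ.source) (l : Fin n) :
    SmoothNear (definingFun J φ l) x := by
  by_cases hl : l ∈ J
  · refine (h.smoothNear_coord hx l).congr (Filter.Eventually.of_forall fun p => ?_)
    simp [definingFun, hl]
  · refine (SmoothNear.const 0 x).congr (Filter.Eventually.of_forall fun p => ?_)
    simp [definingFun, hl]

/-- The retraction sets the coordinates in `J` to zero. Only these change, so Hadamard's lemma
between a point and its projection gives the congruence. -/
theorem IsAdapted.retractAt {P : Set N} {K J : Set (Fin n)} {φ : PartialEquiv N (Eu n)}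
    (h : IsAdapted P K J φ) {x : N} (hx : x ∈ φ.source) (hxP : x ∈ P) :
    RetractAt P x (definingFun J φ) := by
  have hbase : baseVec J (φ x) = φ x := by
    ext j
    by_cases hj : j ∈ J
    · simp [baseVec, hj, (h.mem_iff hx).1 hxP j hj]
    · simp [baseVec, hj]
  have hcor : ∀ᶠ p in 𝓝 x, baseVec J (φ p) ∈ corner K := by
    filter_upwards [h.open_source.mem_nhds hx] with p hp
    exact baseVec_mem_corner (h.apply_mem_corner hp)
  have hlim : Filter.Tendsto (fun p => baseVec J (φ p)) (𝓝 x) (𝓝 (φ x)) := by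
    have := (continuous_baseVec J).continuousAt.comp (h.contMDiffAt hx).continuousAt
    rwa [ContinuousAt, comp_apply, hbase] at this
  obtain ⟨hT, hπ⟩ := h.tendsto_symm hx hlim hcor
  refine ⟨h.smoothNear_definingFun hx, fun l => ?_, fun l => ?_, univ,
    fun p => φ.symm (baseVec J (φ p)), isOpen_univ, dense_univ, ?_, ?_⟩
  · by_cases hl : l ∈ J
    · simp [definingFun, hl, (h.mem_iff hx).1 hxP l hl]
    · simp [definingFun, hl]
  · filter_upwards [h.open_source.mem_nhds hx] with p hp hpP
    by_cases hl : l ∈ J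
    · simp [definingFun, hl, (h.mem_iff hp).1 hpP l hl]
    · simp [definingFun, hl]
  · filter_upwards [hT] with p hp _
    refine (h.mem_iff (φ.map_target hp)).2 fun j hj => ?_
    rw [φ.right_inv hp]
    simp [baseVec, hj]
  · intro f hf
    obtain ⟨δ, hδ, G, hG, hG1⟩ := h.exists_hadamard hx hf
    have hb1 : ∀ᶠ p in 𝓝 x, φ p ∈ Metric.ball (φ x) δ :=
      (h.contMDiffAt hx).continuousAt.eventually_mem (Metric.ball_mem_nhds _ hδ)
    have hb2 : ∀ᶠ p in 𝓝 x, baseVec J (φ p) ∈ Metric.ball (φ x) δ :=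
      hlim.eventually_mem (Metric.ball_mem_nhds _ hδ)
    refine ⟨fun l p => -G l (φ p, baseVec J (φ p)), fun l => (SmoothNear.of_contDiffOn (hG l)
      (a := fun p => (φ p, baseVec J (φ p))) ?_ ?_).neg, ?_⟩
    · filter_upwards [h.eventually_contMDiffAt hx] with p hp
      exact hp.prodMk_space (((contDiff_baseVec J).contMDiff).contMDiffAt.comp p hp)
    · filter_upwards [hb1, hb2, hcor, h.open_source.mem_nhds hx] with p h1 h2 h3 h4
      exact ⟨⟨h1, h.apply_mem_corner h4⟩, h2, h3⟩
    · filter_upwards [hb1, hb2, hT, h.open_source.mem_nhds hx] with p h1 h2 h3 h4 _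
      have := hG1 p h4 _ (φ.map_target h3) h1 (by rwa [φ.right_inv h3])
      rw [φ.right_inv h3] at this
      rw [← sub_eq_iff_eq_add', this]
      refine Finset.sum_congr rfl fun l _ => ?_
      by_cases hl : l ∈ J <;> simp [definingFun, baseVec, hl]

theorem IsAdapted.of_mem_iff {P : Set N} {K J : Set (Fin n)} {φ : PartialEquiv N (Eu n)}
    (h : IsCornerChart K φ) (hP : ∀ x ∈ φ.source, x ∈ P ↔ ∀ j ∈ J, φ x j = 0) :
    IsAdapted P K J φ := by
  refine ⟨h, ?_⟩
  ext y
  constructor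
  · rintro ⟨x, ⟨hxP, hx⟩, rfl⟩
    exact ⟨φ.map_source hx, (hP x hx).1 hxP⟩
  · rintro ⟨hy, hyJ⟩
    refine ⟨φ.symm y, ⟨(hP _ (φ.map_target hy)).2 ?_, φ.map_target hy⟩, φ.right_inv hy⟩
    rwa [φ.right_inv hy]

end Retract

/-! ### Lifting ideals and retractions to the blow-up. -/

section Lifting

variable {n : ℕ} {N : CornerSpace.{u} n} {P : Set N} {h : IsClosedPSubmanifold P}

theorem SmoothNear.comp_blowDownMap [IsManifold (quad n) ∞ N] {f : N → ℝ} {q : blowUp h}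
    (hf : SmoothNear f (blowDownMap h q)) : SmoothNear (fun p => f (blowDownMap h p)) q :=
  hf.comp (Filter.Eventually.of_forall fun p => contMDiff_blowDownMap h p)

theorem eventually_blowDownMap {p : N → Prop} {q : blowUp h}
    (hp : ∀ᶠ x in 𝓝 (blowDownMap h q), p x) : ∀ᶠ y in 𝓝 q, p (blowDownMap h y) :=
  (continuous_blowDownMap h).continuousAt.eventually hp

theorem SmoothNear.comp_blowUpLift [IsManifold (quad n) ∞ N] {f : blowUp h → ℝ} {q : blowUp h}
    (hf : SmoothNear f q) (hq : blowDownMap h q ∉ P) :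
    SmoothNear (fun x => f (blowUpLift h q x)) (blowDownMap h q) := by
  refine SmoothNear.comp (by rwa [blowUpLift_blowDownMap h q hq]) ?_
  filter_upwards [h.isClosed.isOpen_compl.mem_nhds hq] with x hx
  exact contMDiffAt_blowUpLift h q hx

theorem tendsto_blowUpLift [IsManifold (quad n) ∞ N] {q : blowUp h} (hq : blowDownMap h q ∉ P) :
    Filter.Tendsto (blowUpLift h q) (𝓝 (blowDownMap h q)) (𝓝 q) := by
  have := (contMDiffAt_blowUpLift h q hq).continuousAt
  rwa [ContinuousAt, blowUpLift_blowDownMap h q hq] at this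

theorem VanishNear.closure {A : Set N} {f : N → ℝ} {q : N} (hf : SmoothNear f q)
    (h0 : VanishNear A f q) : VanishNear (closure A) f q := by
  filter_upwards [hf, eventually_eventually_nhds.2 h0] with p h1 h2 hp
  have hne : (𝓝[A] p).NeBot := mem_closure_iff_nhdsWithin_neBot.1 hp
  refine tendsto_nhds_unique (l := 𝓝[A] p) (h1.continuousAt.tendsto.mono_left nhdsWithin_le_nhds)
    (Filter.Tendsto.congr' ?_ tendsto_const_nhds)
  filter_upwards [nhdsWithin_le_nhds h2, self_mem_nhdsWithin] with y hy hyA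
  exact (hy hyA).symm

namespace IsProjectiveChart

variable {K J : Set (Fin n)} {i : Fin n} {φ : PartialEquiv N (Eu n)}
  {Ψ : PartialEquiv (blowUp h) (Eu n)}

theorem adapted_exceptional (hΨ : IsProjectiveChart h K J i φ Ψ) :
    IsAdapted (blowDownMap h ⁻¹' P) (insert i K) {i} Ψ :=
  IsAdapted.of_mem_iff hΨ.toIsCornerChart fun q hq => by
    simpa using hΨ.mem_iff hq

/-- A function that vanishes on `P` lifts to a multiple of the defining function of the exceptional
set. -/
theorem exists_division [IsManifold (quad n) ∞ N] (hΨ : IsProjectiveChart h K J i φ Ψ)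
    {q : blowUp h} (hq : q ∈ Ψ.source) (hqP : blowDownMap h q ∈ P) {f : N → ℝ}
    (hf : SmoothNear f (blowDownMap h q)) (hf0 : VanishNear P f (blowDownMap h q)) :
    ∃ f', SmoothNear f' q ∧ ∀ᶠ p in 𝓝 q, f (blowDownMap h p) = Ψ p i * f' p := by
  classical
  -- Each generator `φ l`, `l ∈ J`, of the ideal of `P` lifts to `Ψ i` times a component of
  -- `dirVec`.
  obtain ⟨c, hc, hfc⟩ := (hΨ.adapted.retractAt (hΨ.blowDown_mem_source hq) hqP).exists_eq_sum hf hf0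
  refine ⟨fun p => ∑ l, (if l ∈ J then dirVec J i (Ψ p) l else 0) * c l (blowDownMap h p),
    SmoothNear.sum _ fun l => SmoothNear.mul ?_ (hc l).comp_blowDownMap, ?_⟩
  · split_ifs
    · refine SmoothNear.of_contDiffOn (G := fun z => dirVec J i z l) (C := univ)
        (contDiff_euclidean.1 (contDiff_dirVec J i) l).contDiffOn
        (hΨ.eventually_contMDiffAt hq) (by simp)
    · exact SmoothNear.const 0 q
  · filter_upwards [eventually_blowDownMap hfc, hΨ.open_source.mem_nhds hq] with p hp hps
    rw [hp, Finset.mul_sum]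
    refine Finset.sum_congr rfl fun l _ => ?_
    by_cases hl : l ∈ J
    · simp only [definingFun, hl, if_true]
      rw [hΨ.coord_blowDown hps hl, mul_assoc]
    · simp [definingFun, hl]

end IsProjectiveChart

namespace IsSmoothedDistance

variable {r : N → ℝ}

theorem smoothNear_lift (hr : IsSmoothedDistance h r) (q : blowUp h) :
    SmoothNear (fun p => r (blowDownMap h p)) q :=
  Filter.Eventually.of_forall fun p => hr.lift.smooth p

theorem eq_zero_iff (hr : IsSmoothedDistance h r) (q : blowUp h) :
    r (blowDownMap h q) = 0 ↔ blowDownMap h q ∈ P := hr.lift.zero_iff q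

/-- The lift of a smoothed distance function is a positive multiple of the coordinate that defines
the exceptional set. -/
theorem exists_eq_mul [IsManifold (quad n) ∞ N] (hr : IsSmoothedDistance h r)
    {K J : Set (Fin n)} {i : Fin n} {φ : PartialEquiv N (Eu n)}
    {Ψ : PartialEquiv (blowUp h) (Eu n)} (hΨ : IsProjectiveChart h K J i φ Ψ)
    {q : blowUp h} (hq : q ∈ Ψ.source) (hqP : blowDownMap h q ∈ P) :
    ∃ E, SmoothNear E q ∧ 0 < E q ∧ ∀ᶠ p in 𝓝 q, r (blowDownMap h p) = Ψ p i * E p := by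
  have had := hΨ.adapted_exceptional
  -- The exceptional set is the zero set of the single coordinate `Ψ i`, so its ideal is principal
  -- and only the term `l = i` survives.
  obtain ⟨c, hc, hfc⟩ := (had.retractAt hq hqP).exists_eq_sum (hr.smoothNear_lift q)
    (Filter.Eventually.of_forall fun p hp => (hr.eq_zero_iff p).2 hp)
  have heq : ∀ᶠ p in 𝓝 q, r (blowDownMap h p) = Ψ p i * c i p := by
    filter_upwards [hfc] with p hp
    rw [hp, Finset.sum_eq_single i]
    · simp [definingFun]
    · intro l _ hl
      simp [definingFun, hl]
    · simp
  have h0 : Ψ q i = 0 := (hΨ.mem_iff hq).1 hqP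
  refine ⟨c i, hc i, lt_of_le_of_ne ?_ fun hE => ?_, heq⟩
  · refine ((hc i).nonneg_of_dense (dense_preimage_blowDownMap_compl h) ?_).self_of_nhds
    filter_upwards [heq, hΨ.open_source.mem_nhds hq] with p hp hps hpP
    have h1 : 0 < Ψ p i := lt_of_le_of_ne (hΨ.apply_nonneg hps) fun h2 =>
      hpP ((hΨ.mem_iff hps).2 h2.symm)
    have h2 : 0 ≤ Ψ p i * c i p := hp ▸ hr.nonneg _
    exact nonneg_of_mul_nonneg_right h2 h1
  -- `Ψ i` vanishes at `q`; if the cofactor did too, the product rule would give a zero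
  -- differential.
  · refine hr.lift.deriv_ne_zero q hqP ?_
    have d1 := ((hΨ.smoothNear_coord hq i).contMDiffAt.mdifferentiableAt (by simp)).hasMFDerivAt
    have d2 := ((hc i).contMDiffAt.mdifferentiableAt (by simp)).hasMFDerivAt
    have d3 := (d1.mul d2).congr_of_eventuallyEq heq
    rw [d3.mfderiv, h0, ← hE]
    exact (congrArg₂ (· + ·) (zero_smul ℝ _) (zero_smul ℝ _)).trans (add_zero _)

/-- The distance function and the exceptional coordinate differ by a nonvanishing smooth factor, so
division by one is division by the other. Unlike the coordinate, the distance function is global and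
occurs as a factor of `ρ`. -/
theorem exists_division [IsManifold (quad n) ∞ N] (hr : IsSmoothedDistance h r)
    {q : blowUp h} (hqP : blowDownMap h q ∈ P) {f : N → ℝ}
    (hf : SmoothNear f (blowDownMap h q)) (hf0 : VanishNear P f (blowDownMap h q)) :
    ∃ f', SmoothNear f' q ∧ ∀ᶠ p in 𝓝 q, f (blowDownMap h p) = r (blowDownMap h p) * f' p := by
  obtain ⟨K, J, i, φ, Ψ, hΨ, hq⟩ := exists_isProjectiveChart_mem_source h hqP
  obtain ⟨f', hf', he⟩ := hΨ.exists_division hq hqP hf hf0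
  obtain ⟨E, hE, hE0, hrE⟩ := hr.exists_eq_mul hΨ hq hqP
  refine ⟨fun p => f' p / E p, hf'.div hE hE0.ne', ?_⟩
  filter_upwards [he, hrE, hE.continuousAt.eventually_ne hE0.ne'] with p h1 h2 h3
  rw [h1, h2]
  field_simp

/-- The quotient by the distance function of a function that vanishes on `Y` vanishes on the
pull-back of `Y`. -/
theorem vanishNear_pullback (hr : IsSmoothedDistance h r) {q : blowUp h} {Y : Set N}
    {f : N → ℝ} {f' : blowUp h → ℝ} (hf0 : VanishNear Y f (blowDownMap h q))
    (hf' : SmoothNear f' q)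
    (he : ∀ᶠ p in 𝓝 q, f (blowDownMap h p) = r (blowDownMap h p) * f' p) :
    VanishNear (pullback h Y) f' q := by
  refine VanishNear.closure hf' ?_
  filter_upwards [he, eventually_blowDownMap hf0] with p h1 h2 hp
  rw [h2 hp.1] at h1
  exact (mul_eq_zero.1 h1.symm).resolve_left fun h0 => hp.2 ((hr.eq_zero_iff p).1 h0)

end IsSmoothedDistance

theorem vanishNear_pullback_comp [IsManifold (quad n) ∞ N] {q : blowUp h} {Y : Set N}
    {f : N → ℝ} (hf : SmoothNear f (blowDownMap h q)) (hf0 : VanishNear Y f (blowDownMap h q)) :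
    VanishNear (pullback h Y) (fun p => f (blowDownMap h p)) q := by
  refine VanishNear.closure hf.comp_blowDownMap ?_
  filter_upwards [eventually_blowDownMap hf0] with p h2 hp
  exact h2 hp.1

theorem isOpen_preimage_sdiff {D : Set N} (hD : IsOpen D) :
    IsOpen (blowDownMap h ⁻¹' (D \ P)) :=
  (hD.sdiff h.isClosed).preimage (continuous_blowDownMap h)

theorem tendsto_comp_blowDownMap {D : Set N} {π : N → N} {q : blowUp h}
    (hπ : Filter.Tendsto π (𝓝[D] (blowDownMap h q)) (𝓝 (blowDownMap h q))) {p : N → Prop}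
    (hp : ∀ᶠ x in 𝓝 (blowDownMap h q), p x) :
    ∀ᶠ y in 𝓝 q, y ∈ blowDownMap h ⁻¹' (D \ P) → p (π (blowDownMap h y)) := by
  have h1 := eventually_blowDownMap (h := h) (eventually_nhdsWithin_iff.1 (hπ.eventually hp))
  filter_upwards [h1] with y hy hyD
  exact hy hyD.1

/-- The blow-down map is a local diffeomorphism off the exceptional set, and `π` tends to a point
outside the closed set `P`, so its values near `q` can be lifted. -/
theorem RetractAt.blowUp_of_notMem [IsManifold (quad n) ∞ N] {Y : Set N} {q : blowUp h}
    {w : Fin n → N → ℝ} (hw : RetractAt Y (blowDownMap h q) w) (hq : blowDownMap h q ∉ P) :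
    RetractAt (pullback h Y) q fun l p => w l (blowDownMap h p) := by
  obtain ⟨D, π, hDo, hD, hπY, hπ⟩ := hw.retr
  have ht := tendsto_of_retract hw.smooth hw.zero hπ
  have hπP := tendsto_comp_blowDownMap ht (h.isClosed.isOpen_compl.mem_nhds hq)
  refine ⟨fun l => (hw.smooth l).comp_blowDownMap, hw.zero,
    fun l => vanishNear_pullback_comp (hw.smooth l) (hw.vanish l),
    blowDownMap h ⁻¹' (D \ P), fun p => blowUpLift h q (π (blowDownMap h p)),
    isOpen_preimage_sdiff hDo, dense_preimage_blowDownMap h hD, ?_, ?_⟩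
  · filter_upwards [hπP, eventually_blowDownMap hπY] with p h1 h2 hp
    have h3 : π (blowDownMap h p) ∉ P := h1 hp
    refine subset_closure ?_
    rw [mem_preimage, blowDownMap_blowUpLift h q h3]
    exact ⟨h2 hp.1, h3⟩
  · intro f hf
    obtain ⟨c, hc, hfc⟩ := hπ _ (hf.comp_blowUpLift hq)
    refine ⟨fun l p => c l (blowDownMap h p), fun l => (hc l).comp_blowDownMap, ?_⟩
    filter_upwards [eventually_blowDownMap hfc] with p h1 hp
    rw [h1 hp.1, blowUpLift_blowDownMap h q hp.2]

/-- The lifted retraction is `π` conjugated with the blow-down map. Modulo the `w l`, the map `π`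
fixes the coordinates of `φ`; as `w l = r * w' l` and `r = Ψ i * E`, it changes the `j`-th one by `Ψ
i * a j` with `a j` in the ideal of the `w'`. The factor `Ψ i` cancels in projective coordinates:
the lift has coordinates `(Ψ j + a j) / (1 + a i)` for `j ∈ J`, `j ≠ i`, and `Ψ j + Ψ i * a j`
otherwise. The denominator is nonzero near `q` because the `w' l` vanish there. These coordinates
are congruent to `Ψ j` modulo the `w'`, and Hadamard's lemma extends the congruence to all smooth
functions. -/
theorem RetractAt.blowUp_of_mem [IsManifold (quad n) ∞ N] {r : N → ℝ}
    (hr : IsSmoothedDistance h r) {Y : Set N} {q : blowUp h}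
    {w : Fin n → N → ℝ} (hw : RetractAt Y (blowDownMap h q) w) (hq : blowDownMap h q ∈ P)
    {w' : Fin n → blowUp h → ℝ} (hw' : ∀ l, SmoothNear (w' l) q)
    (he : ∀ l, ∀ᶠ p in 𝓝 q, w l (blowDownMap h p) = r (blowDownMap h p) * w' l p)
    (hw0 : ∀ l, w' l q = 0) : RetractAt (pullback h Y) q w' := by
  classical
  obtain ⟨D, π, hDo, hD, hπY, hπ⟩ := hw.retr
  have ht := tendsto_of_retract hw.smooth hw.zero hπ
  obtain ⟨K, J, i, φ, Ψ, hΨ, hqΨ⟩ := exists_isProjectiveChart_mem_source h hq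
  obtain ⟨E, hE, hE0, hrE⟩ := hr.exists_eq_mul hΨ hqΨ hq
  have hxφ := hΨ.blowDown_mem_source hqΨ
  choose c hc hφc using fun j => hπ _ (hΨ.adapted.smoothNear_coord hxφ j)
  set D' := blowDownMap h ⁻¹' (D \ P) with hD'
  have hDd : Dense D' := dense_preimage_blowDownMap h hD
  set b : Fin n → Fin n → blowUp h → ℝ := fun j l p => E p * c j l (blowDownMap h p) with hb
  have hbs : ∀ j l, SmoothNear (b j l) q := fun j l => hE.mul (hc j l).comp_blowDownMap
  set a : Fin n → blowUp h → ℝ := fun j p => ∑ l, w' l p * b j l p with ha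
  have has : ∀ j, SmoothNear (a j) q := fun j => SmoothNear.sum _ fun l => (hw' l).mul (hbs j l)
  have ha0 : ∀ j, a j q = 0 := fun j => by simp [ha, hw0]
  have h1a : SmoothNear (fun p => 1 + a i p) q := (SmoothNear.const 1 q).add (has i)
  have h1a0 : 1 + a i q ≠ 0 := by rw [ha0]; norm_num
  have hΨs := fun j => hΨ.smoothNear_coord hqΨ j
  -- `ζ` extends the coordinates of the lifted retraction smoothly across the exceptional set; `d`
  -- below holds the coefficients of `ζ j - Ψ j` with respect to the `w'`.
  set ζ : Fin n → blowUp h → ℝ := fun j p =>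
    if j ∈ J ∧ j ≠ i then (Ψ p j + a j p) / (1 + a i p) else Ψ p j + Ψ p i * a j p with hζ
  have hζs : ∀ j, SmoothNear (ζ j) q := by
    intro j
    by_cases hj : j ∈ J ∧ j ≠ i
    · simp only [hζ, if_pos hj]
      exact ((hΨs j).add (has j)).div h1a h1a0
    · simp only [hζ, if_neg hj]
      exact (hΨs j).add ((hΨs i).mul (has j))
  have hζ0 : ∀ j, ζ j q = Ψ q j := by
    intro j
    by_cases hj : j ∈ J ∧ j ≠ i
    · simp only [hζ, if_pos hj, ha0]; simp
    · simp only [hζ, if_neg hj, ha0]; simp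
  set d : Fin n → Fin n → blowUp h → ℝ := fun j l p =>
    if j ∈ J ∧ j ≠ i then (b j l p - Ψ p j * b i l p) / (1 + a i p) else Ψ p i * b j l p with hd
  have hds : ∀ j l, SmoothNear (d j l) q := by
    intro j l
    by_cases hj : j ∈ J ∧ j ≠ i
    · simp only [hd, if_pos hj]
      exact ((hbs j l).sub ((hΨs j).mul (hbs i l))).div h1a h1a0
    · simp only [hd, if_neg hj]
      exact (hΨs i).mul (hbs j l)
  have hpos : ∀ᶠ p in 𝓝 q, 0 < 1 + a i p :=
    continuousAt_const.eventually_lt h1a.continuousAt (by rw [ha0]; norm_num)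
  have hζd : ∀ᶠ p in 𝓝 q, ∀ j, ζ j p - Ψ p j = ∑ l, w' l p * d j l p := by
    filter_upwards [hpos] with p hp j
    by_cases hj : j ∈ J ∧ j ≠ i
    · simp only [hζ, hd, if_pos hj]
      have e1 : ∑ l, w' l p * ((b j l p - Ψ p j * b i l p) / (1 + a i p)) =
          (a j p - Ψ p j * a i p) / (1 + a i p) := by
        simp only [ha, Finset.mul_sum]
        rw [← Finset.sum_sub_distrib, Finset.sum_div]
        exact Finset.sum_congr rfl fun l _ => by ring
      rw [e1]
      field_simp
      ring
    · simp only [hζ, hd, if_neg hj, ha, Finset.mul_sum]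
      rw [add_sub_cancel_left]
      exact Finset.sum_congr rfl fun l _ => by ring
  -- the coordinates of the lifted retraction
  have hmain : ∀ᶠ p in 𝓝 q, p ∈ D' → π (blowDownMap h p) ∉ P ∧
      blowUpLift h q (π (blowDownMap h p)) ∈ Ψ.source ∧
      ∀ j, Ψ (blowUpLift h q (π (blowDownMap h p))) j = ζ j p := by
    have hφc' := eventually_blowDownMap (Filter.eventually_all.2 hφc)
    have hsrc := tendsto_comp_blowDownMap ht (hΨ.adapted.open_source.mem_nhds hxφ)
    filter_upwards [hφc', hsrc, hpos, hrE, Filter.eventually_all.2 he,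
      hΨ.open_source.mem_nhds hqΨ] with p h1 h2 h3 h4 h5 h6 hp
    have hx : π (blowDownMap h p) ∈ φ.source := h2 hp
    have ht : 0 < Ψ p i := lt_of_le_of_ne (hΨ.apply_nonneg h6) fun h0 =>
      hp.2 ((hΨ.mem_iff h6).2 h0.symm)
    have hφπ : ∀ j, φ (π (blowDownMap h p)) j = φ (blowDownMap h p) j + Ψ p i * a j p := by
      intro j
      rw [h1 j hp.1]
      simp only [ha, hb, Finset.mul_sum]
      congr 1
      refine Finset.sum_congr rfl fun l _ => ?_
      rw [h5 l, h4]
      ring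
    have hi : φ (π (blowDownMap h p)) i = Ψ p i * (1 + a i p) := by
      rw [hφπ, hΨ.coord_blowDown_self h6]
      ring
    -- Positivity of the `i`-th coordinate shows both that `π` avoids `P` and that the lift stays in
    -- the domain of the same projective chart.
    have hipos : 0 < φ (π (blowDownMap h p)) i := by
      rw [hi]; positivity
    have hP : π (blowDownMap h p) ∉ P := fun hP =>
      hipos.ne' ((hΨ.adapted.mem_iff hx).1 hP i hΨ.mem)
    have hlift := blowDownMap_blowUpLift h q hP
    have hs : blowUpLift h q (π (blowDownMap h p)) ∈ Ψ.source :=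
      hΨ.mem_source_of_pos (by rwa [hlift]) (by rwa [hlift])
    refine ⟨hP, hs, fun j => ?_⟩
    have e1 := hΨ.chart_blowDown hs
    rw [hlift] at e1
    have e2 := hΨ.chart_blowDown h6
    have e3 := hΨ.coord_blowDown_self hs
    rw [hlift, hi] at e3
    have e4 := hφπ j
    rw [e1, e2] at e4
    by_cases hj : j ∈ J ∧ j ≠ i
    · simp only [blowModel, if_pos hj] at e4
      rw [← e3] at e4
      simp only [hζ, if_pos hj]
      rw [eq_div_iff h3.ne']
      have e5 : Ψ p i * (Ψ (blowUpLift h q (π (blowDownMap h p))) j * (1 + a i p)) =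
          Ψ p i * (Ψ p j + a j p) := by linarith
      exact mul_left_cancel₀ ht.ne' e5
    · simp only [blowModel, if_neg hj] at e4
      simp only [hζ, if_neg hj]
      exact e4
  refine ⟨hw', hw0, fun l => hr.vanishNear_pullback (hw.vanish l) (hw' l) (he l), D',
    fun p => blowUpLift h q (π (blowDownMap h p)), isOpen_preimage_sdiff hDo, hDd, ?_, ?_⟩
  · filter_upwards [hmain, eventually_blowDownMap hπY] with p h1 h2 hp
    refine subset_closure ?_
    rw [mem_preimage, blowDownMap_blowUpLift h q (h1 hp).1]
    exact ⟨h2 hp.1, (h1 hp).1⟩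
  · intro f hf
    obtain ⟨δ, hδ, G, hG, hG1⟩ := hΨ.exists_hadamard hqΨ hf
    set Z : blowUp h → Eu n := fun p => WithLp.toLp 2 fun j => ζ j p with hZ
    have hZs : ∀ᶠ p in 𝓝 q, ContMDiffAt (quad n) 𝓘(ℝ, Eu n) ∞ Z p := by
      filter_upwards [Filter.eventually_all.2 hζs] with p hp using contMDiffAt_toLp hp
    have hZq : Z q = Ψ q := by
      ext j; exact hζ0 j
    have hZb : ∀ᶠ p in 𝓝 q, Z p ∈ Metric.ball (Ψ q) δ :=
      hZs.self_of_nhds.continuousAt.eventually_mem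
        (by rw [hZq]; exact Metric.ball_mem_nhds _ hδ)
    have hΨb : ∀ᶠ p in 𝓝 q, Ψ p ∈ Metric.ball (Ψ q) δ :=
      (hΨ.contMDiffAt hqΨ).continuousAt.eventually_mem (Metric.ball_mem_nhds _ hδ)
    -- On the dense set `D'`, near `q`, `Z p` is the coordinate vector of a point of the blow-up, so
    -- it lies in the corner; the inequalities persist by continuity.
    have hZc : ∀ᶠ p in 𝓝 q, Z p ∈ corner (insert i K) := by
      have : ∀ j, ∀ᶠ p in 𝓝 q, j ∈ insert i K → 0 ≤ ζ j p := by
        intro j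
        by_cases hj : j ∈ insert i K
        · refine ((hζs j).nonneg_of_dense hDd ?_).mono fun p hp _ => hp
          filter_upwards [hmain] with p hp hpD
          obtain ⟨-, h2, h3⟩ := hp hpD
          rw [← h3 j]
          exact hΨ.apply_mem h2 j hj
        · exact Filter.Eventually.of_forall fun p hp => absurd hp hj
      filter_upwards [Filter.eventually_all.2 this] with p hp j hj using hp j hj
    refine ⟨fun l p => ∑ j, d j l p * G j (Ψ p, Z p), fun l => SmoothNear.sum _ fun j =>
      (hds j l).mul (SmoothNear.of_contDiffOn (hG j) (a := fun p => (Ψ p, Z p)) ?_ ?_), ?_⟩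
    · filter_upwards [hΨ.eventually_contMDiffAt hqΨ, hZs] with p h1 h2 using h1.prodMk_space h2
    · filter_upwards [hZb, hΨb, hZc, hΨ.open_source.mem_nhds hqΨ] with p h1 h2 h3 h4
      exact ⟨⟨h2, hΨ.apply_mem h4⟩, h1, h3⟩
    · filter_upwards [hmain, hZb, hΨb, hζd, hΨ.open_source.mem_nhds hqΨ] with p h1 h2 h3 h4 h5 hp
      obtain ⟨-, hs, hco⟩ := h1 hp
      have hZp : Ψ (blowUpLift h q (π (blowDownMap h p))) = Z p := by
        ext j; exact hco j
      have key := hG1 p h5 _ hs h3 (hZp ▸ h2)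
      rw [← sub_eq_iff_eq_add', key, hZp]
      simp only [Finset.mul_sum]
      rw [Finset.sum_comm]
      refine Finset.sum_congr rfl fun j _ => ?_
      change (ζ j p - Ψ p j) * _ = _
      rw [h4 j, Finset.sum_mul]
      exact Finset.sum_congr rfl fun l _ => by ring

end Lifting

/-! ### The semilattice structure under pull-back. -/

section Family

variable {n : ℕ} {N : CornerSpace.{u} n}

/-- A family of closed sets with local retractions that is closed under nonempty intersections, such
that the functions vanishing on an intersection are sums of functions vanishing on the members. -/
structure GoodFamily {k : ℕ} (S : Fin k → Set N) : Prop where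
  isClosed : ∀ i, IsClosed (S i)
  retract : ∀ i, ∀ x ∈ S i, ∃ w, RetractAt (S i) x w
  meet : ∀ i j, (S i ∩ S j).Nonempty → ∃ m, S m = S i ∩ S j ∧ ∀ x ∈ S m, ∀ f, SmoothNear f x →
    VanishNear (S m) f x → ∃ f₁ f₂, SmoothNear f₁ x ∧ SmoothNear f₂ x ∧ VanishNear (S i) f₁ x ∧
      VanishNear (S j) f₂ x ∧ ∀ᶠ p in 𝓝 x, f p = f₁ p + f₂ p

theorem VanishNear.mono {A B : Set N} (hAB : A ⊆ B) {f : N → ℝ} {q : N} (h : VanishNear B f q) :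
    VanishNear A f q :=
  Filter.Eventually.mono h fun _ hp hA => hp (hAB hA)

theorem VanishNear.eq_zero {A : Set N} {f : N → ℝ} {q : N} (h : VanishNear A f q) (hq : q ∈ A) :
    f q = 0 := Filter.Eventually.self_of_nhds h hq

theorem VanishNear.sum_mul {A : Set N} {q : N} {w c : Fin n → N → ℝ}
    (h : ∀ l, VanishNear A (w l) q) : VanishNear A (fun p => ∑ l, w l p * c l p) q := by
  filter_upwards [Filter.eventually_all.2 h] with p hp hA
  exact Finset.sum_eq_zero fun l _ => by rw [hp l hA, zero_mul]

theorem pullback_subset {P : Set N} (h : IsClosedPSubmanifold P) {Y : Set N} (hY : IsClosed Y) :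
    pullback h Y ⊆ blowDownMap h ⁻¹' Y :=
  closure_minimal (preimage_mono sdiff_subset) (hY.preimage (continuous_blowDownMap h))

theorem RetractAt.exists_division [IsManifold (quad n) ∞ N] {P : Set N}
    {h : IsClosedPSubmanifold P} {r : N → ℝ} (hr : IsSmoothedDistance h r) {Y : Set N}
    {q : blowUp h} {w : Fin n → N → ℝ} (hw : RetractAt Y (blowDownMap h q) w)
    (hq : blowDownMap h q ∈ P) (hPY : P ⊆ Y) :
    ∃ w' : Fin n → blowUp h → ℝ, (∀ l, SmoothNear (w' l) q) ∧
      ∀ l, ∀ᶠ p in 𝓝 q, w l (blowDownMap h p) = r (blowDownMap h p) * w' l p := by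
  choose w' h1 h2 using fun l => hr.exists_division hq (hw.smooth l) ((hw.vanish l).mono hPY)
  exact ⟨w', h1, h2⟩

namespace GoodFamily

variable {k : ℕ} {S : Fin (k + 1) → Set N}

/-- The first member of an admissible tuple is contained in every other member that it meets. -/
theorem subset_of_nonempty (hS : GoodFamily S) (hmin : ∀ i : Fin k, ¬ S i.succ ⊂ S 0)
    {j : Fin (k + 1)} {x : N} (hx : x ∈ S 0) (hxj : x ∈ S j) : S 0 ⊆ S j := by
  obtain ⟨m, hm, -⟩ := hS.meet 0 j ⟨x, hx, hxj⟩
  have h1 : S m ⊆ S 0 := hm ▸ inter_subset_left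
  have h2 : S m ⊆ S j := hm ▸ inter_subset_right
  refine Subset.trans ?_ h2
  -- The intersection `S m` is an entry contained in `S 0`: either it is `S 0` itself, or
  -- admissibility excludes a proper inclusion.
  cases m using Fin.cases with
  | zero => exact Subset.rfl
  | succ m => exact by_contra fun hc => hmin m ⟨h1, hc⟩

/-- Over `S 0`, split each generator of the ideal of `S m` into parts vanishing on `S i` and on `S
j`. All of these vanish on `S 0`, so dividing by `r` splits `w' l` into parts vanishing on the two
pull-backs. At a common point of the pull-backs the `w' l` are therefore zero, so the retraction
lifts and the point lies in the pull-back of `S m`; the splitting of the generators then splits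
every function in its ideal. Away from `S 0` everything is transported by `blowUpLift`. -/
theorem meet_pullback [IsManifold (quad n) ∞ N] (hS : GoodFamily S)
    (hmin : ∀ i : Fin k, ¬ S i.succ ⊂ S 0) (h : IsClosedPSubmanifold (S 0)) {r : N → ℝ}
    (hr : IsSmoothedDistance h r) {i j m : Fin (k + 1)} (hm : S m = S i ∩ S j)
    (hdec : ∀ x ∈ S m, ∀ f, SmoothNear f x →
      VanishNear (S m) f x → ∃ f₁ f₂, SmoothNear f₁ x ∧ SmoothNear f₂ x ∧ VanishNear (S i) f₁ x ∧
      VanishNear (S j) f₂ x ∧ ∀ᶠ p in 𝓝 x, f p = f₁ p + f₂ p)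
    {q : blowUp h} (hqi : q ∈ pullback h (S i)) (hqj : q ∈ pullback h (S j)) :
    q ∈ pullback h (S m) ∧ ∀ f, SmoothNear f q →
      VanishNear (pullback h (S m)) f q → ∃ f₁ f₂, SmoothNear f₁ q ∧ SmoothNear f₂ q ∧
      VanishNear (pullback h (S i)) f₁ q ∧ VanishNear (pullback h (S j)) f₂ q ∧
      ∀ᶠ p in 𝓝 q, f p = f₁ p + f₂ p := by
  have hxi : blowDownMap h q ∈ S i := pullback_subset h (hS.isClosed i) hqi
  have hxj : blowDownMap h q ∈ S j := pullback_subset h (hS.isClosed j) hqj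
  have hxm : blowDownMap h q ∈ S m := hm ▸ ⟨hxi, hxj⟩
  obtain ⟨w, hw⟩ := hS.retract m _ hxm
  by_cases hx : blowDownMap h q ∈ S 0
  · have h0m := hS.subset_of_nonempty hmin hx hxm
    have h0i : S 0 ⊆ S i := h0m.trans (hm ▸ inter_subset_left)
    have h0j : S 0 ⊆ S j := h0m.trans (hm ▸ inter_subset_right)
    obtain ⟨w', hw', he⟩ := hw.exists_division hr hx h0m
    choose f₁ f₂ h₁ h₂ v₁ v₂ hf using fun l => hdec _ hxm (w l) (hw.smooth l) (hw.vanish l)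
    choose g₁ hg₁ e₁ using fun l => hr.exists_division hx (h₁ l) ((v₁ l).mono h0i)
    choose g₂ hg₂ e₂ using fun l => hr.exists_division hx (h₂ l) ((v₂ l).mono h0j)
    have u₁ := fun l => hr.vanishNear_pullback (v₁ l) (hg₁ l) (e₁ l)
    have u₂ := fun l => hr.vanishNear_pullback (v₂ l) (hg₂ l) (e₂ l)
    have hsum : ∀ l, ∀ᶠ p in 𝓝 q, w' l p = g₁ l p + g₂ l p := by
      intro l
      refine (hw' l).eq_of_dense ((hg₁ l).add (hg₂ l)) (dense_preimage_blowDownMap_compl h) ?_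
      filter_upwards [he l, e₁ l, e₂ l, eventually_blowDownMap (hf l)] with p a1 a2 a3 a4 hp
      have hr0 : r (blowDownMap h p) ≠ 0 := fun h0 => hp ((hr.eq_zero_iff p).1 h0)
      apply mul_left_cancel₀ hr0
      rw [mul_add, ← a1, ← a2, ← a3, a4]
    have hw0 : ∀ l, w' l q = 0 := fun l => by
      rw [(hsum l).self_of_nhds, (u₁ l).eq_zero hqi, (u₂ l).eq_zero hqj, add_zero]
    have hret := hw.blowUp_of_mem hr hx hw' he hw0
    refine ⟨hret.mem_of_isClosed isClosed_closure, fun f hfs hfv => ?_⟩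
    obtain ⟨c, hc, hfc⟩ := hret.exists_eq_sum hfs hfv
    refine ⟨_, _, SmoothNear.sum Finset.univ fun l => (hg₁ l).mul (hc l),
      SmoothNear.sum Finset.univ fun l => (hg₂ l).mul (hc l),
      VanishNear.sum_mul u₁, VanishNear.sum_mul u₂, ?_⟩
    filter_upwards [hfc, Filter.eventually_all.2 hsum] with p a1 a2
    rw [a1, ← Finset.sum_add_distrib]
    exact Finset.sum_congr rfl fun l _ => by rw [a2 l, add_mul]
  · refine ⟨(hw.blowUp_of_notMem hx).mem_of_isClosed isClosed_closure, fun f hfs hfv => ?_⟩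
    obtain ⟨f₁, f₂, h₁, h₂, v₁, v₂, hf⟩ := hdec _ hxm _ (hfs.comp_blowUpLift hx) (by
      filter_upwards [(tendsto_blowUpLift hx).eventually hfv,
        h.isClosed.isOpen_compl.mem_nhds hx] with y hy hy0 hym
      refine hy (subset_closure ?_)
      rw [mem_preimage, blowDownMap_blowUpLift h q hy0]
      exact ⟨hym, hy0⟩)
    refine ⟨_, _, h₁.comp_blowDownMap, h₂.comp_blowDownMap, vanishNear_pullback_comp h₁ v₁,
      vanishNear_pullback_comp h₂ v₂, ?_⟩
    filter_upwards [eventually_blowDownMap hf,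
      (isOpen_preimage_blowDownMap_compl h).mem_nhds hx] with p hp hp0
    rw [← hp, blowUpLift_blowDownMap h q hp0]

theorem pullback [IsManifold (quad n) ∞ N] (hS : GoodFamily S)
    (hmin : ∀ i : Fin k, ¬ S i.succ ⊂ S 0) (h : IsClosedPSubmanifold (S 0)) {r : N → ℝ}
    (hr : IsSmoothedDistance h r) : GoodFamily fun i : Fin k => pullback h (S i.succ) := by
  refine ⟨fun i => isClosed_closure, fun i q hq => ?_, fun i j hij => ?_⟩
  · have hxi : blowDownMap h q ∈ S i.succ := pullback_subset h (hS.isClosed _) hq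
    obtain ⟨w, hw⟩ := hS.retract _ _ hxi
    by_cases hx : blowDownMap h q ∈ S 0
    · obtain ⟨w', hw', he⟩ := hw.exists_division hr hx (hS.subset_of_nonempty hmin hx hxi)
      exact ⟨w', hw.blowUp_of_mem hr hx hw' he fun l =>
        (hr.vanishNear_pullback (hw.vanish l) (hw' l) (he l)).eq_zero hq⟩
    · exact ⟨_, hw.blowUp_of_notMem hx⟩
  · obtain ⟨q₀, hqi, hqj⟩ := hij
    obtain ⟨m, hm, hdec⟩ := hS.meet i.succ j.succ ⟨blowDownMap h q₀,
      pullback_subset h (hS.isClosed _) hqi, pullback_subset h (hS.isClosed _) hqj⟩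
    have key := fun q hqi hqj => hS.meet_pullback hmin h hr hm hdec (q := q) hqi hqj
    cases m using Fin.cases with
    -- The pull-back of `S 0` to its own blow-up is empty, so the intersection cannot come from the
    -- index `0`, which is no longer in the tuple.
    | zero =>
      have := (key q₀ hqi hqj).1
      simp [Corners.pullback] at this
    | succ m =>
      have heq : Corners.pullback h (S m.succ) =
          Corners.pullback h (S i.succ) ∩ Corners.pullback h (S j.succ) := by
        refine Subset.antisymm (fun q hq => ⟨?_, ?_⟩) fun q hq => (key q hq.1 hq.2).1
        · refine closure_mono (preimage_mono (sdiff_subset_sdiff_left ?_)) hq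
          exact hm ▸ inter_subset_left
        · refine closure_mono (preimage_mono (sdiff_subset_sdiff_left ?_)) hq
          exact hm ▸ inter_subset_right
      refine ⟨m, heq, fun q hq => ?_⟩
      rw [heq] at hq
      exact (key q hq.1 hq.2).2

end GoodFamily

end Family

/-! ### The common factor on the iterated blow-up. -/

section Iterate

variable {n : ℕ}

/-- With the constant `1` for the empty tuple, the case of a single entry fits the recursion for
longer tuples. -/
theorem IsSmoothedDistanceTuple.exists_succ : ∀ {k : ℕ} {N : CornerSpace.{u} n}
    {S : Fin (k + 1) → Set N} {hs : IsSuitable (k + 1) N S} {ρ : N → ℝ},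
    IsSmoothedDistanceTuple (k + 1) N S hs ρ → ∃ r ρ', IsSmoothedDistance hs.fst r ∧
      IsSmoothedDistanceTuple k (blowUp hs.fst) (fun i => pullback hs.fst (S i.succ)) hs.snd ρ' ∧
      ∀ y, ρ (blowDownMap hs.fst y) = r (blowDownMap hs.fst y) * ρ' y
  | 0, _, _, _, ρ, h => ⟨ρ, fun _ => 1, h, fun _ => rfl, fun _ => (mul_one _).symm⟩
  | _ + 1, _, _, _, _, h => h.2

theorem contMDiff_iteratedBlowDown : ∀ (k : ℕ) (N : CornerSpace.{u} n) [IsManifold (quad n) ∞ N]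
    (S : Fin k → Set N) (hs : IsSuitable k N S),
    ContMDiff (quad n) (quad n) ∞ (iteratedBlowDown k N S hs)
  | 0, _, _, _, _ => contMDiff_id
  | k + 1, _, _, _, hs => (contMDiff_blowDownMap hs.fst).comp
      (contMDiff_iteratedBlowDown k (blowUp hs.fst) _ hs.snd)

theorem SmoothNear.comp_iteratedBlowDown {k : ℕ} {N : CornerSpace.{u} n} [IsManifold (quad n) ∞ N]
    {S : Fin k → Set N} {hs : IsSuitable k N S} {f : N → ℝ} {q : iteratedBlowUp k N S hs}
    (hf : SmoothNear f (iteratedBlowDown k N S hs q)) :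
    SmoothNear (fun p => f (iteratedBlowDown k N S hs p)) q :=
  hf.comp (Filter.Eventually.of_forall fun p => contMDiff_iteratedBlowDown k N S hs p)

theorem eventually_iteratedBlowDown {k : ℕ} {N : CornerSpace.{u} n} [IsManifold (quad n) ∞ N]
    {S : Fin k → Set N} {hs : IsSuitable k N S} {p : N → Prop} {q : iteratedBlowUp k N S hs}
    (hp : ∀ᶠ x in 𝓝 (iteratedBlowDown k N S hs q), p x) :
    ∀ᶠ y in 𝓝 q, p (iteratedBlowDown k N S hs y) :=
  (contMDiff_iteratedBlowDown k N S hs).continuous.continuousAt.eventually hp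

theorem IsSmoothedDistanceTuple.smoothNear_lift : ∀ {k : ℕ} {N : CornerSpace.{u} n}
    [IsManifold (quad n) ∞ N] {S : Fin k → Set N} {hs : IsSuitable k N S} {ρ : N → ℝ},
    IsSmoothedDistanceTuple k N S hs ρ → ∀ q,
      SmoothNear (fun p => ρ (iteratedBlowDown k N S hs p)) q
  | 0, _, _, _, _, ρ, h, q =>
    (SmoothNear.const 1 q).congr (Filter.Eventually.of_forall fun p => h p)
  | k + 1, N, _, S, hs, ρ, h, q => by
    obtain ⟨r, ρ', hr, hρ', heq⟩ := h.exists_succ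
    have h1 := (hr.smoothNear_lift (iteratedBlowDown k (blowUp hs.fst) _ hs.snd q)).comp_iteratedBlowDown
    have h2 := hρ'.smoothNear_lift q
    exact (h1.mul h2).congr (Filter.Eventually.of_forall fun p => heq _)

/-- On the iterated blow-up, the functions that define a member `S j` of the family have a common
factor `g`, which divides the smoothed distance function, and the quotients have no common zero. -/
theorem exists_common_factor : ∀ (k : ℕ) (N : CornerSpace.{u} n) [IsManifold (quad n) ∞ N]
    (S : Fin k → Set N) (hs : IsSuitable k N S), IsAdmissible k N S → GoodFamily S →
    ∀ ρ, IsSmoothedDistanceTuple k N S hs ρ → ∀ (j : Fin k) (q : iteratedBlowUp k N S hs)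
      (w : Fin n → N → ℝ), RetractAt (S j) (iteratedBlowDown k N S hs q) w →
    ∃ (g e : iteratedBlowUp k N S hs → ℝ) (v : Fin n → iteratedBlowUp k N S hs → ℝ),
      SmoothNear g q ∧ SmoothNear e q ∧ (∀ l, SmoothNear (v l) q) ∧ (∃ l, v l q ≠ 0) ∧
      (∀ᶠ p in 𝓝 q, 0 ≤ g p) ∧
      (∀ l, ∀ᶠ p in 𝓝 q, w l (iteratedBlowDown k N S hs p) = g p * v l p) ∧
      ∀ᶠ p in 𝓝 q, ρ (iteratedBlowDown k N S hs p) = g p * e p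
  | 0, _, _, _, _, _, _, _, _, j, _, _, _ => j.elim0
  | k + 1, N, _, S, hs, hadm, hS, ρ, hρ, j, q, w, hw => by
    obtain ⟨r, ρ', hr, hρ', heq⟩ := hρ.exists_succ
    obtain ⟨h, hmin, hadm'⟩ := hadm
    have hS' := hS.pullback hmin hs.fst hr
    set b : iteratedBlowUp (k + 1) N S hs → blowUp hs.fst :=
      iteratedBlowDown k (blowUp hs.fst) (fun i => pullback hs.fst (S i.succ)) hs.snd with hb
    have hxj : blowDownMap hs.fst (b q) ∈ S j := hw.mem_of_isClosed (hS.isClosed j)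
    have hsρ' : SmoothNear (fun p => ρ' (b p)) q := hρ'.smoothNear_lift q
    have hsr : SmoothNear (fun p => r (blowDownMap hs.fst (b p))) q :=
      (hr.smoothNear_lift (b q)).comp_iteratedBlowDown
    by_cases hx : blowDownMap hs.fst (b q) ∈ S 0
    · obtain ⟨w', hw', he⟩ :=
        RetractAt.exists_division hr (q := b q) hw hx (hS.subset_of_nonempty hmin hx hxj)
      have heb : ∀ l, ∀ᶠ p in 𝓝 q, w l (blowDownMap hs.fst (b p)) =
          r (blowDownMap hs.fst (b p)) * w' l (b p) := fun l => eventually_iteratedBlowDown (he l)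
      -- If all quotients vanish, `b q` lies on the pull-back of `S j` and the induction hypothesis
      -- applies to them; otherwise `r` is already the whole common factor, with cofactor `ρ'` in
      -- `ρ`.
      by_cases h0 : ∀ l, w' l (b q) = 0
      · have hret := RetractAt.blowUp_of_mem hr (q := b q) hw hx hw' he h0
        cases j using Fin.cases with
        -- The pull-back of `S 0` is empty, so for `j = 0` the quotients cannot all vanish.
        | zero =>
          have := hret.mem_of_isClosed isClosed_closure
          simp [pullback] at this
        | succ j =>
          obtain ⟨g, e, v, hg, hes, hv, hv0, hg0, hwv, hρe⟩ :=
            exists_common_factor k (blowUp hs.fst) _ hs.snd hadm' hS' ρ' hρ' j q w' hret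
          -- The distance function divided out of the generators joins the common factor: `ρ = r *
          -- ρ' = (r * g) * e`.
          refine ⟨fun p => r (blowDownMap hs.fst (b p)) * g p, e, v, hsr.mul hg, hes, hv, hv0, ?_,
            fun l => ?_, ?_⟩
          · filter_upwards [hg0] with p hp using mul_nonneg (hr.nonneg _) hp
          · filter_upwards [heb l, hwv l] with p h1 h2
            refine (h1.trans ?_ : w l (blowDownMap hs.fst (b p)) = _)
            rw [mul_assoc, ← h2]
          · filter_upwards [hρe] with p h1
            refine ((heq (b p)).trans ?_ : ρ (blowDownMap hs.fst (b p)) = _)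
            rw [mul_assoc, ← h1]
      · push Not at h0
        exact ⟨fun p => r (blowDownMap hs.fst (b p)), fun p => ρ' (b p), fun l p => w' l (b p), hsr,
          hsρ', fun l => (hw' l).comp_iteratedBlowDown, h0,
          Filter.Eventually.of_forall fun p => hr.nonneg _, heb,
          Filter.Eventually.of_forall fun p => heq (b p)⟩
    · have hret := RetractAt.blowUp_of_notMem (q := b q) hw hx
      cases j using Fin.cases with
      | zero => exact absurd hxj hx
      | succ j =>
        obtain ⟨g, e, v, hg, hes, hv, hv0, hg0, hwv, hρe⟩ :=
          exists_common_factor k (blowUp hs.fst) _ hs.snd hadm' hS' ρ' hρ' j q _ hret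
        -- Off `S 0` nothing is divided out, so `r` goes into the cofactor of `ρ`.
        refine ⟨g, fun p => r (blowDownMap hs.fst (b p)) * e p, v, hg, hsr.mul hes, hv, hv0, hg0,
          hwv, ?_⟩
        filter_upwards [hρe] with p h1
        refine ((heq (b p)).trans ?_ : ρ (blowDownMap hs.fst (b p)) = _)
        rw [mul_left_comm, ← h1]

end Iterate

/-! ### Clean intersections and sums of ideals. -/

section Clean

variable {n : ℕ} {N : CornerSpace.{u} n}

/-- The differential of a function. -/
def differential (f : N → ℝ) (x : N) : TangentSpace (quad n) x →L[ℝ] ℝ :=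
  mfderiv (quad n) 𝓘(ℝ, ℝ) f x

theorem SmoothNear.hasMFDerivAt {f : N → ℝ} {x : N} (hf : SmoothNear f x) :
    HasMFDerivAt (quad n) 𝓘(ℝ, ℝ) f x (differential f x) :=
  (hf.contMDiffAt.mdifferentiableAt (by simp)).hasMFDerivAt

/-- The product rule at a common zero of the `z m`: the terms with the differentials of the
coefficients drop out. -/
theorem differential_sum_mul {f : N → ℝ} {z c : Fin n → N → ℝ} {x : N}
    (hz : ∀ m, SmoothNear (z m) x) (hz0 : ∀ m, z m x = 0) (hc : ∀ m, SmoothNear (c m) x)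
    (hf : ∀ᶠ p in 𝓝 x, f p = ∑ m, z m p * c m p) (v : TangentSpace (quad n) x) :
    differential f x v = ∑ m, c m x * differential (z m) x v := by
  have h1 := HasMFDerivAt.sum (t := Finset.univ)
    fun m _ => (hz m).hasMFDerivAt.mul (hc m).hasMFDerivAt
  have h2 := h1.congr_of_eventuallyEq (f₁ := f) (by
    filter_upwards [hf] with p hp
    rw [hp, Finset.sum_apply]
    rfl)
  have h3 : differential f x =
      ∑ m, (z m x • differential (c m) x + c m x • differential (z m) x) := h2.mfderiv
  rw [h3, _root_.sum_apply]
  refine Finset.sum_congr rfl fun m _ => ?_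
  rw [hz0 m, zero_smul, zero_add]
  rfl

open Classical in
theorem IsAdapted.differential_definingFun {P : Set N} {K J : Set (Fin n)}
    {φ : PartialEquiv N (Eu n)} (h : IsAdapted P K J φ) {x : N} (hx : x ∈ φ.source) (l : Fin n)
    (v : TangentSpace (quad n) x) :
    differential (definingFun J φ l) x v = if l ∈ J then dChart φ x v l else 0 := by
  by_cases hl : l ∈ J
  · have h1 : HasMFDerivAt (quad n) 𝓘(ℝ, ℝ) (fun p => (EuclideanSpace.proj l : Eu n →L[ℝ] ℝ) (φ p))
        x ((EuclideanSpace.proj l : Eu n →L[ℝ] ℝ).comp (dChart φ x)) :=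
      HasMFDerivAt.comp x (EuclideanSpace.proj l : Eu n →L[ℝ] ℝ).hasMFDerivAt
        (h.mdifferentiableAt hx).hasMFDerivAt
    have h2 := h1.congr_of_eventuallyEq (f₁ := definingFun J φ l)
      (Filter.Eventually.of_forall fun p => by simp [definingFun, hl])
    rw [if_pos hl, differential, h2.mfderiv]
    rfl
  · have h1 : HasMFDerivAt (quad n) 𝓘(ℝ, ℝ) (fun _ : N => (0 : ℝ)) x 0 := hasMFDerivAt_const _ _
    have h2 := h1.congr_of_eventuallyEq (f₁ := definingFun J φ l)
      (Filter.Eventually.of_forall fun p => by simp [definingFun, hl])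
    rw [if_neg hl, differential, h2.mfderiv]
    rfl

theorem SmoothNear.prod {ι : Type*} (s : Finset ι) {f : ι → N → ℝ} {q : N}
    (hf : ∀ j, SmoothNear (f j) q) : SmoothNear (fun p => ∏ j ∈ s, f j p) q := by
  classical
  induction s using Finset.induction_on with
  | empty => simpa using SmoothNear.const 1 q
  | insert a s ha ih => simpa [Finset.prod_insert ha] using (hf a).mul ih

theorem SmoothNear.det {T : N → Matrix (Fin n) (Fin n) ℝ} {q : N}
    (hT : ∀ i j, SmoothNear (fun p => T p i j) q) : SmoothNear (fun p => (T p).det) q := by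
  simp only [Matrix.det_apply']
  exact SmoothNear.sum _ fun σ => (SmoothNear.const _ q).mul (SmoothNear.prod _ fun i => hT _ _)

theorem SmoothNear.adjugate {T : N → Matrix (Fin n) (Fin n) ℝ} {q : N}
    (hT : ∀ i j, SmoothNear (fun p => T p i j) q) (i j : Fin n) :
    SmoothNear (fun p => (T p).adjugate i j) q := by
  simp only [Matrix.adjugate_apply]
  refine SmoothNear.det fun a b => ?_
  simp only [Matrix.updateRow_apply]
  split_ifs
  · exact SmoothNear.const _ q
  · exact hT a b

/-- If a matrix of functions has injective value at `x`, then it has a left inverse near `x`. -/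
theorem exists_leftInverse_near {ι : Type} [Fintype ι] {B : N → Matrix ι (Fin n) ℝ} {x : N}
    (hB : ∀ a m, SmoothNear (fun p => B p a m) x) (hinj : Injective (B x).mulVec) :
    ∃ R : Fin n → ι → N → ℝ, (∀ m a, SmoothNear (R m a) x) ∧
      ∀ᶠ p in 𝓝 x, ∀ z : Fin n → ℝ, ∀ m, z m = ∑ a, R m a p * (B p).mulVec z a := by
  classical
  obtain ⟨g, hg⟩ := (B x).mulVecLin.exists_leftInverse_of_injective
    (LinearMap.ker_eq_bot.2 hinj)
  set L := LinearMap.toMatrix' g with hL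
  have hLB : L * B x = 1 := by
    have := congrArg LinearMap.toMatrix' hg
    rwa [LinearMap.toMatrix'_comp, ← Matrix.toLin'_apply', LinearMap.toMatrix'_toLin',
      LinearMap.toMatrix'_id] at this
  have hT : ∀ i j, SmoothNear (fun p => (L * B p) i j) x := fun i j => by
    simp only [Matrix.mul_apply]
    exact SmoothNear.sum _ fun a => (SmoothNear.const _ x).mul (hB a j)
  have hdet := SmoothNear.det hT
  have hdet0 : (L * B x).det ≠ 0 := by rw [hLB, Matrix.det_one]; exact one_ne_zero
  -- `L` is a constant left inverse of `B x`. Nearby, `L * B p` remains invertible, and Cramer's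
  -- formula for its inverse, multiplied by `L`, is smooth in `p`.
  refine ⟨fun m a p => ((L * B p).adjugate * L) m a / (L * B p).det, fun m a => ?_, ?_⟩
  · refine SmoothNear.div ?_ hdet hdet0
    simp only [Matrix.mul_apply (M := Matrix.adjugate _)]
    exact SmoothNear.sum _ fun i => (SmoothNear.adjugate hT m i).mul (SmoothNear.const _ x)
  · filter_upwards [hdet.continuousAt.eventually_ne hdet0] with p hp z m
    have h1 : (((L * B p).adjugate * L).mulVec ((B p).mulVec z)) m = (L * B p).det * z m := by
      rw [Matrix.mulVec_mulVec, Matrix.mul_assoc, Matrix.adjugate_mul, Matrix.smul_mulVec,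
        Matrix.one_mulVec]
      rfl
    have h2 : ∑ a, ((L * B p).adjugate * L) m a / (L * B p).det * (B p).mulVec z a =
        (((L * B p).adjugate * L).mulVec ((B p).mulVec z)) m / (L * B p).det := by
      simp only [Matrix.mulVec, dotProduct, Finset.sum_div]
      exact Finset.sum_congr rfl fun a _ => by ring
    rw [h2, h1, mul_div_cancel_left₀ _ hp]

open Classical in
/-- Functions that vanish on a clean intersection are sums of functions that vanish on the
two submanifolds. -/
theorem exists_add_of_clean {P Q : Set N} (hP : IsPSubmanifold (n := n) P)
    (hQ : IsPSubmanifold (n := n) Q) (hPQ : IsPSubmanifold (n := n) (P ∩ Q)) {x : N}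
    (hx : x ∈ P ∩ Q)
    (hclean : tangentSpan (n := n) (P ∩ Q) x = tangentSpan P x ⊓ tangentSpan Q x) {f : N → ℝ}
    (hf : SmoothNear f x) (hf0 : VanishNear (P ∩ Q) f x) :
    ∃ f₁ f₂, SmoothNear f₁ x ∧ SmoothNear f₂ x ∧ VanishNear P f₁ x ∧ VanishNear Q f₂ x ∧
      ∀ᶠ p in 𝓝 x, f p = f₁ p + f₂ p := by
  obtain ⟨K₁, J₁, φ₁, h₁, hx₁⟩ := hP x hx.1
  obtain ⟨K₂, J₂, φ₂, h₂, hx₂⟩ := hQ x hx.2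
  obtain ⟨K, J, φ, h, hxφ⟩ := hPQ x hx
  have ret₁ := h₁.retractAt hx₁ hx.1
  have ret₂ := h₂.retractAt hx₂ hx.2
  have ret := h.retractAt hxφ hx
  set v₁ := definingFun J₁ φ₁ with hv₁
  set v₂ := definingFun J₂ φ₂ with hv₂
  set z := definingFun J φ with hz
  choose c₁ hc₁ e₁ using fun l => ret.exists_eq_sum (ret₁.smooth l)
    ((ret₁.vanish l).mono inter_subset_left)
  choose c₂ hc₂ e₂ using fun l => ret.exists_eq_sum (ret₂.smooth l)
    ((ret₂.vanish l).mono inter_subset_right)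
  -- The first two blocks express `v₁` and `v₂` through the generators `z` of the ideal of `P ∩ Q`.
  -- The third selects the indices outside `J`, where `z` is identically zero. A left inverse of `B`
  -- then expresses `z` through `v₁` and `v₂`.
  let B : N → Matrix (Fin n ⊕ Fin n ⊕ Fin n) (Fin n) ℝ := fun p =>
    Sum.elim (fun l m => c₁ l m p) (Sum.elim (fun l m => c₂ l m p)
      fun l m => if l ∉ J ∧ m = l then 1 else 0)
  have hB : ∀ a m, SmoothNear (fun p => B p a m) x := by
    rintro (l | l | l) m
    · exact hc₁ l m
    · exact hc₂ l m
    · exact SmoothNear.const _ x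
  -- Here cleanness enters. A kernel vector is the image under `dφ` of a tangent vector `V` that the
  -- differentials of `v₁` and `v₂` annihilate. So `V` is tangent to `P` and to `Q`, hence to `P ∩
  -- Q`, and its coordinates in `J` vanish; those outside `J` vanish by the third block.
  have hinj : Injective (B x).mulVec := by
    intro ξ₁ ξ₂ hξ₁₂
    rw [← sub_eq_zero]
    have hξ : (B x).mulVec (ξ₁ - ξ₂) = 0 := by rw [Matrix.mulVec_sub, hξ₁₂, sub_self]
    generalize ξ₁ - ξ₂ = ξ at hξ
    have k₁ : ∀ l, ∑ m, c₁ l m x * ξ m = 0 := fun l => congrFun hξ (.inl l)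
    have k₂ : ∀ l, ∑ m, c₂ l m x * ξ m = 0 := fun l => congrFun hξ (.inr (.inl l))
    have k₃ : ∀ l ∉ J, ξ l = 0 := fun l hl => by
      have : ∑ m, (if l ∉ J ∧ m = l then (1 : ℝ) else 0) * ξ m = 0 :=
        congrFun hξ (.inr (.inr l))
      simpa [hl] using this
    obtain ⟨V, hV⟩ := h.dChart_surjective hxφ (WithLp.toLp 2 ξ)
    have hdz : ∀ m, differential (z m) x V = ξ m := by
      intro m
      rw [hz, h.differential_definingFun hxφ, hV]
      by_cases hm : m ∈ J
      · simp [hm]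
      · simp [hm, k₃ m hm]
    have hV₁ : V ∈ tangentSpan P x := by
      refine (h₁.mem_tangentSpan_iff hx₁ hx.1 V).2 fun l hl => ?_
      have a1 := differential_sum_mul ret.smooth ret.zero (hc₁ l) (e₁ l) V
      simp only [hdz] at a1
      rw [k₁ l, hv₁, h₁.differential_definingFun hx₁, if_pos hl] at a1
      exact a1
    have hV₂ : V ∈ tangentSpan Q x := by
      refine (h₂.mem_tangentSpan_iff hx₂ hx.2 V).2 fun l hl => ?_
      have a1 := differential_sum_mul ret.smooth ret.zero (hc₂ l) (e₂ l) V
      simp only [hdz] at a1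
      rw [k₂ l, hv₂, h₂.differential_definingFun hx₂, if_pos hl] at a1
      exact a1
    have hVR : V ∈ tangentSpan (P ∩ Q) x := hclean ▸ ⟨hV₁, hV₂⟩
    ext m
    by_cases hm : m ∈ J
    · have := (h.mem_tangentSpan_iff hxφ hx V).1 hVR m hm
      rw [hV] at this
      exact this
    · exact k₃ m hm
  obtain ⟨R, hR, hRB⟩ := exists_leftInverse_near hB hinj
  obtain ⟨c, hc, hfc⟩ := ret.exists_eq_sum hf hf0
  refine ⟨fun p => ∑ l, v₁ l p * ∑ m, R m (.inl l) p * c m p,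
    fun p => ∑ l, v₂ l p * ∑ m, R m (.inr (.inl l)) p * c m p,
    SmoothNear.sum _ fun l => (ret₁.smooth l).mul (SmoothNear.sum _ fun m => (hR _ _).mul (hc m)),
    SmoothNear.sum _ fun l => (ret₂.smooth l).mul (SmoothNear.sum _ fun m => (hR _ _).mul (hc m)),
    VanishNear.sum_mul ret₁.vanish, VanishNear.sum_mul ret₂.vanish, ?_⟩
  filter_upwards [hfc, hRB, Filter.eventually_all.2 e₁, Filter.eventually_all.2 e₂]
    with p a1 a2 a3 a4
  have b1 : ∀ l, (B p).mulVec (fun m => z m p) (.inl l) = v₁ l p := fun l => by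
    rw [a3 l]
    change ∑ m, c₁ l m p * z m p = _
    exact Finset.sum_congr rfl fun m _ => mul_comm _ _
  have b2 : ∀ l, (B p).mulVec (fun m => z m p) (.inr (.inl l)) = v₂ l p := fun l => by
    rw [a4 l]
    change ∑ m, c₂ l m p * z m p = _
    exact Finset.sum_congr rfl fun m _ => mul_comm _ _
  have b3 : ∀ l, (B p).mulVec (fun m => z m p) (.inr (.inr l)) = 0 := fun l => by
    change ∑ m, (if l ∉ J ∧ m = l then (1 : ℝ) else 0) * z m p = 0
    refine Finset.sum_eq_zero fun m _ => ?_
    split_ifs with hm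
    · simp [hz, definingFun, hm.2, hm.1]
    · rw [zero_mul]
  have b4 : ∀ m, z m p = ∑ l, R m (.inl l) p * v₁ l p + ∑ l, R m (.inr (.inl l)) p * v₂ l p := by
    intro m
    rw [a2 (fun m => z m p) m, Fintype.sum_sum_type, Fintype.sum_sum_type]
    simp [b1, b2, b3]
  rw [a1]
  simp only [b4, add_mul, Finset.sum_add_distrib, Finset.sum_mul, Finset.mul_sum]
  congr 1
  · rw [Finset.sum_comm]
    exact Finset.sum_congr rfl fun l _ => Finset.sum_congr rfl fun m _ => by ring
  · rw [Finset.sum_comm]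
    exact Finset.sum_congr rfl fun l _ => Finset.sum_congr rfl fun m _ => by ring

theorem IsCleanSemilattice.goodFamily {k : ℕ} {S : Fin k → Set N}
    (hS : IsCleanSemilattice (range S)) : GoodFamily S := by
  refine ⟨fun i => (hS.isClosedPSubmanifold _ (mem_range_self i)).isClosed, fun i x hx => ?_,
    fun i j _ => ?_⟩
  · obtain ⟨K, J, φ, h, hxφ⟩ := (hS.isClosedPSubmanifold _ (mem_range_self i)).isPSubmanifold x hx
    exact ⟨_, h.retractAt hxφ hx⟩
  · obtain ⟨m, hm⟩ := hS.inter_mem _ (mem_range_self i) _ (mem_range_self j)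
    refine ⟨m, hm, fun x hx f hf hf0 => ?_⟩
    rw [hm] at hx hf0
    exact exists_add_of_clean (hS.isClosedPSubmanifold _ (mem_range_self i)).isPSubmanifold
      (hS.isClosedPSubmanifold _ (mem_range_self j)).isPSubmanifold
      (hm ▸ (hS.isClosedPSubmanifold _ (mem_range_self m)).isPSubmanifold) hx
      (hS.clean _ (mem_range_self i) _ (mem_range_self j) x hx) hf hf0

end Clean

/-! ### Local quotients and their global extension. -/

section Quotient

variable {n : ℕ}

theorem dense_iteratedBlowDown_preimage : ∀ (k : ℕ) (N : CornerSpace.{u} n)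
    [IsManifold (quad n) ∞ N] (S : Fin k → Set N) (hs : IsSuitable k N S) (V : Set N),
    IsOpen V → Dense V → Dense (iteratedBlowDown k N S hs ⁻¹' V)
  | 0, _, _, _, _, _, _, h => h
  | k + 1, _, _, S, hs, _, hV, h =>
    (dense_iteratedBlowDown_preimage k (blowUp hs.fst) _ hs.snd _ (isOpen_preimage_sdiff hV)
      (dense_preimage_blowDownMap hs.fst h)).mono
      (preimage_mono (preimage_mono sdiff_subset) : (_ : Set (iteratedBlowUp k (blowUp hs.fst)
        (fun i => pullback hs.fst (S i.succ)) hs.snd)) ⊆ _)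

theorem notMem_iUnion_of_notMem_pullback {k : ℕ} {N : CornerSpace.{u} n} {S : Fin (k + 1) → Set N}
    (h : IsClosedPSubmanifold (S 0)) {y : blowUp h}
    (hy : y ∉ ⋃ i : Fin k, pullback h (S i.succ)) (hy0 : blowDownMap h y ∉ S 0) :
    blowDownMap h y ∉ ⋃ i, S i := by
  intro hm
  obtain ⟨i, hi⟩ := mem_iUnion.1 hm
  cases i using Fin.cases with
  | zero => exact hy0 hi
  | succ i => exact hy (mem_iUnion.2 ⟨i, subset_closure ⟨hi, hy0⟩⟩)

/-- A point of `[N : S 0]` that avoids the exceptional set and all the pull-backs lies over the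
complement of the union. Both conditions hold on dense subsets of the iterated blow-up, and the
first is open. -/
theorem dense_preimage_compl_iUnion : ∀ (k : ℕ) (N : CornerSpace.{u} n)
    [IsManifold (quad n) ∞ N] (S : Fin k → Set N) (hs : IsSuitable k N S), (∀ i, IsClosed (S i)) →
    Dense (iteratedBlowDown k N S hs ⁻¹' (⋃ i, S i)ᶜ)
  | 0, N, _, S, hs, _ => by
    have : (⋃ i, S i)ᶜ = univ := by simp
    rw [this]
    exact dense_univ
  | k + 1, N, _, S, hs, hc => by
    have h1 := dense_preimage_compl_iUnion k (blowUp hs.fst)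
      (fun i => pullback hs.fst (S i.succ)) hs.snd fun _ => isClosed_closure
    have h2 := dense_iteratedBlowDown_preimage k (blowUp hs.fst)
      (fun i => pullback hs.fst (S i.succ)) hs.snd _ (isOpen_preimage_blowDownMap_compl hs.fst)
      (dense_preimage_blowDownMap_compl hs.fst)
    have h3 : IsOpen (iteratedBlowDown k (blowUp hs.fst) (fun i => pullback hs.fst (S i.succ))
        hs.snd ⁻¹' (blowDownMap hs.fst ⁻¹' (S 0)ᶜ)) :=
      (isOpen_preimage_blowDownMap_compl hs.fst).preimage
        (contMDiff_iteratedBlowDown k (blowUp hs.fst) _ hs.snd).continuous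
    exact (h1.inter_of_isOpen_right h2 h3).mono fun q hq =>
      notMem_iUnion_of_notMem_pullback hs.fst hq.1 hq.2

theorem IsSmoothedDistanceTuple.pos : ∀ {k : ℕ} {N : CornerSpace.{u} n} {S : Fin k → Set N}
    {hs : IsSuitable k N S} {ρ : N → ℝ}, IsSmoothedDistanceTuple k N S hs ρ →
    (∀ i, IsClosed (S i)) → ∀ x ∉ ⋃ i, S i, 0 < ρ x
  | 0, _, _, _, ρ, h, _, x, _ => by
    rw [show ρ x = 1 from h x]
    exact one_pos
  | k + 1, N, S, hs, ρ, h, hc, x, hx => by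
    obtain ⟨r, ρ', hr, hρ', heq⟩ := h.exists_succ
    have hx0 : x ∉ S 0 := fun h0 => hx (mem_iUnion.2 ⟨0, h0⟩)
    let y : blowUp hs.fst := (Sum.inl ⟨x, hx0⟩ : BlowUp n (S 0))
    have hy : y ∉ ⋃ i : Fin k, pullback hs.fst (S i.succ) := by
      intro hy
      obtain ⟨i, hi⟩ := mem_iUnion.1 hy
      exact hx (mem_iUnion.2 ⟨i.succ, pullback_subset hs.fst (hc _) hi⟩)
    have h1 : ρ x = r x * ρ' y := heq y
    have h2 : r x ≠ 0 := fun h0 => hx0 ((hr.eq_zero_iff y).1 h0)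
    rw [h1]
    exact mul_pos (lt_of_le_of_ne (hr.nonneg x) h2.symm)
      (hρ'.pos (fun _ => isClosed_closure) y hy)

variable {N N' : CornerSpace.{u} n} {P : Set N} {h : IsClosedPSubmanifold P} {r : N → ℝ}

theorem IsSmoothedDistance.pos_of_notMem (hr : IsSmoothedDistance h r) {x : N} (hx : x ∉ P) :
    0 < r x := by
  let y : blowUp h := (Sum.inl ⟨x, hx⟩ : BlowUp n P)
  exact lt_of_le_of_ne (hr.nonneg x) fun h0 => hx ((hr.eq_zero_iff y).1 h0.symm)

theorem IsSmoothedDistance.smoothNear_of_notMem [IsManifold (quad n) ∞ N]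
    (hr : IsSmoothedDistance h r) {x : N} (hx : x ∉ P) : SmoothNear r x := by
  let y : blowUp h := (Sum.inl ⟨x, hx⟩ : BlowUp n P)
  have hy : blowDownMap h y ∉ P := hx
  have h1 : SmoothNear (fun x' => r (blowDownMap h (blowUpLift h y x'))) x :=
    (hr.smoothNear_lift y).comp_blowUpLift hy
  refine h1.congr ?_
  filter_upwards [h.isClosed.isOpen_compl.mem_nhds hx] with x' hx'
  rw [blowDownMap_blowUpLift h y hx']

open Classical in
/-- If the functions that define `P` lift to multiples of a function `g` and one of the quotients is
positive, then the smoothed distance function lifts to a positive multiple of `g`. -/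
theorem IsSmoothedDistance.exists_eq_mul_of_factor [IsManifold (quad n) ∞ N]
    (hr : IsSmoothedDistance h r) {K J : Set (Fin n)} {φ : PartialEquiv N (Eu n)}
    (hφ : IsAdapted P K J φ) {b : N' → N} (hb : ContMDiff (quad n) (quad n) ∞ b) {q : N'}
    (hq : b q ∈ φ.source) (hqP : b q ∈ P) {D : Set N'} (hD : Dense D) (hDP : ∀ p ∈ D, b p ∉ P)
    {g : N' → ℝ} {v : Fin n → N' → ℝ} (hv : ∀ l, SmoothNear (v l) q)
    (hg : ∀ᶠ p in 𝓝 q, p ∈ D → 0 < g p)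
    (he : ∀ᶠ p in 𝓝 q, ∀ l ∈ J, φ (b p) l = g p * v l p) {i : Fin n} (hi : i ∈ J)
    (hvi : 0 < v i q) :
    ∃ E, SmoothNear E q ∧ 0 < E q ∧ ∀ᶠ p in 𝓝 q, p ∈ D → r (b p) = g p * E p := by
  have hne : Nonempty (blowUp h) := by
    obtain ⟨p, hp, -⟩ := hD.inter_nhds_nonempty (Filter.univ_mem : univ ∈ 𝓝 q)
    exact ⟨(Sum.inl ⟨b p, hDP p hp⟩ : BlowUp n P)⟩
  obtain ⟨y₀⟩ := id hne
  obtain ⟨Ψ, hΨ⟩ := exists_isProjectiveChart h hφ hi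
  have hbs : ∀ᶠ p in 𝓝 q, b p ∈ φ.source :=
    hb.continuous.continuousAt.eventually_mem (hφ.open_source.mem_nhds hq)
  have hvpos : ∀ᶠ p in 𝓝 q, 0 < v i p := continuousAt_const.eventually_lt (hv i).continuousAt hvi
  -- The factor `g` cancels from the projective coordinates of the lift of `b` to `[N : P]`. What
  -- remains is smooth even where `g` vanishes, so `b` lifts smoothly near `q`.
  set ζ : Fin n → N' → ℝ := fun l p => if l ∈ J ∧ l ≠ i then v l p / v i p else φ (b p) l with hζ
  have hζs : ∀ l, SmoothNear (ζ l) q := by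
    intro l
    by_cases hl : l ∈ J ∧ l ≠ i
    · simp only [hζ, if_pos hl]
      exact (hv l).div (hv i) hvi.ne'
    · simp only [hζ, if_neg hl]
      exact (hφ.smoothNear_coord hq l).comp (Filter.Eventually.of_forall fun p => hb p)
  set Z : N' → Eu n := fun p => WithLp.toLp 2 fun l => ζ l p with hZ
  have hZs : ∀ᶠ p in 𝓝 q, ContMDiffAt (quad n) 𝓘(ℝ, Eu n) ∞ Z p := by
    filter_upwards [Filter.eventually_all.2 hζs] with p hp using contMDiffAt_toLp hp
  have hlift : ∀ᶠ p in 𝓝 q, p ∈ D → blowUpLift h y₀ (b p) ∈ Ψ.source ∧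
      Ψ (blowUpLift h y₀ (b p)) = Z p := by
    filter_upwards [hbs, hvpos, hg, he] with p h1 h2 h3 h4 hp
    have hβ := blowDownMap_blowUpLift h y₀ (hDP p hp)
    have hpos : 0 < φ (b p) i := by
      rw [h4 i hi]
      exact mul_pos (h3 hp) h2
    have hs : blowUpLift h y₀ (b p) ∈ Ψ.source :=
      hΨ.mem_source_of_pos (by rwa [hβ]) (by rwa [hβ])
    refine ⟨hs, ?_⟩
    have e1 := hΨ.chart_blowDown hs
    have e2 := hΨ.coord_blowDown_self hs
    rw [hβ] at e1 e2
    ext l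
    change _ = ζ l p
    have e3 : φ (b p) l = blowModel J i (Ψ (blowUpLift h y₀ (b p))) l := by rw [e1]
    by_cases hl : l ∈ J ∧ l ≠ i
    · simp only [blowModel, if_pos hl] at e3
      simp only [hζ, if_pos hl]
      rw [← e2, h4 i hi, h4 l hl.1] at e3
      rw [eq_div_iff h2.ne']
      apply mul_left_cancel₀ (h3 hp).ne'
      linarith
    · simp only [blowModel, if_neg hl] at e3
      simp only [hζ, if_neg hl]
      exact e3.symm
  have hZc : ∀ᶠ p in 𝓝 q, Z p ∈ corner (insert i K) := by
    have : ∀ l, ∀ᶠ p in 𝓝 q, l ∈ insert i K → 0 ≤ ζ l p := by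
      intro l
      by_cases hl : l ∈ insert i K
      · refine ((hζs l).nonneg_of_dense hD ?_).mono fun p hp _ => hp
        filter_upwards [hlift] with p hp hpD
        obtain ⟨h1, h2⟩ := hp hpD
        have := hΨ.apply_mem h1 l hl
        rw [h2] at this
        exact this
      · exact Filter.Eventually.of_forall fun p hp => absurd hp hl
    filter_upwards [Filter.eventually_all.2 this] with p hp l hl using hp l hl
  have hmodel : blowModel J i (Z q) = φ (b q) := by
    ext l
    by_cases hl : l ∈ J ∧ l ≠ i
    · simp only [blowModel, if_pos hl]
      change ζ i q * ζ l q = _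
      simp only [hζ, if_pos hl]
      rw [if_neg (by simp), he.self_of_nhds i hi, he.self_of_nhds l hl.1]
      field_simp
    · simp only [blowModel, if_neg hl]
      change ζ l q = _
      simp only [hζ, if_neg hl]
  have hZT : Z q ∈ Ψ.target :=
    (hΨ.mem_target_iff _).2 ⟨hZc.self_of_nhds, hmodel ▸ φ.map_source hq⟩
  set y := Ψ.symm (Z q) with hy
  have hys : y ∈ Ψ.source := Ψ.map_target hZT
  have hΨy : Ψ y = Z q := Ψ.right_inv hZT
  have hβy : blowDownMap h y = b q := by
    apply φ.injOn (hΨ.blowDown_mem_source hys) hq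
    rw [hΨ.chart_blowDown hys, hΨy, hmodel]
  obtain ⟨E, hE, hE0, hrE⟩ := hr.exists_eq_mul hΨ hys (hβy.symm ▸ hqP)
  have hZlim : Filter.Tendsto Z (𝓝 q) (𝓝 (Ψ y)) := by
    rw [hΨy]
    exact hZs.self_of_nhds.continuousAt
  obtain ⟨hT, hlim⟩ := hΨ.tendsto_symm hys hZlim hZc
  have hsm : ∀ᶠ p in 𝓝 q, ContMDiffAt (quad n) (quad n) ∞ (fun p => Ψ.symm (Z p)) p := by
    filter_upwards [hZs, eventually_eventually_nhds.2 hT] with p h1 h2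
    have h3 : ContMDiffWithinAt (quad n) (quad n) ∞ (fun p => Ψ.symm (Z p))
        {p | Z p ∈ Ψ.target} p :=
      (hΨ.smooth_symm _ h2.self_of_nhds).comp (f := Z) p h1.contMDiffWithinAt fun p hp => hp
    exact h3.contMDiffAt h2
  -- Along the lift `r = Ψ i * E`, and on `D` the exceptional coordinate is `Ψ i = φ i ∘ b = g * v
  -- i`.
  refine ⟨fun p => v i p * E (Ψ.symm (Z p)), (hv i).mul (SmoothNear.comp hE hsm),
    mul_pos hvi hE0, ?_⟩
  filter_upwards [hlift, hlim.eventually hrE, he] with p h1 h2 h3 hp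
  obtain ⟨h4, h5⟩ := h1 hp
  have hβ := blowDownMap_blowUpLift h y₀ (hDP p hp)
  have h6 : Ψ.symm (Z p) = blowUpLift h y₀ (b p) := by rw [← h5, Ψ.left_inv h4]
  rw [h6, hβ] at h2
  rw [h2, h6, ← hΨ.coord_blowDown_self h4, hβ, h3 i hi, mul_assoc]

/-- Over `S j` both functions are multiples of the same `g`, namely `ρ = g * e` and `r = g * E` with
`E > 0`, so `e / E` is the extension. Elsewhere `r` is smooth and positive. -/
theorem exists_local_quotient {k : ℕ} {N : CornerSpace.{u} n} [IsManifold (quad n) ∞ N]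
    {S : Fin k → Set N} {hs : IsSuitable k N S} (hadm : IsAdmissible k N S) (hS : GoodFamily S)
    {ρ : N → ℝ} (hρ : IsSmoothedDistanceTuple k N S hs ρ) {j : Fin k}
    {h : IsClosedPSubmanifold (S j)} {r : N → ℝ} (hr : IsSmoothedDistance h r)
    (q : iteratedBlowUp k N S hs) :
    ∃ f, SmoothNear f q ∧ ∀ᶠ p in 𝓝 q, iteratedBlowDown k N S hs p ∉ ⋃ i, S i →
      f p = ρ (iteratedBlowDown k N S hs p) / r (iteratedBlowDown k N S hs p) := by
  classical
  set b := iteratedBlowDown k N S hs with hb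
  have hbs : ContMDiff (quad n) (quad n) ∞ b := contMDiff_iteratedBlowDown k N S hs
  by_cases hq : b q ∈ S j
  swap
  · exact ⟨_, (hρ.smoothNear_lift q).div (hr.smoothNear_of_notMem hq).comp_iteratedBlowDown
      (hr.pos_of_notMem hq).ne', Filter.Eventually.of_forall fun p _ => rfl⟩
  obtain ⟨K, J, φ, hφ, hx⟩ := h.isPSubmanifold _ hq
  obtain ⟨g, e, v, hg, hes, hv, ⟨i, hvi⟩, hg0, hwv, hρe⟩ :=
    exists_common_factor k N S hs hadm hS ρ hρ j q _ (hφ.retractAt hx hq)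
  set D := b ⁻¹' (⋃ i, S i)ᶜ with hD
  have hDd : Dense D := dense_preimage_compl_iUnion k N S hs hS.isClosed
  have hDP : ∀ p ∈ D, b p ∉ S j := fun p hp hj => hp (mem_iUnion.2 ⟨j, hj⟩)
  have hsrc : ∀ᶠ p in 𝓝 q, b p ∈ φ.source :=
    eventually_iteratedBlowDown (hφ.open_source.mem_nhds hx)
  have hwv' := Filter.eventually_all.2 hwv
  have hgD : ∀ᶠ p in 𝓝 q, p ∈ D → 0 < g p := by
    filter_upwards [hg0, hsrc, hwv'] with p h1 h2 h3 hp
    refine lt_of_le_of_ne h1 fun h0 => hDP p hp ((hφ.mem_iff h2).2 fun l hl => ?_)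
    have := h3 l
    rw [← h0, zero_mul, definingFun, if_pos hl] at this
    exact this
  have he : ∀ᶠ p in 𝓝 q, ∀ l ∈ J, φ (b p) l = g p * v l p := by
    filter_upwards [hwv'] with p hp l hl
    rw [← hp l, definingFun, if_pos hl]
  -- For an index outside `J` the defining function is zero, so `v i` would vanish wherever `g > 0`,
  -- on a set accumulating at `q`.
  have hi : i ∈ J := by
    by_contra hi
    have hvne := (hv i).continuousAt.eventually_ne hvi
    obtain ⟨p, hp, h1, h2, h3⟩ := hDd.inter_nhds_nonempty (hwv'.and (hvne.and hgD))
    have := h1 i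
    rw [definingFun, if_neg hi] at this
    exact mul_ne_zero (h3 hp).ne' h2 this.symm
  obtain ⟨E, hE, hE0, hrE⟩ : ∃ E, SmoothNear E q ∧ 0 < E q ∧
      ∀ᶠ p in 𝓝 q, p ∈ D → r (b p) = g p * E p := by
    -- Projective charts require a positive `i`-th coordinate. If `v i` is negative at `q`, then `i`
    -- is not a boundary coordinate, and it may be reflected.
    rcases lt_or_gt_of_ne hvi with hneg | hpos
    · have hiK : i ∉ K := by
        intro hiK
        have hvneg := (hv i).continuousAt.eventually_lt continuousAt_const hneg
        obtain ⟨p, hp, h1, h2, h3, h4⟩ :=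
          hDd.inter_nhds_nonempty (he.and (hvneg.and (hgD.and hsrc)))
        have h5 := hφ.apply_mem_corner h4 i hiK
        rw [h1 i hi] at h5
        exact absurd h5 (not_le.2 (mul_neg_of_pos_of_neg (h3 hp) h2))
      refine hr.exists_eq_mul_of_factor (hφ.flip hiK) hbs
        (by simpa [PartialEquiv.trans_source] using hx) hq hDd hDP
        (v := fun l p => if l = i then -v l p else v l p) (fun l => ?_) hgD ?_ hi (by simpa)
      · by_cases hl : l = i
        · simp only [hl, if_true]
          exact (hv i).neg
        · simp only [hl, if_false]
          exact hv l
      · filter_upwards [he] with p hp l hl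
        change flipCoord i (φ (b p)) l = _
        by_cases hli : l = i
        · subst hli
          simp [flipCoord, hp l hl]
        · simp [flipCoord, hli, hp l hl]
    · exact hr.exists_eq_mul_of_factor hφ hbs hx hq hDd hDP hv hgD he hi hpos
  refine ⟨_, hes.div hE hE0.ne', ?_⟩
  filter_upwards [hρe, hrE, hgD] with p h1 h2 h3 hp
  rw [h1, h2 hp, mul_div_mul_left _ _ (h3 hp).ne']

/-- Local smooth extensions of a function on a dense set are restrictions of a global one. -/
theorem exists_smooth_extension {D : Set N} (hD : Dense D) (f₀ : N → ℝ)
    (hloc : ∀ q, ∃ f, SmoothNear f q ∧ ∀ᶠ p in 𝓝 q, p ∈ D → f p = f₀ p) :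
    ∃ f : N → ℝ, ContMDiff (quad n) 𝓘(ℝ, ℝ) ∞ f ∧ ∀ p ∈ D, f p = f₀ p := by
  choose F hF hF0 using hloc
  -- Each point takes the value of its own local extension; by density, the extensions chosen at
  -- points near `q` agree with the one chosen at `q`.
  refine ⟨fun q => F q q, fun q => ?_, fun p hp => (hF0 p).self_of_nhds hp⟩
  refine (hF q).contMDiffAt.congr_of_eventuallyEq ?_
  filter_upwards [(hF q).eventually, eventually_eventually_nhds.2 (hF0 q)] with p h1 h2
  refine ((hF p).eq_of_dense h1 hD ?_).self_of_nhds
  filter_upwards [hF0 p, h2] with y h3 h4 hy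
  rw [h3 hy, h4 hy]

end Quotient

end Corners

end

/-! ### The extension theorem. -/

theorem mainTheorem4 {n : ℕ} {M : Type*} [TopologicalSpace M] [ConnectedSpace M]
    [ChartedSpace (EuclideanQuadrant n) M]
    [IsManifold (modelWithCornersEuclideanQuadrant n) ∞ M]
    {k : ℕ} (S : Fin k → Set M) (hinj : Function.Injective S)
    (hS : Corners.IsCleanSemilattice (M := Corners.CornerSpace.mk (n := n) M) (Set.range S))
    (hadm : Corners.IsAdmissible k (Corners.CornerSpace.mk (n := n) M) S)
    (j : Fin k) (hj : (S j).Nonempty) (r ρ : M → ℝ)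
    (hr : Corners.IsSmoothedDistance (hS.isClosedPSubmanifold (S j) (Set.mem_range_self j)) r)
    (hρ : Corners.IsSmoothedDistanceTuple k (Corners.CornerSpace.mk (n := n) M) S
      hadm.isSuitable ρ) :
    (∀ x ∉ ⋃ i, S i, 0 < ρ x / r x) ∧
    ∃ f : Corners.iteratedBlowUp k (Corners.CornerSpace.mk (n := n) M) S hadm.isSuitable → ℝ,
      ContMDiff (modelWithCornersEuclideanQuadrant n) 𝓘(ℝ, ℝ) ∞ f ∧
      ∀ x ∉ ⋃ i, S i, ∀ q,
        Corners.iteratedBlowDown k (Corners.CornerSpace.mk (n := n) M) S hadm.isSuitable q = x →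
        f q = ρ x / r x := by
  have hM : IsManifold (modelWithCornersEuclideanQuadrant n) ∞
      (Corners.CornerSpace.mk (n := n) M) := ‹_›
  have hgood := hS.goodFamily
  refine ⟨fun x hx => div_pos (hρ.pos hgood.isClosed x hx)
    (hr.pos_of_notMem fun hxj => hx (Set.mem_iUnion.2 ⟨j, hxj⟩)), ?_⟩
  let N := Corners.CornerSpace.mk (n := n) M
  obtain ⟨f, hf, hf0⟩ := Corners.exists_smooth_extension
    (N := Corners.iteratedBlowUp k N S hadm.isSuitable)
    (Corners.dense_preimage_compl_iUnion k N S hadm.isSuitable hgood.isClosed)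
    (fun q => ρ (Corners.iteratedBlowDown k N S hadm.isSuitable q) /
      r (Corners.iteratedBlowDown k N S hadm.isSuitable q))
    (fun q => Corners.exists_local_quotient hadm hgood hρ hr q)
  refine ⟨f, hf, fun x hx q hq => ?_⟩
  subst hq
  exact hf0 q hx
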